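/- Let $M$ be a smooth manifold of dimension $m\ge 1$ with a volume form $\eta$, and let $\pi\colon E\to M$ be a fibration (a smooth surjective submersion) with $\dim E=m+n$. *Notation.* For a fibration $\rho\colon N\to M$, let $\Lambda^k_2N\to N$ be the bundle of $k$-forms on $N$ that vanish whenever two of their arguments are $\rho$-vertical. It carries the Liouville form $\Theta(\omega)(X_1,\dots,X_k)=\omega(T\mathrm{pr}\,X_1,\dots,T\mathrm{pr}\,X_k)$, where $\mathrm{pr}\colon\Lambda^k_2N\to N$ is the projection, and the canonical $(k+1)$-form $-d\Theta$. The first jet manifold $J^1\rho$ consists of the linear maps $z\colon T_{\rho(y)}M\to T_yN$ $(y\in N)$ with $T_y\rho\circ z=\mathrm{id}$. Let $\nu\colon\mathcal M\pi:=\Lambda^m_2E\to E$ be the projection, let $\Omega=-d\Theta$ be the canonical $(m+1)$-form of $\mathcal M\pi$, and consider the fibration $\pi\circ\nu\colon\mathcal M\pi\to M$. Define $$\flat_\Omega\colon J^1(\pi\circ\nu)\to\Lambda^{m+1}_2(\mathcal M\pi),\qquad \flat_\Omega(z)=i_{h_z}\Omega(\omega)-(m-1)\,\Omega(\omega),$$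 where $z$ lies over $\omega\in\mathcal M\pi$, $h_z=z\circ T_\omega(\pi\circ\nu)$, and $(i_{h}\Omega)(X_1,\dots,X_{m+1})=\sum_i\Omega(X_1,\dots,h(X_i),\dots,X_{m+1})$. Let $\widetilde\Omega=\flat_\Omega^*\,\Omega_{\Lambda^{m+1}_2\mathcal M\pi}$ be the pullback to $J^1(\pi\circ\nu)$ of the canonical $(m+2)$-form of $\Lambda^{m+1}_2(\mathcal M\pi)$. A *Hamiltonian density* is a smooth fibred map $\mathcal H\colon\mathcal M\pi\to\Lambda^mM$ over $M$ which, regarded as an $m$-form on $\mathcal M\pi$, satisfies $i_{V_\mu}d\mathcal H=\eta$ (with $\eta$ pulled back to $\mathcal M\pi$), where $V_\mu$ is the infinitesimal generator of the action $(t,\omega)\mapsto t\,\eta_{\nu(\omega)}+\omega$ of $\mathbb R$ on $\mathcal M\pi$. Then $-d\mathcal H$ is a section of $\Lambda^{m+1}_2(\mathcal M\pi)\to\mathcal M\pi$. A *premultisymplectic structure of order $k+1$* on a manifold $P$ is a smooth closed $(k+1)$-form $\Omega_P$. For $1\le l\le k$, a submanifold $S\subseteq P$ is *$l$-Lagrangian*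 if for every $x\in S$ the image $W$ of $T_xS$ in the quotient $\bar V=T_xP/\{v: i_v\Omega_P(x)=0\}$, with the form $\bar\Omega$ induced by $\Omega_P(x)$, satisfies $$W=\{v\in\bar V:\ i_{v\wedge w_1\wedge\dots\wedge w_l}\bar\Omega=0\ \text{ for all } w_1,\dots,w_l\in W\}.$$ **Proposition.** The form $\widetilde\Omega$ is a premultisymplectic structure of order $m+2$ on $J^1(\pi\circ\nu)$ and, for every Hamiltonian density $\mathcal H$, the set $$S_{\mathcal H}=\flat_\Omega^{-1}\bigl(-d\mathcal H(\mathcal M\pi)\bigr)$$ is an (embedded) $(m+1)$-Lagrangian submanifold of $(J^1(\pi\circ\nu),\widetilde\Omega)$. -/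

import Mathlib

open scoped Manifold ContDiff Topology
open Set

noncomputable section

namespace TulczyjewTriple

/-! ## Multisymplectic linear algebra -/

section LinearAlgebra

variable {V : Type*} [AddCommGroup V] [Module ℝ V] {k : ℕ}

/-- `ker ♭_Ω`, where `♭_Ω v = i_v Ω`. -/
def flatKer (Ω : V [⋀^Fin (k + 1)]→ₗ[ℝ] ℝ) : Submodule ℝ V :=
  LinearMap.ker Ω.curryLeft

/-- The `(k+1)`-form `Ω` is multisymplectic: `♭_Ω` is injective. -/
def IsMultisymplectic (Ω : V [⋀^Fin (k + 1)]→ₗ[ℝ] ℝ) : Prop :=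
  Function.Injective Ω.curryLeft

/-- The `l`-orthogonal complement: all `v` with `i_{v ∧ w₁ ∧ … ∧ w_l} Ω = 0` for all
`w₁, …, w_l ∈ W` (the remaining `k - l` arguments are arbitrary). -/
def orthogonal (Ω : V [⋀^Fin (k + 1)]→ₗ[ℝ] ℝ) (l : ℕ) (W : Submodule ℝ V) : Submodule ℝ V where
  carrier := {v | ∀ w : Fin k → V, (∀ i : Fin k, (i : ℕ) < l → w i ∈ W) →
    Ω (Matrix.vecCons v w) = 0}
  add_mem' := by
    intro a b ha hb w hw
    rw [Ω.map_vecCons_add, ha w hw, hb w hw, add_zero]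
  zero_mem' := by
    intro w _
    exact Ω.map_coord_zero 0 rfl
  smul_mem' := by
    intro c a ha w hw
    rw [Ω.map_vecCons_smul, ha w hw, smul_zero]

lemma map_eq_of_sub_mem_flatKer (Ω : V [⋀^Fin (k + 1)]→ₗ[ℝ] ℝ) (v v' : Fin (k + 1) → V)
    (h : ∀ i, v i - v' i ∈ flatKer Ω) : Ω v = Ω v' := by
  classical
  have key : ∀ (w : Fin (k + 1) → V) (i : Fin (k + 1)), w i ∈ flatKer Ω → Ω w = 0 := by
    intro w i hi
    have h0 : ∀ w : Fin (k + 1) → V, w 0 ∈ flatKer Ω → Ω w = 0 := by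
      intro w hw
      have : Ω.curryLeft (w 0) (Fin.tail w) = 0 := by
        rw [LinearMap.mem_ker.1 hw]; rfl
      rw [AlternatingMap.curryLeft_apply_apply] at this
      simpa [Matrix.vecCons, Fin.cons_self_tail] using this
    by_cases hi0 : i = 0
    · subst hi0; exact h0 w hi
    · have := Ω.map_swap w (i := 0) (j := i) (Ne.symm hi0)
      rw [h0 (w ∘ Equiv.swap 0 i) (by simpa using hi)] at this
      simpa using this.symm
  have step : ∀ s : Finset (Fin (k + 1)), Ω (fun i => if i ∈ s then v' i else v i) = Ω v := by
    intro s
    induction s using Finset.induction_on with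
    | empty => simp
    | insert a s ha ih =>
      rw [← ih]
      set u : Fin (k + 1) → V := fun i => if i ∈ s then v' i else v i with hu
      have h1 : (fun i => if i ∈ insert a s then v' i else v i) =
          Function.update u a (v' a) := by
        funext i
        by_cases hia : i = a
        · subst hia; simp
        · simp [hu, hia]
      have h2 : u = Function.update u a (v a) := by
        funext i
        by_cases hia : i = a
        · subst hia; simp [hu, ha]
        · simp [Function.update_of_ne hia]
      have h3 : Ω (Function.update u a (v a)) - Ω (Function.update u a (v' a)) = 0 := by
        rw [← Ω.map_update_sub]
        exact key _ a (by simpa using h a)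
      rw [h1]
      conv_rhs => rw [h2]
      exact (sub_eq_zero.1 h3).symm
  simpa using (step Finset.univ).symm

/-- The multisymplectic form induced by `Ω` on `V ⧸ ker ♭_Ω`; see `reduce_mk`. -/
def reduce (Ω : V [⋀^Fin (k + 1)]→ₗ[ℝ] ℝ) : (V ⧸ flatKer Ω) [⋀^Fin (k + 1)]→ₗ[ℝ] ℝ :=
  Ω.compLinearMap (LinearMap.exists_rightInverse_of_surjective (flatKer Ω).mkQ
    (Submodule.range_mkQ _)).choose

/-- The reduced form is the one with `μ^* Ω̃ = Ω`, where `μ : V → V ⧸ ker ♭_Ω`. -/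
theorem reduce_mk (Ω : V [⋀^Fin (k + 1)]→ₗ[ℝ] ℝ) :
    (reduce Ω).compLinearMap (flatKer Ω).mkQ = Ω := by
  ext v
  have hs := (LinearMap.exists_rightInverse_of_surjective (flatKer Ω).mkQ
    (Submodule.range_mkQ _)).choose_spec
  refine map_eq_of_sub_mem_flatKer Ω _ _ fun i => ?_
  rw [← Submodule.Quotient.eq, ← Submodule.mkQ_apply, ← Submodule.mkQ_apply]
  exact LinearMap.congr_fun hs ((flatKer Ω).mkQ (v i))

theorem reduce_isMultisymplectic (Ω : V [⋀^Fin (k + 1)]→ₗ[ℝ] ℝ) :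
    IsMultisymplectic (reduce Ω) := by
  unfold IsMultisymplectic
  rw [← LinearMap.ker_eq_bot, LinearMap.ker_eq_bot']
  intro a ha
  obtain ⟨v, rfl⟩ := Submodule.mkQ_surjective _ a
  rw [Submodule.mkQ_apply, Submodule.Quotient.mk_eq_zero]
  refine LinearMap.mem_ker.2 ?_
  ext w
  have h1 : reduce Ω (Matrix.vecCons ((flatKer Ω).mkQ v) (fun i => (flatKer Ω).mkQ (w i))) = 0 := by
    rw [← AlternatingMap.curryLeft_apply_apply, ha]; rfl
  have h2 := congrArg (fun f => f (Matrix.vecCons v w)) (reduce_mk Ω)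
  rw [AlternatingMap.curryLeft_apply_apply, ← h2]
  simp only [AlternatingMap.compLinearMap_apply, AlternatingMap.zero_apply]
  rw [← h1]
  congr 1
  funext i
  refine Fin.cases ?_ (fun j => ?_) i <;> simp

/-- `W` is an `l`-Lagrangian subspace of the premultisymplectic vector space `(V, Ω)`:
its image in the multisymplectic vector space `V ⧸ ker ♭_Ω` equals its `l`-orthogonal. -/
def IsLagrangian (Ω : V [⋀^Fin (k + 1)]→ₗ[ℝ] ℝ) (l : ℕ) (W : Submodule ℝ V) : Prop :=
  W.map (flatKer Ω).mkQ = orthogonal (reduce Ω) l (W.map (flatKer Ω).mkQ)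

end LinearAlgebra

/-! ## Forms and submanifolds of a smooth manifold -/

section Manifolds

variable {V : Type*} [NormedAddCommGroup V] [NormedSpace ℝ V]
  {V' : Type*} [NormedAddCommGroup V'] [NormedSpace ℝ V']
  {N : Type*} [TopologicalSpace N] [ChartedSpace V N]
  {N' : Type*} [TopologicalSpace N'] [ChartedSpace V' N'] {k : ℕ}

variable (V N) in
/-- (Not necessarily smooth) `k`-forms on a manifold `N` modelled on `V`. -/
abbrev KForm (k : ℕ) : Type _ := ∀ x : N, TangentSpace 𝓘(ℝ, V) x [⋀^Fin k]→L[ℝ] ℝ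

/-- The expression of a form in the chart at `x`, i.e. its pullback by the inverse chart. -/
def chartRep (α : KForm V N k) (x : N) (y : V) : V [⋀^Fin k]→L[ℝ] ℝ :=
  (α ((chartAt V x).symm y)).compContinuousLinearMap
    (mfderiv 𝓘(ℝ, V) 𝓘(ℝ, V) (chartAt V x).symm y)

/-- Smoothness of a form: its coefficients in charts are smooth. -/
def IsSmoothForm (α : KForm V N k) : Prop :=
  ∀ x : N, ContDiffOn ℝ ∞ (chartRep α x) (chartAt V x).target

/-- The exterior derivative, computed in the chart at `x`. -/
def extD (α : KForm V N k) : KForm V N (k + 1) := fun x =>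
  (extDeriv (chartRep α x) (chartAt V x x)).compContinuousLinearMap
    (mfderiv 𝓘(ℝ, V) 𝓘(ℝ, V) (chartAt V x) x)

/-- The pullback `f^* α`. -/
def pullback (f : N → N') (α : KForm V' N' k) : KForm V N k := fun x =>
  (α (f x)).compContinuousLinearMap (mfderiv 𝓘(ℝ, V) 𝓘(ℝ, V') f x)

/-- A premultisymplectic structure of order `k`: a closed smooth `k`-form. -/
def IsPremultisymplectic (Ω : KForm V N k) : Prop :=
  IsSmoothForm Ω ∧ ∀ x, extD Ω x = 0

variable (V) in
/-- `S` is an embedded submanifold of `N`: for some dimension `d`, around every point of `S`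
there is a chart of `N` in which `S` is a `d`-dimensional linear slice. -/
def IsEmbeddedSubmanifold (S : Set N) : Prop :=
  ∃ d : ℕ, ∀ x ∈ S, ∃ φ ∈ IsManifold.maximalAtlas 𝓘(ℝ, V) ∞ N, x ∈ φ.source ∧
    ∃ L : Submodule ℝ V, Module.finrank ℝ L = d ∧
      ∀ y ∈ φ.source, y ∈ S ↔ φ y ∈ L

variable (V) in
/-- The tangent space `T_x S`, spanned by the velocities at `x` of the smooth curves in `S`. -/
def tangentSubmodule (S : Set N) (x : N) : Submodule ℝ (TangentSpace 𝓘(ℝ, V) x) :=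
  Submodule.span ℝ {v | ∃ (γ : ℝ → N) (h : γ 0 = x), ContMDiffAt 𝓘(ℝ, ℝ) 𝓘(ℝ, V) ∞ γ 0 ∧
    (∀ᶠ t in 𝓝 (0 : ℝ), γ t ∈ S) ∧ v = h ▸ mfderiv 𝓘(ℝ, ℝ) 𝓘(ℝ, V) γ 0 (1 : ℝ)}

/-- `S` is an `l`-Lagrangian submanifold of the premultisymplectic manifold `(N, Ω)`. -/
def IsLagrangianSubmanifold (Ω : KForm V N (k + 1)) (l : ℕ) (S : Set N) : Prop :=
  IsEmbeddedSubmanifold V S ∧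
    ∀ x ∈ S, IsLagrangian (Ω x).toAlternatingMap l (tangentSubmodule V S x)

end Manifolds

/-! ## Fibrations and adapted charts -/

/-- A fibration `π : E → M`: a smooth surjective submersion, where `M` is modelled on `B`,
`E` is modelled on `V`, and the fibres are modelled on `F`. -/
structure Fibration (B F V M E : Type*)
    [NormedAddCommGroup B] [NormedSpace ℝ B] [NormedAddCommGroup F] [NormedSpace ℝ F]
    [NormedAddCommGroup V] [NormedSpace ℝ V]
    [TopologicalSpace M] [ChartedSpace B M] [TopologicalSpace E] [ChartedSpace V E] where
  toFun : E → M
  surjective : Function.Surjective toFun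
  isSubmersion : Manifold.IsSubmersionOfComplement F 𝓘(ℝ, V) 𝓘(ℝ, B) ∞ toFun

section Fibrations

variable {B F V M E : Type*}
  [NormedAddCommGroup B] [NormedSpace ℝ B] [NormedAddCommGroup F] [NormedSpace ℝ F]
  [NormedAddCommGroup V] [NormedSpace ℝ V]
  [TopologicalSpace M] [ChartedSpace B M]
  [TopologicalSpace E] [ChartedSpace V E]

instance : CoeFun (Fibration B F V M E) (fun _ => E → M) := ⟨Fibration.toFun⟩

/-- The tangent map `T_u π`. -/
def Fibration.tangent (π : Fibration B F V M E) (u : E) :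
    TangentSpace 𝓘(ℝ, V) u →L[ℝ] TangentSpace 𝓘(ℝ, B) (π u) :=
  mfderiv 𝓘(ℝ, V) 𝓘(ℝ, B) π u

/-- Adapted (fibred) coordinates: `total` is a smooth chart `(x, u)` of `E`, and `base` the
corresponding chart `x` of `M`. -/
structure AdaptedChart (π : Fibration B F V M E) where
  base : OpenPartialHomeomorph M B
  total : OpenPartialHomeomorph E (B × F)
  base_mem : base ∈ IsManifold.maximalAtlas 𝓘(ℝ, B) ∞ M
  smooth_total : ContMDiffOn 𝓘(ℝ, V) 𝓘(ℝ, B × F) ∞ total total.source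
  smooth_symm : ContMDiffOn 𝓘(ℝ, B × F) 𝓘(ℝ, V) ∞ total.symm total.target
  mapsTo : ∀ u ∈ total.source, π u ∈ base.source
  fst_total : ∀ u ∈ total.source, (total u).1 = base (π u)

lemma Fibration.exists_adaptedChart (π : Fibration B F V M E) (u : E) :
    ∃ a : AdaptedChart π, u ∈ a.total.source := by
  have h := π.isSubmersion u
  refine ⟨⟨h.codChart, h.domChart.trans h.equiv.toHomeomorph.toOpenPartialHomeomorph,
    h.codChart_mem_maximalAtlas, ?_, ?_, ?_, ?_⟩, ?_⟩
  · have h1 := contMDiffOn_of_mem_maximalAtlas h.domChart_mem_maximalAtlas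
    have h2 : ContMDiff 𝓘(ℝ, V) 𝓘(ℝ, B × F) ∞ h.equiv := h.equiv.contDiff.contMDiff
    exact (h2.comp_contMDiffOn h1).mono (by intro x hx; simpa using hx)
  · have h1 := contMDiffOn_symm_of_mem_maximalAtlas h.domChart_mem_maximalAtlas
    have h2 : ContMDiff 𝓘(ℝ, B × F) 𝓘(ℝ, V) ∞ h.equiv.symm := h.equiv.symm.contDiff.contMDiff
    refine ContMDiffOn.comp (t := h.domChart.target) h1 h2.contMDiffOn ?_
    intro x hx
    simpa using hx
  · intro u hu
    exact h.source_subset_preimage_source (by simpa using hu)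
  · intro v hv
    have hv' : v ∈ h.domChart.source := by simpa using hv
    have h4 := h.writtenInCharts
    have h3 := h4 (show h.domChart v ∈ (h.domChart.extend 𝓘(ℝ, V)).target by
      simpa using h.domChart.map_source hv')
    simp [h.domChart.left_inv hv'] at h3
    simpa using h3.symm
  · simpa using h.mem_domChart_source

/-- Coordinates on the bundle over `E` with fibres `Z u`, with values in `L`: each adapted
chart gives a bijection `Z u ≃ L` over its domain, with smooth transition maps. -/
structure FiberCoords (π : Fibration B F V M E) (Z : E → Type*) (L : Type*)
    [NormedAddCommGroup L] [NormedSpace ℝ L] where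
  coord : AdaptedChart π → ∀ u : E, Z u → L
  inv : AdaptedChart π → ∀ u : E, L → Z u
  left_inv : ∀ a : AdaptedChart π, ∀ u ∈ a.total.source, ∀ z : Z u, inv a u (coord a u z) = z
  right_inv : ∀ a : AdaptedChart π, ∀ u ∈ a.total.source, ∀ l : L, coord a u (inv a u l) = l
  smooth : ∀ a b : AdaptedChart π, ContDiffOn ℝ ∞
    (fun q : (B × F) × L => coord b (a.total.symm q.1) (inv a (a.total.symm q.1) q.2))
    ((a.total.symm.trans b.total).source ×ˢ univ)

variable {π : Fibration B F V M E} {Z : E → Type*} {L : Type*}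
  [NormedAddCommGroup L] [NormedSpace ℝ L]

/-- The total space of the bundle over `E` with fibres `Z u`. -/
@[ext]
structure Tot (c : FiberCoords π Z L) where
  pt : E
  val : Z pt

lemma AdaptedChart.contDiffOn_trans (a b : AdaptedChart π) :
    ContDiffOn ℝ ∞ (a.total.symm.trans b.total) (a.total.symm.trans b.total).source := by
  rw [← contMDiffOn_iff_contDiffOn]
  refine ContMDiffOn.comp (t := b.total.source) b.smooth_total
    (a.smooth_symm.mono ?_) ?_
  · intro x hx; exact hx.1
  · intro x hx; exact hx.2

namespace FiberCoords

/-- The chart of the total space induced by adapted coordinates on `E`. -/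
def chart (c : FiberCoords π Z L) (a : AdaptedChart π) : PartialEquiv (Tot c) (B × (F × L)) where
  toFun p := ((a.total p.pt).1, (a.total p.pt).2, c.coord a p.pt p.val)
  invFun q := ⟨a.total.symm (q.1, q.2.1), c.inv a _ q.2.2⟩
  source := {p | p.pt ∈ a.total.source}
  target := {q | (q.1, q.2.1) ∈ a.total.target}
  map_source' p hp := a.total.map_source hp
  map_target' q hq := a.total.map_target hq
  left_inv' := by
    rintro ⟨u, z⟩ hp
    have h1 : a.total.symm (a.total u) = u := a.total.left_inv hp
    have h2 := c.left_inv a u hp z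
    have h3 : ∀ u' : E, u' = u →
        (⟨u', c.inv a u' (c.coord a u z)⟩ : Tot c) = ⟨u, z⟩ := by
      rintro u' rfl
      rw [h2]
    exact h3 _ h1
  right_inv' := by
    rintro ⟨x, y, l⟩ hq
    have h1 : a.total (a.total.symm (x, y)) = (x, y) := a.total.right_inv hq
    have h2 := c.right_inv a _ (a.total.map_target hq) l
    simp only [h1, h2]

lemma chart_trans_source (c : FiberCoords π Z L) (a b : AdaptedChart π) :
    ((c.chart a).symm.trans (c.chart b)).source =
      (fun q : B × (F × L) => (q.1, q.2.1)) ⁻¹' (a.total.symm.trans b.total).source := rfl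

lemma contDiffOn_chart_trans (c : FiberCoords π Z L) (a b : AdaptedChart π) :
    ContDiffOn ℝ ∞ ((c.chart a).symm.trans (c.chart b))
      ((c.chart a).symm.trans (c.chart b)).source := by
  rw [chart_trans_source]
  have h1 : ContDiffOn ℝ ∞ (fun q : B × (F × L) => (a.total.symm.trans b.total) (q.1, q.2.1))
      ((fun q : B × (F × L) => (q.1, q.2.1)) ⁻¹' (a.total.symm.trans b.total).source) :=
    (a.contDiffOn_trans b).comp (by fun_prop) (fun q hq => hq)
  have h2 := (c.smooth a b).comp
    (s := (fun q : B × (F × L) => (q.1, q.2.1)) ⁻¹' (a.total.symm.trans b.total).source)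
    (f := fun q : B × (F × L) => ((q.1, q.2.1), q.2.2)) (by fun_prop) (fun q hq => ⟨hq, trivial⟩)
  exact h1.fst.prodMk (h1.snd.prodMk h2)

/-- The atlas of the total space consists of the charts induced by adapted coordinates. -/
def core (c : FiberCoords π Z L) : ChartedSpaceCore (B × (F × L)) (Tot c) where
  atlas := range c.chart
  chartAt p := c.chart (π.exists_adaptedChart p.pt).choose
  mem_chart_source p := (π.exists_adaptedChart p.pt).choose_spec
  chart_mem_atlas p := mem_range_self _
  open_source := by
    rintro _ _ ⟨a, rfl⟩ ⟨b, rfl⟩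
    rw [chart_trans_source]
    exact (a.total.symm.trans b.total).open_source.preimage (by fun_prop)
  continuousOn_toFun := by
    rintro _ _ ⟨a, rfl⟩ ⟨b, rfl⟩
    exact (c.contDiffOn_chart_trans a b).continuousOn

end FiberCoords

variable (c : FiberCoords π Z L)

instance : TopologicalSpace (Tot c) := c.core.toTopologicalSpace

instance : ChartedSpace (B × (F × L)) (Tot c) := c.core.toChartedSpace

instance : IsManifold 𝓘(ℝ, B × (F × L)) ∞ (Tot c) := by
  apply isManifold_of_contDiffOn
  intro e e' he he'
  change e ∈ ⋃ (e : PartialEquiv (Tot c) (B × (F × L))) (he : e ∈ c.core.atlas),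
    {c.core.openPartialHomeomorph e he} at he
  change e' ∈ ⋃ (e : PartialEquiv (Tot c) (B × (F × L))) (he : e ∈ c.core.atlas),
    {c.core.openPartialHomeomorph e he} at he'
  simp only [mem_iUnion, mem_singleton_iff] at he he'
  obtain ⟨_, ⟨a, rfl⟩, rfl⟩ := he
  obtain ⟨_, ⟨b, rfl⟩, rfl⟩ := he'
  refine (c.contDiffOn_chart_trans a b).mono ?_
  intro x hx
  exact hx.1

namespace FiberCoords

/-- `chart` as a chart of the manifold `Tot c`. -/
def homeo (a : AdaptedChart π) : OpenPartialHomeomorph (Tot c) (B × (F × L)) :=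
  c.core.openPartialHomeomorph (c.chart a) (mem_range_self a)

lemma homeo_mem_atlas (a : AdaptedChart π) : c.homeo a ∈ atlas (B × (F × L)) (Tot c) := by
  change _ ∈ ⋃ (e : PartialEquiv (Tot c) (B × (F × L))) (he : e ∈ c.core.atlas),
    {c.core.openPartialHomeomorph e he}
  simp only [mem_iUnion, mem_singleton_iff]
  exact ⟨_, mem_range_self a, rfl⟩

lemma exists_chartAt (p : Tot c) :
    ∃ a : AdaptedChart π, p.pt ∈ a.total.source ∧ chartAt (B × (F × L)) p = c.homeo a :=
  ⟨(π.exists_adaptedChart p.pt).choose, (π.exists_adaptedChart p.pt).choose_spec, rfl⟩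

/-- The total space as a fibration over `M`, with projection `p ↦ π p.pt`. -/
def fibration :
    Fibration B (F × L) (B × (F × L)) M (Tot c) where
  toFun p := π p.pt
  surjective x := by
    obtain ⟨u, rfl⟩ := π.surjective x
    exact ⟨⟨u, c.inv (π.exists_adaptedChart u).choose u 0⟩, rfl⟩
  isSubmersion p := by
    obtain ⟨a, ha⟩ := π.exists_adaptedChart p.pt
    refine Manifold.IsSubmersionAtOfComplement.mk_of_charts
      (ContinuousLinearEquiv.refl ℝ _) (c.homeo a) a.base ha (a.mapsTo _ ha)
      (IsManifold.subset_maximalAtlas (c.homeo_mem_atlas a)) a.base_mem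
      (fun q hq => a.mapsTo _ hq) ?_
    rintro ⟨x, y, l⟩ hq
    have hq' : (x, y) ∈ a.total.target := by
      have : (x, y, l) ∈ (c.homeo a).target := by simpa using hq
      exact this
    have h1 := a.fst_total _ (a.total.map_target hq')
    rw [a.total.right_inv hq'] at h1
    simpa [homeo, chart, ChartedSpaceCore.openPartialHomeomorph] using h1.symm

end FiberCoords

end Fibrations

/-! ## Horizontal forms and jets -/

section Horizontal

variable {T S : Type*} [AddCommGroup T] [Module ℝ T] [TopologicalSpace T]
  [AddCommGroup S] [Module ℝ S] [TopologicalSpace S]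

/-- The `k`-forms on `T` which are `r`-horizontal with respect to `p : T → S`: they vanish
whenever at least `r` of their arguments are vertical (belong to `ker p`). -/
def horizontalForms (p : T →L[ℝ] S) (r k : ℕ) : Submodule ℝ (T [⋀^Fin k]→L[ℝ] ℝ) where
  carrier := {θ | ∀ (v : Fin k → T) (s : Finset (Fin k)), r ≤ s.card →
    (∀ i ∈ s, p (v i) = 0) → θ v = 0}
  add_mem' := by
    intro a b ha hb v s hs hv
    simp [ha v s hs hv, hb v s hs hv]
  zero_mem' := by
    intro v s _ _
    rfl
  smul_mem' := by
    intro c a ha v s hs hv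
    simp [ha v s hs hv]

lemma comp_mem_horizontalForms {T' S' : Type*} [AddCommGroup T'] [Module ℝ T']
    [TopologicalSpace T'] [AddCommGroup S'] [Module ℝ S'] [TopologicalSpace S']
    {p : T →L[ℝ] S} {p' : T' →L[ℝ] S'} {r k : ℕ} {θ : T [⋀^Fin k]→L[ℝ] ℝ}
    (hθ : θ ∈ horizontalForms p r k) (g : T' →L[ℝ] T) (hg : ∀ v, p' v = 0 → p (g v) = 0) :
    θ.compContinuousLinearMap g ∈ horizontalForms p' r k := by
  intro v s hs hv
  exact hθ (fun i => g (v i)) s hs fun i hi => hg _ (hv i hi)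

end Horizontal

section FormModel

variable (B F : Type*) [NormedAddCommGroup B] [NormedSpace ℝ B]
  [NormedAddCommGroup F] [NormedSpace ℝ F] (r k : ℕ)

/-- The normed space of `k`-forms on `B × F` which are `r`-horizontal with respect to the
projection to `B`: the model of the fibres of `Λ^k_r E`. -/
def FormModel : Type _ := horizontalForms (ContinuousLinearMap.fst ℝ B F) r k

instance : NormedAddCommGroup (FormModel B F r k) :=
  inferInstanceAs (NormedAddCommGroup (horizontalForms (ContinuousLinearMap.fst ℝ B F) r k))

instance : NormedSpace ℝ (FormModel B F r k) :=
  inferInstanceAs (NormedSpace ℝ (horizontalForms (ContinuousLinearMap.fst ℝ B F) r k))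

variable {B F r k}

/-- The inclusion into all forms on `B × F`. -/
def FormModel.toForm : FormModel B F r k →L[ℝ] ((B × F) [⋀^Fin k]→L[ℝ] ℝ) :=
  (horizontalForms (ContinuousLinearMap.fst ℝ B F) r k).subtypeL

lemma FormModel.toForm_mem (θ : FormModel B F r k) :
    θ.toForm ∈ horizontalForms (ContinuousLinearMap.fst ℝ B F) r k := Subtype.property θ

lemma FormModel.toForm_injective :
    Function.Injective (FormModel.toForm : FormModel B F r k → (B × F) [⋀^Fin k]→L[ℝ] ℝ) :=
  Subtype.val_injective

/-- The element of the model given by a horizontal form. -/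
def FormModel.mk (θ : (B × F) [⋀^Fin k]→L[ℝ] ℝ)
    (hθ : θ ∈ horizontalForms (ContinuousLinearMap.fst ℝ B F) r k) : FormModel B F r k := ⟨θ, hθ⟩

@[simp] lemma FormModel.toForm_mk (θ : (B × F) [⋀^Fin k]→L[ℝ] ℝ)
    (hθ : θ ∈ horizontalForms (ContinuousLinearMap.fst ℝ B F) r k) :
    (FormModel.mk θ hθ).toForm = θ := rfl

lemma contDiffOn_formModel_apply {Q : Type*} [NormedAddCommGroup Q] [NormedSpace ℝ Q]
    {h : Q → FormModel B F r k} {w : Q → Fin k → B × F} {s : Set Q}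
    (hh : ContDiffOn ℝ ∞ h s) (hw : ContDiffOn ℝ ∞ w s) :
    ContDiffOn ℝ ∞ (fun q => (h q).toForm (w q)) s := by
  let f : FormModel B F r k →L[ℝ] ContinuousMultilinearMap ℝ (fun _ : Fin k => B × F) ℝ :=
    (ContinuousAlternatingMap.toContinuousMultilinearMapCLM ℝ).comp FormModel.toForm
  have h1 : ContDiffOn ℝ ∞ (fun q => f.flipMultilinear (w q)) s :=
    f.flipMultilinear.contDiff.comp_contDiffOn hw
  exact h1.clm_apply hh

variable [FiniteDimensional ℝ B] [FiniteDimensional ℝ F]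

variable (B F r k) in
/-- Evaluation of forms on the tuples of vectors of a basis. -/
def evalBasis : FormModel B F r k →ₗ[ℝ]
    ((Fin k → Fin (Module.finrank ℝ (B × F))) → ℝ) where
  toFun θ f := θ.toForm fun i => Module.finBasis ℝ (B × F) (f i)
  map_add' _ _ := rfl
  map_smul' _ _ := rfl

lemma evalBasis_injective : LinearMap.ker (evalBasis B F r k) = ⊥ := by
  rw [LinearMap.ker_eq_bot']
  intro θ hθ
  apply FormModel.toForm_injective
  apply ContinuousAlternatingMap.toAlternatingMap_injective
  refine Module.Basis.ext_alternating (Module.finBasis ℝ (B × F)) fun f _ => ?_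
  exact congrFun hθ f

instance : FiniteDimensional ℝ (FormModel B F r k) :=
  FiniteDimensional.of_injective (evalBasis B F r k) (LinearMap.ker_eq_bot.1 evalBasis_injective)

lemma contDiffOn_formModel {Q : Type*} [NormedAddCommGroup Q] [NormedSpace ℝ Q]
    {h : Q → FormModel B F r k} {s : Set Q}
    (hh : ∀ v : Fin k → B × F, ContDiffOn ℝ ∞ (fun q => (h q).toForm v) s) :
    ContDiffOn ℝ ∞ h s := by
  obtain ⟨g, hg⟩ := (evalBasis B F r k).exists_leftInverse_of_injective evalBasis_injective
  have h1 : ContDiffOn ℝ ∞ (fun q => evalBasis B F r k (h q)) s :=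
    contDiffOn_pi.2 fun f => hh _
  have h2 := g.toContinuousLinearMap.contDiff.comp_contDiffOn h1
  refine h2.congr fun q _ => ?_
  exact (LinearMap.congr_fun hg (h q)).symm

end FormModel

section Bundles

variable {B F V M E : Type*}
  [NormedAddCommGroup B] [NormedSpace ℝ B] [NormedAddCommGroup F] [NormedSpace ℝ F]
  [NormedAddCommGroup V] [NormedSpace ℝ V]
  [TopologicalSpace M] [ChartedSpace B M]
  [TopologicalSpace E] [ChartedSpace V E]
  {π : Fibration B F V M E}

namespace AdaptedChart

lemma mdifferentiable (a : AdaptedChart π) :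
    a.total.MDifferentiable 𝓘(ℝ, V) 𝓘(ℝ, B × F) :=
  ⟨a.smooth_total.mdifferentiableOn (by simp), a.smooth_symm.mdifferentiableOn (by simp)⟩

lemma base_mdifferentiable (a : AdaptedChart π) :
    a.base.MDifferentiable 𝓘(ℝ, B) 𝓘(ℝ, B) :=
  ⟨(contMDiffOn_of_mem_maximalAtlas a.base_mem).mdifferentiableOn (by simp),
    (contMDiffOn_symm_of_mem_maximalAtlas a.base_mem).mdifferentiableOn (by simp)⟩

/-- The differential of the chart of `E` at `u`. -/
def tangentEquiv (a : AdaptedChart π) {u : E} (hu : u ∈ a.total.source) :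
    TangentSpace 𝓘(ℝ, V) u ≃L[ℝ] (B × F) :=
  a.mdifferentiable.mfderiv hu

/-- The differential of the chart of `M` at `x`. -/
def baseTangentEquiv (a : AdaptedChart π) {x : M} (hx : x ∈ a.base.source) :
    TangentSpace 𝓘(ℝ, B) x ≃L[ℝ] B :=
  a.base_mdifferentiable.mfderiv hx

lemma fst_tangentEquiv (a : AdaptedChart π) {u : E} (hu : u ∈ a.total.source)
    (v : TangentSpace 𝓘(ℝ, V) u) :
    (a.tangentEquiv hu v).1 = a.baseTangentEquiv (a.mapsTo u hu) (π.tangent u v) := by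
  have h1 : HasMFDerivAt 𝓘(ℝ, V) 𝓘(ℝ, B × F) a.total u (mfderiv 𝓘(ℝ, V) 𝓘(ℝ, B × F) a.total u) :=
    (a.mdifferentiable.mdifferentiableAt hu).hasMFDerivAt
  have h2 : HasMFDerivAt 𝓘(ℝ, B × F) 𝓘(ℝ, B) Prod.fst (a.total u)
      (ContinuousLinearMap.fst ℝ B F) :=
    (hasFDerivAt_fst (𝕜 := ℝ) (E := B) (F := F)).hasMFDerivAt
  have h3 : HasMFDerivAt 𝓘(ℝ, V) 𝓘(ℝ, B) π u (mfderiv 𝓘(ℝ, V) 𝓘(ℝ, B) π u) :=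
    ((π.isSubmersion.contMDiff u).mdifferentiableAt (by simp)).hasMFDerivAt
  have h4 : HasMFDerivAt 𝓘(ℝ, B) 𝓘(ℝ, B) a.base (π u)
      (mfderiv 𝓘(ℝ, B) 𝓘(ℝ, B) a.base (π u)) :=
    (a.base_mdifferentiable.mdifferentiableAt (a.mapsTo u hu)).hasMFDerivAt
  have h5 := h2.comp u h1
  have h6 := h4.comp u h3
  have h7 : (Prod.fst ∘ a.total) =ᶠ[𝓝 u] (a.base ∘ π) := by
    filter_upwards [a.total.open_source.mem_nhds hu] with w hw using a.fst_total w hw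
  have h8 := hasMFDerivAt_unique h5 (h6.congr_of_eventuallyEq h7)
  exact DFunLike.congr_fun h8 v

lemma tangentEquiv_trans (a b : AdaptedChart π) {u : E} (ha : u ∈ a.total.source)
    (hb : u ∈ b.total.source) (w : B × F) :
    b.tangentEquiv hb ((a.tangentEquiv ha).symm w) =
      fderiv ℝ (a.total.symm.trans b.total) (a.total u) w := by
  rw [← mfderiv_eq_fderiv]
  have h0 : a.total.symm (a.total u) = u := a.total.left_inv ha
  have h1 : HasMFDerivAt 𝓘(ℝ, B × F) 𝓘(ℝ, V) a.total.symm (a.total u)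
      (mfderiv 𝓘(ℝ, B × F) 𝓘(ℝ, V) a.total.symm (a.total u)) :=
    (a.mdifferentiable.mdifferentiableAt_symm (a.total.map_source ha)).hasMFDerivAt
  have h2 : HasMFDerivAt 𝓘(ℝ, V) 𝓘(ℝ, B × F) b.total (a.total.symm (a.total u))
      (mfderiv 𝓘(ℝ, V) 𝓘(ℝ, B × F) b.total (a.total.symm (a.total u))) :=
    (b.mdifferentiable.mdifferentiableAt (by rwa [h0])).hasMFDerivAt
  have h3 := (h2.comp (a.total u) h1).mfderiv
  have h4 : mfderiv 𝓘(ℝ, B × F) 𝓘(ℝ, B × F) (a.total.symm.trans b.total) (a.total u) =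
      mfderiv 𝓘(ℝ, B × F) 𝓘(ℝ, B × F) (b.total ∘ a.total.symm) (a.total u) := rfl
  rw [h4, h3, h0]
  rfl

lemma baseTangentEquiv_trans (a b : AdaptedChart π) {x : M} (ha : x ∈ a.base.source)
    (hb : x ∈ b.base.source) (w : B) :
    b.baseTangentEquiv hb ((a.baseTangentEquiv ha).symm w) =
      fderiv ℝ (a.base.symm.trans b.base) (a.base x) w := by
  rw [← mfderiv_eq_fderiv]
  have h0 : a.base.symm (a.base x) = x := a.base.left_inv ha
  have h1 : HasMFDerivAt 𝓘(ℝ, B) 𝓘(ℝ, B) a.base.symm (a.base x)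
      (mfderiv 𝓘(ℝ, B) 𝓘(ℝ, B) a.base.symm (a.base x)) :=
    (a.base_mdifferentiable.mdifferentiableAt_symm (a.base.map_source ha)).hasMFDerivAt
  have h2 : HasMFDerivAt 𝓘(ℝ, B) 𝓘(ℝ, B) b.base (a.base.symm (a.base x))
      (mfderiv 𝓘(ℝ, B) 𝓘(ℝ, B) b.base (a.base.symm (a.base x))) :=
    (b.base_mdifferentiable.mdifferentiableAt (by rwa [h0])).hasMFDerivAt
  have h3 := (h2.comp (a.base x) h1).mfderiv
  have h4 : mfderiv 𝓘(ℝ, B) 𝓘(ℝ, B) (a.base.symm.trans b.base) (a.base x) =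
      mfderiv 𝓘(ℝ, B) 𝓘(ℝ, B) (b.base ∘ a.base.symm) (a.base x) := rfl
  rw [h4, h3, h0]
  rfl

lemma contDiffOn_base_trans (a b : AdaptedChart π) :
    ContDiffOn ℝ ∞ (a.base.symm.trans b.base) (a.base.symm.trans b.base).source := by
  rw [← contMDiffOn_iff_contDiffOn]
  refine ContMDiffOn.comp (t := b.base.source) (contMDiffOn_of_mem_maximalAtlas b.base_mem)
    ((contMDiffOn_symm_of_mem_maximalAtlas a.base_mem).mono ?_) ?_
  · intro x hx; exact hx.1
  · intro x hx; exact hx.2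

end AdaptedChart

/-- The fibre of `Λ^k_r E` over `u`. -/
abbrev FormFiber (π : Fibration B F V M E) (r k : ℕ) (u : E) : Type _ :=
  horizontalForms (π.tangent u) r k

open Classical in
/-- The coordinates on `Λ^k_r E` induced by adapted coordinates: the coefficients of a form
(and `0` outside the domain of the chart). -/
def formCoords [FiniteDimensional ℝ B] [FiniteDimensional ℝ F] (π : Fibration B F V M E)
    (r k : ℕ) : FiberCoords π (FormFiber π r k) (FormModel B F r k) where
  coord a u z := if hu : u ∈ a.total.source then
      FormModel.mk ((z : TangentSpace 𝓘(ℝ, V) u [⋀^Fin k]→L[ℝ] ℝ).compContinuousLinearMap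
          ((a.tangentEquiv hu).symm : B × F →L[ℝ] TangentSpace 𝓘(ℝ, V) u))
        (comp_mem_horizontalForms z.2 _ fun v hv => by
          have h := a.fst_tangentEquiv hu ((a.tangentEquiv hu).symm v)
          rw [ContinuousLinearEquiv.apply_symm_apply] at h
          apply (a.baseTangentEquiv (a.mapsTo u hu)).injective
          rw [map_zero]
          exact h.symm.trans hv)
    else 0
  inv a u w := if hu : u ∈ a.total.source then
      ⟨w.toForm.compContinuousLinearMap
          (a.tangentEquiv hu : TangentSpace 𝓘(ℝ, V) u →L[ℝ] B × F),
        comp_mem_horizontalForms w.toForm_mem _ fun v hv => by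
          have h := a.fst_tangentEquiv hu v
          rw [hv, map_zero] at h
          exact h⟩
    else 0
  left_inv a u hu z := by
    simp only [hu, dif_pos]
    ext v
    simp [Function.comp_def]
  right_inv a u hu z := by
    simp only [hu, dif_pos]
    apply FormModel.toForm_injective
    ext v
    simp [Function.comp_def]
  smooth a b := by
    apply contDiffOn_formModel
    intro v
    have h1 : ContDiffOn ℝ ∞ (fun q : (B × F) × FormModel B F r k =>
        fderiv ℝ (b.total.symm.trans a.total) ((a.total.symm.trans b.total) q.1))
        ((a.total.symm.trans b.total).source ×ˢ univ) := by
      have h2 := (b.contDiffOn_trans a).fderiv_of_isOpen (m := ∞)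
        (b.total.symm.trans a.total).open_source (by simp)
      refine h2.comp ((a.contDiffOn_trans b).comp contDiff_fst.contDiffOn fun q hq => hq.1) ?_
      rintro ⟨e, w⟩ ⟨⟨he1, he2⟩, -⟩
      refine ⟨b.total.map_source he2, ?_⟩
      have h3 : b.total.symm (b.total (a.total.symm e)) = a.total.symm e := b.total.left_inv he2
      change b.total.symm (b.total (a.total.symm e)) ∈ a.total.source
      rw [h3]
      exact a.total.map_target he1
    have h4 := contDiffOn_formModel_apply (r := r) (k := k) (h := fun q : (B × F) × FormModel B F r k => q.2)
      (w := fun q i => fderiv ℝ (b.total.symm.trans a.total)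
        ((a.total.symm.trans b.total) q.1) (v i)) contDiff_snd.contDiffOn
      (contDiffOn_pi.2 fun i => h1.clm_apply contDiffOn_const)
    refine h4.congr ?_
    rintro ⟨e, w⟩ ⟨⟨he1, he2⟩, -⟩
    have hea : a.total.symm e ∈ a.total.source := a.total.map_target he1
    have heb : a.total.symm e ∈ b.total.source := he2
    simp only [hea, heb, dif_pos]
    change w.toForm (fun i => a.tangentEquiv hea
      ((b.tangentEquiv heb).symm (v i))) = _
    congr 1
    funext i
    exact b.tangentEquiv_trans a heb hea (v i)

/-- The manifold `Λ^k_r E`. -/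
abbrev FormBundle [FiniteDimensional ℝ B] [FiniteDimensional ℝ F] (π : Fibration B F V M E)
    (r k : ℕ) : Type _ :=
  Tot (formCoords π r k)

/-- The fibre of `J¹π` over `u`: the linear maps `z : T_{π u} M → T_u E` with `T_u π ∘ z = id`. -/
abbrev JetFiber (π : Fibration B F V M E) (u : E) : Type _ :=
  {z : TangentSpace 𝓘(ℝ, B) (π u) →L[ℝ] TangentSpace 𝓘(ℝ, V) u //
    (π.tangent u).comp z = ContinuousLinearMap.id ℝ _}

/-- The jet with given coordinates `u^α_i`. -/
def AdaptedChart.jet (a : AdaptedChart π) {u : E} (hu : u ∈ a.total.source) (l : B →L[ℝ] F) :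
    JetFiber π u :=
  ⟨((a.tangentEquiv hu).symm : B × F →L[ℝ] TangentSpace 𝓘(ℝ, V) u).comp
      (((ContinuousLinearMap.id ℝ B).prod l).comp
        (a.baseTangentEquiv (a.mapsTo u hu) : TangentSpace 𝓘(ℝ, B) (π u) →L[ℝ] B)), by
    ext v
    apply (a.baseTangentEquiv (a.mapsTo u hu)).injective
    have h := a.fst_tangentEquiv hu ((a.tangentEquiv hu).symm
      (a.baseTangentEquiv (a.mapsTo u hu) v, l (a.baseTangentEquiv (a.mapsTo u hu) v)))
    rw [ContinuousLinearEquiv.apply_symm_apply] at h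
    exact h.symm⟩

instance (u : E) : Nonempty (JetFiber π u) :=
  ⟨(π.exists_adaptedChart u).choose.jet (π.exists_adaptedChart u).choose_spec 0⟩

open Classical in
/-- The coordinates `u^α_i` on `J¹π` induced by adapted coordinates. -/
def jetCoords (π : Fibration B F V M E) : FiberCoords π (JetFiber π) (B →L[ℝ] F) where
  coord a u z := if hu : u ∈ a.total.source then
      (ContinuousLinearMap.snd ℝ B F).comp
        ((a.tangentEquiv hu : TangentSpace 𝓘(ℝ, V) u →L[ℝ] B × F).comp
          (z.1.comp ((a.baseTangentEquiv (a.mapsTo u hu)).symm :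
            B →L[ℝ] TangentSpace 𝓘(ℝ, B) (π u))))
    else 0
  inv a u l := if hu : u ∈ a.total.source then a.jet hu l else Classical.arbitrary _
  left_inv a u hu z := by
    simp only [hu, dif_pos]
    apply Subtype.ext
    ext v
    apply (a.tangentEquiv hu).injective
    have h := a.fst_tangentEquiv hu (z.1 v)
    have hz : π.tangent u (z.1 v) = v := DFunLike.congr_fun z.2 v
    rw [hz] at h
    simp only [AdaptedChart.jet, ContinuousLinearMap.comp_apply, ContinuousLinearEquiv.coe_coe,
      ContinuousLinearEquiv.apply_symm_apply, ContinuousLinearMap.prod_apply,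
      ContinuousLinearEquiv.symm_apply_apply, ContinuousLinearMap.coe_snd',
      ContinuousLinearMap.id_apply]
    exact Prod.ext h.symm rfl
  right_inv a u hu l := by
    simp only [hu, dif_pos]
    ext v
    simp [AdaptedChart.jet]
  smooth a b := by
    have h1 : ContDiffOn ℝ ∞ (fun q : (B × F) × (B →L[ℝ] F) =>
        fderiv ℝ (a.total.symm.trans b.total) q.1)
        ((a.total.symm.trans b.total).source ×ˢ univ) := by
      have h2 := (a.contDiffOn_trans b).fderiv_of_isOpen (m := ∞)
        (a.total.symm.trans b.total).open_source (by simp)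
      exact h2.comp contDiff_fst.contDiffOn fun q hq => hq.1
    have h3 : ContDiffOn ℝ ∞ (fun q : (B × F) × (B →L[ℝ] F) =>
        fderiv ℝ (b.base.symm.trans a.base) ((a.total.symm.trans b.total) q.1).1)
        ((a.total.symm.trans b.total).source ×ˢ univ) := by
      have h2 := (b.contDiffOn_base_trans a).fderiv_of_isOpen (m := ∞)
        (b.base.symm.trans a.base).open_source (by simp)
      refine h2.comp (((a.contDiffOn_trans b).comp contDiff_fst.contDiffOn
        fun q hq => hq.1).fst) ?_
      rintro ⟨e, l⟩ ⟨⟨he1, he2⟩, -⟩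
      have hea : a.total.symm e ∈ a.total.source := a.total.map_target he1
      have heb : a.total.symm e ∈ b.total.source := he2
      have h4 : (b.total (a.total.symm e)).1 = b.base (π (a.total.symm e)) := b.fst_total _ heb
      change (b.total (a.total.symm e)).1 ∈ (b.base.symm.trans a.base).source
      rw [h4]
      refine ⟨b.base.map_source (b.mapsTo _ heb), ?_⟩
      change b.base.symm (b.base (π (a.total.symm e))) ∈ a.base.source
      rw [b.base.left_inv (b.mapsTo _ heb)]
      exact a.mapsTo _ hea
    have h5 : ContDiff ℝ ∞ (fun q : (B × F) × (B →L[ℝ] F) =>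
        ContinuousLinearMap.inl ℝ B F + (ContinuousLinearMap.inr ℝ B F).comp q.2) :=
      contDiff_const.add (contDiff_const.clm_comp contDiff_snd)
    have h6 := (contDiffOn_const (c := ContinuousLinearMap.snd ℝ B F)).clm_comp
      (h1.clm_comp (h5.contDiffOn.clm_comp h3))
    refine h6.congr ?_
    rintro ⟨e, l⟩ ⟨⟨he1, he2⟩, -⟩
    have hea : a.total.symm e ∈ a.total.source := a.total.map_target he1
    have heb : a.total.symm e ∈ b.total.source := he2
    simp only [hea, heb, dif_pos]
    ext w
    have h7 := b.baseTangentEquiv_trans a (b.mapsTo _ heb) (a.mapsTo _ hea) w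
    rw [← b.fst_total _ heb] at h7
    have h8 := a.tangentEquiv_trans b hea heb
      (a.baseTangentEquiv (a.mapsTo _ hea) ((b.baseTangentEquiv (b.mapsTo _ heb)).symm w),
        l (a.baseTangentEquiv (a.mapsTo _ hea) ((b.baseTangentEquiv (b.mapsTo _ heb)).symm w)))
    rw [a.total.right_inv he1] at h8
    change (b.tangentEquiv heb ((a.tangentEquiv hea).symm _)).2 = _
    refine (congrArg Prod.snd h8).trans ?_
    rw [h7]
    simp only [ContinuousLinearMap.comp_apply, add_apply,
      ContinuousLinearMap.inl_apply, ContinuousLinearMap.inr_apply, Prod.mk_add_mk, add_zero,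
      zero_add]
    rfl

/-- The manifold `J¹π`. -/
abbrev Jet (π : Fibration B F V M E) : Type _ := Tot (jetCoords π)

end Bundles

/-! ## Canonical forms, and contraction with an endomorphism -/

section Contraction

variable {T : Type*} [AddCommGroup T] [Module ℝ T] [TopologicalSpace T] {k : ℕ}

/-- The contraction `i_h Ω` of a form with an endomorphism `h`; see `contractEnd_apply`. -/
def contractEnd (h : T →L[ℝ] T) (Ω : T [⋀^Fin k]→L[ℝ] ℝ) : T [⋀^Fin k]→L[ℝ] ℝ where
  toContinuousMultilinearMap := ∑ i : Fin k,
    Ω.toContinuousMultilinearMap.compContinuousLinearMap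
      (Function.update (fun _ => ContinuousLinearMap.id ℝ T) i h)
  map_eq_zero_of_eq' := by
    intro v i j hij hne
    have key : ∀ a : Fin k, (fun l => (Function.update (fun _ => ContinuousLinearMap.id ℝ T) a h :
        Fin k → T →L[ℝ] T) l (v l)) = Function.update v a (h (v a)) := by
      intro a
      funext l
      by_cases hl : l = a
      · subst hl; simp
      · simp [Function.update_of_ne hl]
    have h0 : (∑ a : Fin k, Ω (Function.update v a (h (v a)))) = 0 := by
      rw [← Finset.sum_subset (Finset.subset_univ {i, j})]
      · rw [Finset.sum_pair hne]
        have hsw : Function.update v j (h (v j)) =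
            Function.update v i (h (v i)) ∘ Equiv.swap i j := by
          funext l
          by_cases hl : l = j
          · subst hl; simp [hij]
          · by_cases hl' : l = i
            · subst hl'; simp [hij, hne, Function.update_of_ne hne.symm]
            · simp [Function.update_of_ne hl, Equiv.swap_apply_of_ne_of_ne hl' hl,
                Function.update_of_ne hl']
        rw [hsw]
        have := Ω.toAlternatingMap.map_swap (Function.update v i (h (v i))) hne
        simp only [ContinuousAlternatingMap.coe_toAlternatingMap] at this
        rw [this, add_neg_cancel]
      · intro a _ ha
        simp only [Finset.mem_insert, Finset.mem_singleton, not_or] at ha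
        refine Ω.map_eq_zero_of_eq _ ?_ hne
        rw [Function.update_of_ne (Ne.symm ha.1), Function.update_of_ne (Ne.symm ha.2), hij]
    change (∑ a : Fin k, Ω.toContinuousMultilinearMap.compContinuousLinearMap
      (Function.update (fun _ => ContinuousLinearMap.id ℝ T) a h)) v = 0
    rw [sum_apply, ← h0]
    refine Finset.sum_congr rfl fun a _ => ?_
    rw [ContinuousMultilinearMap.compContinuousLinearMap_apply, key]
    rfl

theorem contractEnd_apply (h : T →L[ℝ] T) (Ω : T [⋀^Fin k]→L[ℝ] ℝ) (v : Fin k → T) :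
    contractEnd h Ω v = ∑ i, Ω (Function.update v i (h (v i))) := by
  change (∑ a : Fin k, Ω.toContinuousMultilinearMap.compContinuousLinearMap
      (Function.update (fun _ => ContinuousLinearMap.id ℝ T) a h)) v = _
  rw [sum_apply]
  refine Finset.sum_congr rfl fun a _ => ?_
  rw [ContinuousMultilinearMap.compContinuousLinearMap_apply]
  change Ω _ = Ω _
  congr 1
  funext l
  by_cases hl : l = a
  · subst hl; simp
  · simp [Function.update_of_ne hl]

variable {S : Type*} [AddCommGroup S] [Module ℝ S] [TopologicalSpace S]

/-- A `3`-horizontal form does not change on arguments two of which are vertical when another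
argument is replaced by its horizontal part; hence `i_h Ω - (k - 2) Ω` is `2`-horizontal. -/
lemma contractEnd_sub_mem {p : T →L[ℝ] S} {h : T →L[ℝ] T} (hp : ∀ v, p (h v) = p v)
    (hh : ∀ v, p v = 0 → h v = 0) {Ω : T [⋀^Fin (k + 2)]→L[ℝ] ℝ}
    (hΩ : Ω ∈ horizontalForms p 3 (k + 2)) :
    contractEnd h Ω - (k : ℝ) • Ω ∈ horizontalForms p 2 (k + 2) := by
  classical
  intro v s hs hv
  obtain ⟨s', hs's, hcard⟩ := Finset.exists_subset_card_eq hs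
  have hterm : ∀ i : Fin (k + 2), Ω (Function.update v i (h (v i))) =
      if i ∈ s' then 0 else Ω v := by
    intro i
    split_ifs with hi
    · refine Ω.map_coord_zero i ?_
      rw [Function.update_self]
      exact hh _ (hv i (hs's hi))
    · have h1 : Ω (Function.update v i (h (v i))) - Ω (Function.update v i (v i)) =
          Ω (Function.update v i (h (v i) - v i)) :=
        (Ω.toAlternatingMap.map_update_sub v i _ _).symm
      have h2 : Ω (Function.update v i (h (v i) - v i)) = 0 := by
        refine hΩ _ (insert i s') ?_ ?_
        · rw [Finset.card_insert_of_notMem hi, hcard]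
        · intro j hj
          by_cases hji : j = i
          · subst hji
            rw [Function.update_self, map_sub, hp, sub_self]
          · rw [Function.update_of_ne hji]
            exact hv j (hs's (Finset.mem_of_mem_insert_of_ne hj hji))
      rw [Function.update_eq_self, h2] at h1
      exact sub_eq_zero.1 h1
  change contractEnd h Ω v - (k : ℝ) • Ω v = 0
  rw [contractEnd_apply, Finset.sum_congr rfl fun i _ => hterm i, Finset.sum_ite]
  have h3 : (Finset.univ.filter fun i : Fin (k + 2) => i ∉ s').card = k := by
    have : (Finset.univ.filter fun i : Fin (k + 2) => i ∉ s') = s'ᶜ := by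
      ext i; simp
    rw [this, Finset.card_compl, hcard, Fintype.card_fin]
    omega
  simp [h3]

end Contraction

section ExteriorDerivative

variable {B F V M E : Type*}
  [NormedAddCommGroup B] [NormedSpace ℝ B] [NormedAddCommGroup F] [NormedSpace ℝ F]
  [NormedAddCommGroup V] [NormedSpace ℝ V]
  [TopologicalSpace M] [ChartedSpace B M]
  [TopologicalSpace E] [ChartedSpace V E]
  {π : Fibration B F V M E} {Z : E → Type*} {L : Type*}
  [NormedAddCommGroup L] [NormedSpace ℝ L] (c : FiberCoords π Z L)

lemma extDeriv_mem_horizontalForms {W W' : Type*} [NormedAddCommGroup W] [NormedSpace ℝ W]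
    [NormedAddCommGroup W'] [NormedSpace ℝ W'] (p : W →L[ℝ] W') {r k : ℕ}
    (α : W → W [⋀^Fin k]→L[ℝ] ℝ) (x : W) (hα : ∀ᶠ y in 𝓝 x, α y ∈ horizontalForms p r k) :
    extDeriv α x ∈ horizontalForms p (r + 1) (k + 1) := by
  classical
  by_cases hd : DifferentiableAt ℝ α x
  · intro v s hs hv
    rw [extDeriv_apply hd]
    refine Finset.sum_eq_zero fun i _ => ?_
    have h0 : (fun y => α y (i.removeNth v)) =ᶠ[𝓝 x] fun _ => 0 := by
      filter_upwards [hα] with y hy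
      refine hy _ (Finset.univ.filter fun j => i.succAbove j ∈ s) ?_ ?_
      · have h1 : s ⊆ insert i ((Finset.univ.filter fun j => i.succAbove j ∈ s).image
            i.succAbove) := by
          intro j hj
          by_cases hji : j = i
          · simp [hji]
          · obtain ⟨l, rfl⟩ := Fin.exists_succAbove_eq hji
            simp [hj]
        have h2 := (Finset.card_le_card h1).trans (Finset.card_insert_le _ _)
        have h3 := Finset.card_image_le (s := Finset.univ.filter fun j => i.succAbove j ∈ s)
          (f := i.succAbove)
        omega
      · intro j hj
        exact hv _ (by simpa using hj)
    rw [h0.fderiv_eq]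
    simp
  · have : extDeriv α x = 0 := by
      rw [extDeriv, fderiv_zero_of_not_differentiableAt hd]
      ext v
      simp [ContinuousAlternatingMap.alternatizeUncurryFin_apply]
    rw [this]
    exact Submodule.zero_mem _

/-- On the total space, the exterior derivative of an `r`-horizontal form is
`(r+1)`-horizontal. -/
lemma extD_mem_horizontalForms {r k : ℕ} (α : KForm (B × (F × L)) (Tot c) k)
    (hα : ∀ p, α p ∈ horizontalForms (c.fibration.tangent p) r k) (p : Tot c) :
    extD α p ∈ horizontalForms (c.fibration.tangent p) (r + 1) (k + 1) := by
  obtain ⟨a, ha, hchart⟩ := c.exists_chartAt p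
  have hmem : c.homeo a ∈ IsManifold.maximalAtlas 𝓘(ℝ, B × (F × L)) ∞ (Tot c) :=
    IsManifold.subset_maximalAtlas (c.homeo_mem_atlas a)
  -- the adapted chart of the fibration over `M` given by `a`
  have hfst : ∀ q ∈ (c.homeo a).source, (c.homeo a q).1 = a.base (c.fibration q) :=
    fun q hq => a.fst_total q.pt hq
  let A : AdaptedChart c.fibration :=
    { base := a.base
      total := c.homeo a
      base_mem := a.base_mem
      smooth_total := contMDiffOn_of_mem_maximalAtlas hmem
      smooth_symm := contMDiffOn_symm_of_mem_maximalAtlas hmem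
      mapsTo := fun q hq => a.mapsTo q.pt hq
      fst_total := hfst }
  have hp : p ∈ A.total.source := ha
  unfold extD
  rw [hchart]
  refine comp_mem_horizontalForms (p := ContinuousLinearMap.fst ℝ B (F × L)) ?_ _ ?_
  · refine extDeriv_mem_horizontalForms _ _ _ ?_
    have hev : ∀ᶠ y in 𝓝 (c.homeo a p), y ∈ (c.homeo a).target :=
      (c.homeo a).open_target.mem_nhds ((c.homeo a).map_source hp)
    filter_upwards [hev] with y hy
    unfold chartRep
    rw [hchart]
    refine comp_mem_horizontalForms (hα _) _ ?_
    intro v hv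
    have hq : (c.homeo a).symm y ∈ A.total.source := (c.homeo a).map_target hy
    apply (A.baseTangentEquiv (A.mapsTo _ hq)).injective
    rw [map_zero, ← A.fst_tangentEquiv hq]
    have h1 := A.mdifferentiable.comp_symm_deriv hy
    have h2 := DFunLike.congr_fun h1 v
    exact (congrArg Prod.fst h2).trans hv
  · intro v hv
    have := A.fst_tangentEquiv hp v
    rw [hv, map_zero] at this
    exact this

lemma Tot.mdifferentiableAt_pt (p : Tot c) :
    MDifferentiableAt 𝓘(ℝ, B × (F × L)) 𝓘(ℝ, V) (Tot.pt : Tot c → E) p := by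
  obtain ⟨a, ha⟩ := π.exists_adaptedChart p.pt
  have hp : p ∈ (c.homeo a).source := ha
  have h1 : MDifferentiableAt 𝓘(ℝ, B × (F × L)) 𝓘(ℝ, B × (F × L)) (c.homeo a) p :=
    (contMDiffAt_of_mem_maximalAtlas (n := ∞)
      (IsManifold.subset_maximalAtlas (c.homeo_mem_atlas a)) hp).mdifferentiableAt (by simp)
  have h2 : MDifferentiableAt 𝓘(ℝ, B × (F × L)) 𝓘(ℝ, B × F)
      (fun q : B × (F × L) => (q.1, q.2.1)) (c.homeo a p) := by
    apply DifferentiableAt.mdifferentiableAt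
    fun_prop
  have h3 : MDifferentiableAt 𝓘(ℝ, B × F) 𝓘(ℝ, V) a.total.symm (a.total p.pt) :=
    a.mdifferentiable.mdifferentiableAt_symm (a.total.map_source ha)
  have h4 := MDifferentiableAt.comp (x := p) (g := a.total.symm)
    (f := (fun q : B × (F × L) => (q.1, q.2.1)) ∘ c.homeo a) h3 (h2.comp p h1)
  refine h4.congr_of_eventuallyEq ?_
  filter_upwards [(c.homeo a).open_source.mem_nhds hp] with q hq
  exact (a.total.left_inv hq).symm

end ExteriorDerivative

/-! ## The Hamiltonian side of the triple -/

section FieldTheory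

variable {B F V M E : Type*}
  [NormedAddCommGroup B] [NormedSpace ℝ B] [FiniteDimensional ℝ B]
  [NormedAddCommGroup F] [NormedSpace ℝ F] [FiniteDimensional ℝ F]
  [NormedAddCommGroup V] [NormedSpace ℝ V]
  [TopologicalSpace M] [ChartedSpace B M]
  [TopologicalSpace E] [ChartedSpace V E]

/-- The Liouville form `Θ(ω)(X₁, …, X_k) = ω(Tν X₁, …, Tν X_k)` on `Λ^k_r E`, where
`ν : Λ^k_r E → E` is the projection. -/
def liouville (π : Fibration B F V M E) (r k : ℕ) :
    KForm (B × (F × FormModel B F r k)) (FormBundle π r k) k := fun w =>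
  (w.val : TangentSpace 𝓘(ℝ, V) w.pt [⋀^Fin k]→L[ℝ] ℝ).compContinuousLinearMap
    (mfderiv 𝓘(ℝ, B × (F × FormModel B F r k)) 𝓘(ℝ, V) (Tot.pt : FormBundle π r k → E) w)

/-- The canonical `(k+1)`-form `Ω = -dΘ` on `Λ^k_r E`. -/
def canonicalForm (π : Fibration B F V M E) (r k : ℕ) :
    KForm (B × (F × FormModel B F r k)) (FormBundle π r k) (k + 1) := fun w =>
  -extD (liouville π r k) w

/-- The extended multimomentum bundle `ℳπ = Λ^m_2 E`. -/
abbrev Momentum (π : Fibration B F V M E) (m : ℕ) : Type _ := FormBundle π 2 m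

/-- `ℳπ` as a fibration over `M`, with projection `π ∘ ν`. -/
abbrev momentumFibration (π : Fibration B F V M E) (m : ℕ) :
    Fibration B (F × FormModel B F 2 m) (B × (F × FormModel B F 2 m)) M (Momentum π m) :=
  (formCoords π 2 m).fibration

lemma canonicalForm_mem (π : Fibration B F V M E) (r k : ℕ) (w : FormBundle π r k) :
    canonicalForm π r k w ∈
      horizontalForms ((formCoords π r k).fibration.tangent w) (r + 1) (k + 1) := by
  refine Submodule.neg_mem _ (extD_mem_horizontalForms _ _ (fun p => ?_) w)
  refine comp_mem_horizontalForms p.val.2 _ fun v hv => ?_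
  have h1 : (formCoords π r k).fibration.tangent p = (π.tangent p.pt).comp
      (mfderiv 𝓘(ℝ, B × (F × FormModel B F r k)) 𝓘(ℝ, V) (Tot.pt : FormBundle π r k → E) p) :=
    mfderiv_comp p ((π.isSubmersion.contMDiff p.pt).mdifferentiableAt (by simp))
      (Tot.mdifferentiableAt_pt _ p)
  rw [h1] at hv
  exact hv

/-- The horizontal projector `h_z = z ∘ T_u π` of a jet `z`. -/
def horizontalProjector {π : Fibration B F V M E} (z : Jet π) :
    TangentSpace 𝓘(ℝ, V) z.pt →L[ℝ] TangentSpace 𝓘(ℝ, V) z.pt :=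
  z.val.1.comp (π.tangent z.pt)

/-- `♭_Ω : J¹(π ∘ ν) → Λ^{m+1}_2(ℳπ)`, `♭_Ω(z) = i_{h_z} Ω(ω) - (m - 1) Ω(ω)`, where `ω ∈ ℳπ`
is the base point of `z`. -/
def flatOmega (π : Fibration B F V M E) (m : ℕ) (z : Jet (momentumFibration π m)) :
    FormBundle (momentumFibration π m) 2 (m + 1) where
  pt := z.pt
  val := ⟨contractEnd (horizontalProjector z) (canonicalForm π 2 m z.pt) -
      ((m : ℝ) - 1) • canonicalForm π 2 m z.pt, by
    cases m with
    | zero =>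
      intro v s hs _
      have := Finset.card_le_univ s
      simp at this
      omega
    | succ k =>
      have h := contractEnd_sub_mem (k := k)
        (p := (momentumFibration π (k + 1)).tangent z.pt) (h := horizontalProjector z)
        (fun v => DFunLike.congr_fun z.val.2 ((momentumFibration π (k + 1)).tangent z.pt v))
        (fun v hv => by
          change z.val.1 ((momentumFibration π (k + 1)).tangent z.pt v) = 0
          rw [hv, map_zero])
        (canonicalForm_mem π 2 (k + 1) z.pt)
      have hk : ((k + 1 : ℕ) : ℝ) - 1 = k := by push_cast; ring
      rw [hk]
      exact h⟩

/-- The premultisymplectic form `Ω̃ = ♭_Ω^* Ω_{Λ^{m+1}_2 ℳπ}` on `J¹(π ∘ ν)`. -/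
def tildeOmega (π : Fibration B F V M E) (m : ℕ) :
    KForm (B × ((F × FormModel B F 2 m) × (B →L[ℝ] F × FormModel B F 2 m)))
      (Jet (momentumFibration π m)) (m + 1 + 1) :=
  pullback (flatOmega π m) (canonicalForm (momentumFibration π m) 2 (m + 1))

variable (B M) in
/-- A volume form on the `m`-dimensional manifold `M`. -/
structure VolumeForm (m : ℕ) where
  toForm : KForm B M m
  smooth : IsSmoothForm toForm
  ne_zero : ∀ x, toForm x ≠ 0

/-- The pullback of `η` to `E`, at the point `u`, as an element of `Λ^m_2 E`. -/
def VolumeForm.lift (π : Fibration B F V M E) {m : ℕ} (η : VolumeForm B M m) (u : E) :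
    FormFiber π 2 m u :=
  ⟨(η.toForm (π u)).compContinuousLinearMap (π.tangent u), by
    intro v s hs hv
    obtain ⟨i, hi⟩ := Finset.card_pos.1 (by omega : 0 < s.card)
    exact (η.toForm (π u)).map_coord_zero i (hv i hi)⟩

/-- The action `(t, ω) ↦ t η + ω` of `ℝ` on `ℳπ`. -/
def translate (π : Fibration B F V M E) {m : ℕ} (η : VolumeForm B M m) (t : ℝ)
    (w : Momentum π m) : Momentum π m :=
  ⟨w.pt, t • η.lift π w.pt + w.val⟩

/-- The infinitesimal generator `V_μ` of the action. -/
def generator (π : Fibration B F V M E) {m : ℕ} (η : VolumeForm B M m) (w : Momentum π m) :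
    TangentSpace 𝓘(ℝ, B × (F × FormModel B F 2 m)) w :=
  have h : translate π η 0 w = w := by simp [translate]
  h ▸ mfderiv 𝓘(ℝ, ℝ) 𝓘(ℝ, B × (F × FormModel B F 2 m)) (fun t => translate π η t w) 0 (1 : ℝ)

/-- A fibred map `ℳπ → Λ^m M` over `M`, regarded as an `m`-form on `ℳπ`. -/
def pulledDensity (π : Fibration B F V M E) {m : ℕ}
    (H : ∀ w : Momentum π m,
      TangentSpace 𝓘(ℝ, B) (momentumFibration π m w) [⋀^Fin m]→L[ℝ] ℝ) :
    KForm (B × (F × FormModel B F 2 m)) (Momentum π m) m := fun w =>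
  (H w).compContinuousLinearMap ((momentumFibration π m).tangent w)

/-- A Hamiltonian density: a smooth fibred map `ℋ : ℳπ → Λ^m M` over `M` such that
`i_{V_μ} dℋ = η`. -/
structure HamiltonianDensity (π : Fibration B F V M E) {m : ℕ} (η : VolumeForm B M m) where
  toFun : ∀ w : Momentum π m,
    TangentSpace 𝓘(ℝ, B) (momentumFibration π m w) [⋀^Fin m]→L[ℝ] ℝ
  smooth : IsSmoothForm (pulledDensity π toFun)
  contract_generator : ∀ (w : Momentum π m)
    (X : Fin m → TangentSpace 𝓘(ℝ, B × (F × FormModel B F 2 m)) w),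
    extD (pulledDensity π toFun) w (Matrix.vecCons (generator π η w) X) =
      η.toForm (momentumFibration π m w) fun i => (momentumFibration π m).tangent w (X i)

/-- The section `-dℋ : ℳπ → Λ^{m+1}_2(ℳπ)`. -/
def HamiltonianDensity.negD {π : Fibration B F V M E} {m : ℕ} {η : VolumeForm B M m}
    (H : HamiltonianDensity π η) (w : Momentum π m) :
    FormBundle (momentumFibration π m) 2 (m + 1) where
  pt := w
  val := ⟨-extD (pulledDensity π H.toFun) w, by
    refine Submodule.neg_mem _ (extD_mem_horizontalForms _ _ (fun p => ?_) w)
    intro v s hs hv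
    obtain ⟨i, hi⟩ := Finset.card_pos.1 (by omega : 0 < s.card)
    exact (H.toFun p).map_coord_zero i (hv i hi)⟩

/-- `S_ℋ = ♭_Ω⁻¹(-dℋ(ℳπ))`. -/
def HamiltonianDensity.lagrangianSet {π : Fibration B F V M E} {m : ℕ} {η : VolumeForm B M m}
    (H : HamiltonianDensity π η) : Set (Jet (momentumFibration π m)) :=
  flatOmega π m ⁻¹' range H.negD

end FieldTheory

end TulczyjewTriple

end

open TulczyjewTriple

/-! In adapted coordinates everything becomes constant-coefficient linear algebra. The fibre
coordinate of `Λ^k_r E` is the form itself, so the Liouville form is linear in the coordinates and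
`-dΘ` has constant coefficients (`canonicalForm_eq`). The projector `h_z` is affine in the jet
coordinate `l`, so `♭_Ω` covers the identity of `ℳπ` and reads `l ↦ flatModel 0 + flatLin l`
(`homeo_flatOmega`). Hence `Ω̃` is the pullback of a constant form by an affine map: it is constant
in suitable charts, therefore smooth and closed (`tildeOmega_eq`).

Over a point `q` of `ℳπ`, the equation of `S_ℋ` is `flatLin l = -dℋ(q) - flatModel 0`. The main
algebraic fact is `mem_range_flatLin`: a 2-horizontal form of degree `m + 1` is in the range of
`flatLin` as soon as its contraction with the generator `V_μ` vanishes on a horizontal basis. Both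
`-dℋ` and `flatModel 0` contribute `-η` there, so `i_{V_μ} dℋ = η` is what makes the equation
solvable over every `q`. Subtracting a smooth particular solution from `l` then turns `S_ℋ` into the
kernel of a linear map (`exists_slice_chart`).

The tangent vectors of `S_ℋ` are the solutions of `flatLin l = -Γ (x, y)`, where `Γ` is the
derivative of the coefficients of `dℋ`. On `m + 2` of them `Ω̃` equals the alternation of `Γ`, which
is `d(dℋ) = 0`; so `S_ℋ` is isotropic (`tildeModel_eq_zero`). Conversely, a vector `X` orthogonal to
the tangent space differs from a tangent vector with the same projection to `ℳπ` by a vertical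
vector `(0, 0, l)`, again orthogonal. Pairing it with tangent vectors gives `-flatLin l` on their
projections, and these are arbitrary by solvability; so `flatLin l = 0` and `X` is tangent
(`flatLin_eq_iff_forall_tildeModel`). -/

noncomputable section

namespace TulczyjewTriple

/-! ### Smooth maps into spaces of alternating forms. -/

section SmoothForms

variable {Q W : Type*} [NormedAddCommGroup Q] [NormedSpace ℝ Q]
  [NormedAddCommGroup W] [NormedSpace ℝ W] {k : ℕ}

/-- Evaluation is linear in the form and multilinear in the vectors: `flipMultilinear` turns the
vectors into a functional on forms, which is then applied to `h q`. -/
lemma contDiffAt_alternatingMap_apply {h : Q → W [⋀^Fin k]→L[ℝ] ℝ} {w : Q → Fin k → W} {x : Q}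
    {n : WithTop ℕ∞} (hh : ContDiffAt ℝ n h x) (hw : ContDiffAt ℝ n w x) :
    ContDiffAt ℝ n (fun q => h q (w q)) x := by
  let f : (W [⋀^Fin k]→L[ℝ] ℝ) →L[ℝ] ContinuousMultilinearMap ℝ (fun _ : Fin k => W) ℝ :=
    ContinuousAlternatingMap.toContinuousMultilinearMapCLM ℝ
  have h1 : ContDiffAt ℝ n (fun q => f.flipMultilinear (w q)) x :=
    ContDiff.comp_contDiffAt x (ContinuousMultilinearMap.contDiff _) hw
  exact h1.clm_apply hh

variable [FiniteDimensional ℝ W]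

variable (W k) in
/-- Evaluation of forms on the tuples of vectors of a basis. -/
def formEval : (W [⋀^Fin k]→L[ℝ] ℝ) →ₗ[ℝ] ((Fin k → Fin (Module.finrank ℝ W)) → ℝ) where
  toFun θ f := θ fun i => Module.finBasis ℝ W (f i)
  map_add' _ _ := rfl
  map_smul' _ _ := rfl

lemma ker_formEval : LinearMap.ker (formEval W k) = ⊥ := by
  rw [LinearMap.ker_eq_bot']
  intro θ hθ
  apply ContinuousAlternatingMap.toAlternatingMap_injective
  exact Module.Basis.ext_alternating (Module.finBasis ℝ W) fun f _ => congrFun hθ f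

instance finiteDimensional_forms : FiniteDimensional ℝ (W [⋀^Fin k]→L[ℝ] ℝ) :=
  FiniteDimensional.of_injective (formEval W k) (LinearMap.ker_eq_bot.1 ker_formEval)

/-- In finite dimension a form is recovered linearly from its finitely many values on tuples of
basis vectors, so smoothness can be tested on values. -/
lemma contDiffAt_alternatingMap {h : Q → W [⋀^Fin k]→L[ℝ] ℝ} {x : Q} {n : WithTop ℕ∞}
    (hh : ∀ v : Fin k → W, ContDiffAt ℝ n (fun q => h q v) x) : ContDiffAt ℝ n h x := by
  obtain ⟨g, hg⟩ := (formEval W k).exists_leftInverse_of_injective ker_formEval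
  have h1 : ContDiffAt ℝ n (fun q => formEval W k (h q)) x := contDiffAt_pi.2 fun f => hh _
  have h2 := g.toContinuousLinearMap.contDiff.contDiffAt.comp x h1
  refine h2.congr_of_eventuallyEq (Filter.Eventually.of_forall fun q => ?_)
  exact (LinearMap.congr_fun hg (h q)).symm

lemma contDiffAt_compContinuousLinearMap {W' : Type*} [NormedAddCommGroup W'] [NormedSpace ℝ W']
    {h : Q → W' [⋀^Fin k]→L[ℝ] ℝ} {g : Q → W →L[ℝ] W'} {x : Q} {n : WithTop ℕ∞}
    (hh : ContDiffAt ℝ n h x) (hg : ContDiffAt ℝ n g x) :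
    ContDiffAt ℝ n (fun q => (h q).compContinuousLinearMap (g q)) x :=
  contDiffAt_alternatingMap fun v => contDiffAt_alternatingMap_apply (w := fun q i => g q (v i)) hh
    (contDiffAt_pi.2 fun _ => hg.clm_apply contDiffAt_const)

end SmoothForms

/-! ### Forms and the exterior derivative in arbitrary charts. -/

section ChartIndependence

variable {V : Type*} [NormedAddCommGroup V] [NormedSpace ℝ V]
  {N : Type*} [TopologicalSpace N] [ChartedSpace V N] {k : ℕ}

/-- The expression of a form in an arbitrary chart. -/
def formInChart (φ : OpenPartialHomeomorph N V) (α : KForm V N k) (y : V) :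
    V [⋀^Fin k]→L[ℝ] ℝ :=
  (α (φ.symm y)).compContinuousLinearMap (mfderiv 𝓘(ℝ, V) 𝓘(ℝ, V) φ.symm y)

variable {φ ψ : OpenPartialHomeomorph N V}

lemma mdifferentiable_of_mem_maximalAtlas (hφ : φ ∈ IsManifold.maximalAtlas 𝓘(ℝ, V) ∞ N) :
    φ.MDifferentiable 𝓘(ℝ, V) 𝓘(ℝ, V) :=
  ⟨(contMDiffOn_of_mem_maximalAtlas hφ).mdifferentiableOn (by simp),
    (contMDiffOn_symm_of_mem_maximalAtlas hφ).mdifferentiableOn (by simp)⟩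

lemma contDiffOn_trans_of_mem_maximalAtlas
    (hφ : φ ∈ IsManifold.maximalAtlas 𝓘(ℝ, V) ∞ N)
    (hψ : ψ ∈ IsManifold.maximalAtlas 𝓘(ℝ, V) ∞ N) :
    ContDiffOn ℝ ∞ (ψ ∘ φ.symm) (φ.symm.trans ψ).source := by
  rw [← contMDiffOn_iff_contDiffOn]
  refine ContMDiffOn.comp (t := ψ.source) (contMDiffOn_of_mem_maximalAtlas hψ)
    ((contMDiffOn_symm_of_mem_maximalAtlas hφ).mono ?_) ?_
  · intro x hx; exact hx.1
  · intro x hx; exact hx.2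

lemma formInChart_comp_mfderiv (hφ : φ ∈ IsManifold.maximalAtlas 𝓘(ℝ, V) ∞ N)
    (α : KForm V N k) {x : N} (hx : x ∈ φ.source) :
    (formInChart φ α (φ x)).compContinuousLinearMap (mfderiv 𝓘(ℝ, V) 𝓘(ℝ, V) φ x) = α x := by
  have h := (mdifferentiable_of_mem_maximalAtlas hφ).symm_comp_deriv hx
  ext v
  have hx' : φ.symm (φ x) = x := φ.left_inv hx
  -- `φ.symm (φ x)` equals `x` only propositionally, so the point has to be generalised before the
  -- two forms can be compared.
  have key : ∀ (x' : N) (hx' : x' = x) (D : V →L[ℝ] V) (v : Fin k → V),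
      (∀ i, D (mfderiv 𝓘(ℝ, V) 𝓘(ℝ, V) φ x (v i)) = v i) →
      α x' (fun i => D (mfderiv 𝓘(ℝ, V) 𝓘(ℝ, V) φ x (v i))) = α x v := by
    rintro x' rfl D v hv
    congr 1
    funext i
    exact hv i
  exact key _ hx' _ v fun i => DFunLike.congr_fun h (v i)

/-- The differential of a chart is invertible, so the coefficient form is unique. This converts a
pointwise formula for `α` into its chart expression. -/
lemma formInChart_eq_iff (hφ : φ ∈ IsManifold.maximalAtlas 𝓘(ℝ, V) ∞ N)
    (α : KForm V N k) {x : N} (hx : x ∈ φ.source) (θ : V [⋀^Fin k]→L[ℝ] ℝ)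
    (h : α x = θ.compContinuousLinearMap (mfderiv 𝓘(ℝ, V) 𝓘(ℝ, V) φ x)) :
    formInChart φ α (φ x) = θ := by
  have h1 := (formInChart_comp_mfderiv hφ α hx).trans h
  have h2 := (mdifferentiable_of_mem_maximalAtlas hφ).mfderiv hx
  have h3 := (mdifferentiable_of_mem_maximalAtlas hφ).comp_symm_deriv (φ.map_source hx)
  rw [φ.left_inv hx] at h3
  ext v
  have h4 := DFunLike.congr_fun h1
    (fun i => mfderiv 𝓘(ℝ, V) 𝓘(ℝ, V) φ.symm (φ x) (v i) : Fin k → V)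
  have h5 : ∀ i, mfderiv 𝓘(ℝ, V) 𝓘(ℝ, V) φ x (mfderiv 𝓘(ℝ, V) 𝓘(ℝ, V) φ.symm (φ x) (v i))
    = v i := fun i => DFunLike.congr_fun h3 (v i)
  have h6 : (fun i => mfderiv 𝓘(ℝ, V) 𝓘(ℝ, V) φ x
    (mfderiv 𝓘(ℝ, V) 𝓘(ℝ, V) φ.symm (φ x) (v i)) : Fin k → V) = v := funext h5
  exact ((congrArg (formInChart φ α (φ x)) h6).symm.trans h4).trans (congrArg θ h6)

lemma mfderiv_comp_symm_eq (hφ : φ ∈ IsManifold.maximalAtlas 𝓘(ℝ, V) ∞ N)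
    (hψ : ψ ∈ IsManifold.maximalAtlas 𝓘(ℝ, V) ∞ N) {y : V}
    (hy : y ∈ (φ.symm.trans ψ).source) (v : V) :
    fderiv ℝ (ψ ∘ φ.symm) y v = mfderiv 𝓘(ℝ, V) 𝓘(ℝ, V) ψ (φ.symm y)
      (mfderiv 𝓘(ℝ, V) 𝓘(ℝ, V) φ.symm y v) := by
  have h1 : mfderiv 𝓘(ℝ, V) 𝓘(ℝ, V) (ψ ∘ φ.symm) y = _ := mfderiv_comp y
    ((mdifferentiable_of_mem_maximalAtlas hψ).mdifferentiableAt hy.2)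
    ((mdifferentiable_of_mem_maximalAtlas hφ).mdifferentiableAt_symm hy.1)
  rw [mfderiv_eq_fderiv] at h1
  exact DFunLike.congr_fun h1 v

lemma formInChart_trans (hφ : φ ∈ IsManifold.maximalAtlas 𝓘(ℝ, V) ∞ N)
    (hψ : ψ ∈ IsManifold.maximalAtlas 𝓘(ℝ, V) ∞ N) (α : KForm V N k) {y : V}
    (hy : y ∈ (φ.symm.trans ψ).source) :
    formInChart φ α y = (formInChart ψ α ((ψ ∘ φ.symm) y)).compContinuousLinearMap
      (fderiv ℝ (ψ ∘ φ.symm) y) := by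
  have h1 := formInChart_comp_mfderiv hψ α hy.2
  ext v
  refine (DFunLike.congr_fun h1
    (fun i => mfderiv 𝓘(ℝ, V) 𝓘(ℝ, V) φ.symm y (v i))).symm.trans ?_
  change formInChart ψ α ((ψ ∘ φ.symm) y) _ = formInChart ψ α ((ψ ∘ φ.symm) y) _
  congr 1
  funext i
  exact (mfderiv_comp_symm_eq hφ hψ hy (v i)).symm

variable [IsManifold 𝓘(ℝ, V) ∞ N]

/-- `extD` is computed in the preferred chart at `x`. Naturality of `d` under the transition map,
which is smooth enough to have a symmetric second derivative, transfers the computation to any chart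
of the maximal atlas. -/
lemma extD_eq_of_chart (hφ : φ ∈ IsManifold.maximalAtlas 𝓘(ℝ, V) ∞ N) (α : KForm V N k)
    {x : N} (hx : x ∈ φ.source) (hd : DifferentiableAt ℝ (formInChart φ α) (φ x)) :
    extD α x = (extDeriv (formInChart φ α) (φ x)).compContinuousLinearMap
      (mfderiv 𝓘(ℝ, V) 𝓘(ℝ, V) φ x) := by
  set χ := chartAt V x with hχdef
  have hχ : χ ∈ IsManifold.maximalAtlas 𝓘(ℝ, V) ∞ N := IsManifold.chart_mem_maximalAtlas x
  have hxχ : x ∈ χ.source := mem_chart_source V x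
  have hy : χ x ∈ (χ.symm.trans φ).source := by
    refine ⟨χ.map_source hxχ, ?_⟩
    change χ.symm (χ x) ∈ φ.source
    rwa [χ.left_inv hxχ]
  have hφχ : (φ ∘ χ.symm) (χ x) = φ x := congrArg φ (χ.left_inv hxχ)
  have hsrc := (χ.symm.trans φ).open_source.mem_nhds hy
  have h1 : formInChart χ α =ᶠ[𝓝 (χ x)] fun y =>
      (formInChart φ α ((φ ∘ χ.symm) y)).compContinuousLinearMap (fderiv ℝ (φ ∘ χ.symm) y) := by
    filter_upwards [hsrc] with y hy using formInChart_trans hχ hφ α hy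
  have h2 : extDeriv (formInChart χ α) (χ x) = _ := h1.extDeriv_eq.trans
    (extDeriv_pullback (r := ∞) (by rwa [hφχ])
      ((contDiffOn_trans_of_mem_maximalAtlas hχ hφ).contDiffAt hsrc) (by
        rw [minSmoothness_of_isRCLikeNormedField]
        exact WithTop.coe_le_coe.2 (le_top : (2 : ℕ∞) ≤ ⊤)))
  rw [hφχ] at h2
  have h3 : extD α x = (extDeriv (formInChart χ α) (χ x)).compContinuousLinearMap
      (mfderiv 𝓘(ℝ, V) 𝓘(ℝ, V) χ x) := rfl
  rw [h3, h2]
  ext v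
  change extDeriv (formInChart φ α) (φ x) _ = extDeriv (formInChart φ α) (φ x) _
  congr 1
  funext i
  have h4 := mfderiv_comp_symm_eq hχ hφ hy (mfderiv 𝓘(ℝ, V) 𝓘(ℝ, V) χ x (v i))
  have h5 := DFunLike.congr_fun
    ((mdifferentiable_of_mem_maximalAtlas hχ).symm_comp_deriv hxχ) (v i)
  have h6 : mfderiv 𝓘(ℝ, V) 𝓘(ℝ, V) χ.symm (χ x) (mfderiv 𝓘(ℝ, V) 𝓘(ℝ, V) χ x (v i)) = v i := h5
  refine h4.trans ?_
  rw [h6, χ.left_inv hxχ]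
  rfl

variable [FiniteDimensional ℝ V]

/-- `IsSmoothForm` speaks of preferred charts only. Near each point the expression in `φ` is the
pullback of a preferred one by a smooth transition map. -/
lemma IsSmoothForm.contDiffOn_formInChart {α : KForm V N k} (hα : IsSmoothForm α)
    (hφ : φ ∈ IsManifold.maximalAtlas 𝓘(ℝ, V) ∞ N) :
    ContDiffOn ℝ ∞ (formInChart φ α) φ.target := by
  intro y hy
  refine ContDiffAt.contDiffWithinAt ?_
  set x := φ.symm y
  set χ := chartAt V x with hχdef
  have hχ : χ ∈ IsManifold.maximalAtlas 𝓘(ℝ, V) ∞ N := IsManifold.chart_mem_maximalAtlas x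
  have hy' : y ∈ (φ.symm.trans χ).source := ⟨hy, mem_chart_source V x⟩
  have hsrc := (φ.symm.trans χ).open_source.mem_nhds hy'
  have h1 : formInChart φ α =ᶠ[𝓝 y] fun y =>
      (formInChart χ α ((χ ∘ φ.symm) y)).compContinuousLinearMap (fderiv ℝ (χ ∘ φ.symm) y) := by
    filter_upwards [hsrc] with y hy using formInChart_trans hφ hχ α hy
  have h2 := (contDiffOn_trans_of_mem_maximalAtlas hφ hχ).contDiffAt hsrc
  refine ContDiffAt.congr_of_eventuallyEq ?_ h1
  have h3 : ContDiffAt ℝ ∞ (formInChart χ α) ((χ ∘ φ.symm) y) :=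
    (hα x).contDiffAt (χ.open_target.mem_nhds (χ.map_source (mem_chart_source V x)))
  exact contDiffAt_compContinuousLinearMap (h3.comp y h2) (h2.fderiv_right (by simp))

/-- A form which is locally constant in suitable charts is smooth and closed. -/
lemma isPremultisymplectic_of_locally_const {α : KForm V N k}
    (h : ∀ x : N, ∃ φ ∈ IsManifold.maximalAtlas 𝓘(ℝ, V) ∞ N, x ∈ φ.source ∧
      ∃ θ : V [⋀^Fin k]→L[ℝ] ℝ, ∀ y ∈ φ.source,
        α y = θ.compContinuousLinearMap (mfderiv 𝓘(ℝ, V) 𝓘(ℝ, V) φ y)) :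
    IsPremultisymplectic α := by
  have hloc : ∀ x : N, ∃ φ ∈ IsManifold.maximalAtlas 𝓘(ℝ, V) ∞ N, x ∈ φ.source ∧
      ∃ θ : V [⋀^Fin k]→L[ℝ] ℝ, formInChart φ α =ᶠ[𝓝 (φ x)] fun _ => θ := by
    intro x
    obtain ⟨φ, hφ, hx, θ, hθ⟩ := h x
    refine ⟨φ, hφ, hx, θ, ?_⟩
    filter_upwards [φ.open_target.mem_nhds (φ.map_source hx)] with y hy
    have := formInChart_eq_iff hφ α (φ.map_target hy) θ (hθ _ (φ.map_target hy))
    rwa [φ.right_inv hy] at this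
  constructor
  · intro x₀ y hy
    refine ContDiffAt.contDiffWithinAt ?_
    set χ := chartAt V x₀
    have hχ : χ ∈ IsManifold.maximalAtlas 𝓘(ℝ, V) ∞ N := IsManifold.chart_mem_maximalAtlas x₀
    obtain ⟨φ, hφ, hx, θ, hθ⟩ := hloc (χ.symm y)
    have hy' : y ∈ (χ.symm.trans φ).source := ⟨hy, hx⟩
    have hsrc := (χ.symm.trans φ).open_source.mem_nhds hy'
    have h2 := (contDiffOn_trans_of_mem_maximalAtlas hχ hφ).contDiffAt hsrc
    have h1 : chartRep α x₀ =ᶠ[𝓝 y] fun y =>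
        (formInChart φ α ((φ ∘ χ.symm) y)).compContinuousLinearMap (fderiv ℝ (φ ∘ χ.symm) y) := by
      filter_upwards [hsrc] with y hy using formInChart_trans hχ hφ α hy
    refine ContDiffAt.congr_of_eventuallyEq ?_ h1
    have h3 : ContDiffAt ℝ ∞ (formInChart φ α) ((φ ∘ χ.symm) y) :=
      contDiffAt_const.congr_of_eventuallyEq hθ
    exact contDiffAt_compContinuousLinearMap (h3.comp y h2) (h2.fderiv_right (by simp))
  · intro x
    obtain ⟨φ, hφ, hx, θ, hθ⟩ := hloc x
    rw [extD_eq_of_chart hφ α hx ((differentiableAt_const θ).congr_of_eventuallyEq hθ),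
      hθ.extDeriv_eq]
    have : extDeriv (fun _ : V => θ) (φ x) = 0 := by
      ext v
      simp [extDeriv, ContinuousAlternatingMap.alternatizeUncurryFin_apply]
    rw [this]
    rfl

end ChartIndependence

/-! ### Values that determine a 2-horizontal form. -/

section HorizontalForms

variable {B F : Type*} [NormedAddCommGroup B] [NormedSpace ℝ B]
  [NormedAddCommGroup F] [NormedSpace ℝ F] {k m : ℕ}

/-- Split every argument into vertical and horizontal parts and expand. Terms with two or more
vertical entries vanish by 2-horizontality; those with none or one are the two hypotheses. -/
lemma eq_zero_of_mem_horizontalForms_two {θ : (B × F) [⋀^Fin k]→L[ℝ] ℝ}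
    (hθ : θ ∈ horizontalForms (ContinuousLinearMap.fst ℝ B F) 2 k)
    (h0 : ∀ b : Fin k → B, θ (fun i => (b i, 0)) = 0)
    (h1 : ∀ (b : Fin k → B) (j : Fin k) (u : F),
      θ (Function.update (fun i => (b i, 0)) j (0, u)) = 0) : θ = 0 := by
  classical
  ext v
  have hv : v = (fun i => ((0 : B), (v i).2)) + fun i => ((v i).1, (0 : F)) := by
    funext i; simp
  rw [hv]
  refine (θ.toMultilinearMap.map_add_univ _ _).trans (Finset.sum_eq_zero fun s _ => ?_)
  change θ _ = 0
  rcases le_or_gt 2 s.card with hs | hs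
  · exact hθ _ s hs fun i hi => by simp [Finset.piecewise_eq_of_mem _ _ _ hi]
  · rcases s.eq_empty_or_nonempty with rfl | hne
    · simpa using h0 fun i => (v i).1
    · obtain ⟨j, rfl⟩ := Finset.card_eq_one.1 (by have := hne.card_pos; omega : s.card = 1)
      rw [Finset.piecewise_singleton]
      exact h1 _ _ _

lemma alternatingMap_eq_zero_of_basis (b : Module.Basis (Fin m) ℝ B) (α : B [⋀^Fin m]→L[ℝ] ℝ)
    (h : α b = 0) : α = 0 := by
  apply ContinuousAlternatingMap.toAlternatingMap_injective
  have := AlternatingMap.eq_smul_basis_det b α.toAlternatingMap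
  rw [this]
  have h' : α.toAlternatingMap b = 0 := h
  rw [h', zero_smul]
  rfl

lemma alternatingMap_eq_zero_of_finrank_lt [FiniteDimensional ℝ B]
    (h : Module.finrank ℝ B < k) (α : B [⋀^Fin k]→L[ℝ] ℝ) (v : Fin k → B) : α v = 0 := by
  refine α.toAlternatingMap.map_linearDependent v fun hv => ?_
  have := hv.fintype_card_le_finrank
  simp at this
  omega

/-- A `2`-horizontal form of degree `m + 1`, where `m` is the dimension of the base, is determined
by its contractions with vertical vectors on a basis of the base. -/
lemma eq_zero_of_forall_vecCons (b : Module.Basis (Fin m) ℝ B)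
    {Φ : (B × F) [⋀^Fin (m + 1)]→L[ℝ] ℝ}
    (hΦ : Φ ∈ horizontalForms (ContinuousLinearMap.fst ℝ B F) 2 (m + 1))
    (h : ∀ u : F, Φ (Matrix.vecCons (0, u) fun i => (b i, 0)) = 0) : Φ = 0 := by
  classical
  have : FiniteDimensional ℝ B := b.finiteDimensional_of_finite
  -- For fixed `u` this is a form of top degree on the base, so its value on one basis controls all
  -- tuples.
  have key : ∀ (c : Fin m → B) (u : F), Φ (Matrix.vecCons (0, u) fun i => (c i, 0)) = 0 := by
    intro c u
    have h2 := alternatingMap_eq_zero_of_basis b ((Φ.curryLeft (0, u)).compContinuousLinearMap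
      (ContinuousLinearMap.inl ℝ B F)) (h u)
    exact DFunLike.congr_fun h2 c
  have key0 : ∀ (c : Fin (m + 1) → B) (u : F),
      Φ (Function.update (fun i => (c i, 0)) 0 (0, u)) = 0 := by
    intro c u
    rw [← key (Fin.tail c) u]
    congr 1
    funext i
    refine Fin.cases ?_ (fun j => ?_) i <;> simp [Fin.tail]
  refine eq_zero_of_mem_horizontalForms_two hΦ (fun c => ?_) fun c j u => ?_
  · exact alternatingMap_eq_zero_of_finrank_lt (by simp [Module.finrank_eq_card_basis b])
      (Φ.compContinuousLinearMap (ContinuousLinearMap.inl ℝ B F)) c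
  · by_cases hj : j = 0
    · subst hj; exact key0 c u
    · have h3 := Φ.toAlternatingMap.map_swap (Function.update (fun i => (c i, 0)) j (0, u))
        (Ne.symm hj)
      have h4 : (Function.update (fun i => (c i, (0 : F))) j (0, u)) ∘ Equiv.swap 0 j =
          Function.update (fun i => ((c ∘ Equiv.swap 0 j) i, (0 : F))) 0 (0, u) := by
        funext i
        by_cases hi : i = 0
        · subst hi; simp
        · by_cases hij : i = j
          · subst hij; simp [Ne.symm hj, hi]
          · simp [Equiv.swap_apply_of_ne_of_ne hi hij, hi, hij]
      rw [h4] at h3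
      have h5 := key0 (c ∘ Equiv.swap 0 j) u
      change Φ _ = -Φ _ at h3
      rw [h5] at h3
      linarith

/-- A `2`-horizontal form of degree the dimension of the base is determined by its value on a
horizontal basis and its contractions with the maps `B → F`. -/
lemma eq_zero_of_forall_sum_update (b : Module.Basis (Fin m) ℝ B)
    {θ : (B × F) [⋀^Fin m]→L[ℝ] ℝ}
    (hθ : θ ∈ horizontalForms (ContinuousLinearMap.fst ℝ B F) 2 m)
    (h0 : θ (fun i => (b i, 0)) = 0)
    (h1 : ∀ κ : B →L[ℝ] F, ∑ j, θ (Function.update (fun i => (b i, 0)) j (0, κ (b j))) = 0) :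
    θ = 0 := by
  classical
  have : FiniteDimensional ℝ B := b.finiteDimensional_of_finite
  refine eq_zero_of_mem_horizontalForms_two hθ (fun c => ?_) fun c j u => ?_
  · exact DFunLike.congr_fun (alternatingMap_eq_zero_of_basis b
      (θ.compContinuousLinearMap (ContinuousLinearMap.inl ℝ B F)) h0) c
  · have h2 : ∀ (κ : B →L[ℝ] F) (c : Fin m → B),
        ∑ j, θ (Function.update (fun i => (c i, 0)) j (0, κ (c j))) = 0 := by
      intro κ c
      have h3 := alternatingMap_eq_zero_of_basis b
        ((contractEnd ((ContinuousLinearMap.inr ℝ B F).comp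
          (κ.comp (ContinuousLinearMap.fst ℝ B F))) θ).compContinuousLinearMap
            (ContinuousLinearMap.inl ℝ B F)) ((contractEnd_apply _ _ _).trans (h1 κ))
      exact (contractEnd_apply _ _ _).symm.trans (DFunLike.congr_fun h3 c)
    -- To isolate the summand `j`: the other `m - 1` vectors span a proper subspace `P`, so some `κ`
    -- kills `P` and sends a vector `w` outside `P` to `u`. Replacing `c j` by `w` is harmless,
    -- because slot `j` is overwritten by `(0, u)`.
    set P : Submodule ℝ B := Submodule.span ℝ (c '' {j}ᶜ) with hP
    have hPlt : P < ⊤ := by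
      refine lt_top_iff_ne_top.2 fun htop => ?_
      have h4 : Module.finrank ℝ P ≤ ((Finset.univ.erase j).image c).card := by
        have : P = Submodule.span ℝ (((Finset.univ.erase j).image c : Finset B) : Set B) := by
          rw [hP]
          congr 1
          ext x
          simp [and_comm, eq_comm]
        rw [this]
        exact finrank_span_finset_le_card _
      rw [htop, finrank_top, Module.finrank_eq_card_basis b, Fintype.card_fin] at h4
      have h5 := h4.trans Finset.card_image_le
      rw [Finset.card_erase_of_mem (Finset.mem_univ _), Finset.card_univ, Fintype.card_fin] at h5
      have := j.pos
      omega
    obtain ⟨w, -, hw⟩ := SetLike.exists_of_lt hPlt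
    obtain ⟨f, hf1, hf2⟩ := Submodule.exists_dual_map_eq_bot_of_notMem hw inferInstance
    have hfP : ∀ x ∈ P, f x = 0 := by
      intro x hx
      have : f x ∈ P.map f := ⟨x, hx, rfl⟩
      rw [hf2] at this
      simpa using this
    let κ : B →L[ℝ] F := (LinearMap.toContinuousLinearMap f).smulRight ((f w)⁻¹ • u)
    have h6 := h2 κ (Function.update c j w)
    rw [Finset.sum_eq_single j] at h6
    · rw [← h6]
      congr 1
      funext i
      by_cases hi : i = j
      · subst hi; simp [κ, hf1]
      · simp [hi]
    · intro i _ hi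
      have h7 : κ (c i) = 0 := by
        have := hfP (c i) (Submodule.subset_span ⟨i, hi, rfl⟩)
        simp [κ, this]
      refine θ.map_coord_zero i ?_
      simp [hi, h7]
    · simp

end HorizontalForms

/-! ### Linearity of the contraction in the endomorphism. -/

section Contraction

variable {T : Type*} [AddCommGroup T] [Module ℝ T] [TopologicalSpace T] {k : ℕ}

lemma contractEnd_add [IsTopologicalAddGroup T] (h h' : T →L[ℝ] T) (Ω : T [⋀^Fin k]→L[ℝ] ℝ) :
    contractEnd (h + h') Ω = contractEnd h Ω + contractEnd h' Ω := by
  classical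
  ext v
  simp only [contractEnd_apply, ContinuousAlternatingMap.add_apply,
    add_apply, ← Finset.sum_add_distrib]
  exact Finset.sum_congr rfl fun i _ => Ω.map_update_add v i _ _

lemma contractEnd_smul [ContinuousConstSMul ℝ T] (c : ℝ) (h : T →L[ℝ] T) (Ω : T [⋀^Fin k]→L[ℝ] ℝ) :
    contractEnd (c • h) Ω = c • contractEnd h Ω := by
  classical
  ext v
  simp only [contractEnd_apply, ContinuousAlternatingMap.smul_apply,
    smul_apply, Finset.smul_sum]
  exact Finset.sum_congr rfl fun i _ => Ω.map_update_smul v i _ _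

end Contraction

/-! ### Coordinate models of the canonical form and of `♭_Ω`. -/

section Model

variable (B F : Type*) [NormedAddCommGroup B] [NormedSpace ℝ B]
  [NormedAddCommGroup F] [NormedSpace ℝ F] (r k m : ℕ)

/-- The Liouville form in coordinates, at the points with fibre coordinate `θ`. -/
def liouvilleModel : FormModel B F r k →L[ℝ] (B × (F × FormModel B F r k)) [⋀^Fin k]→L[ℝ] ℝ :=
  (ContinuousAlternatingMap.compContinuousLinearMapCLM
    ((ContinuousLinearMap.fst ℝ B (F × FormModel B F r k)).prod
      ((ContinuousLinearMap.fst ℝ F (FormModel B F r k)).comp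
        (ContinuousLinearMap.snd ℝ B (F × FormModel B F r k))))).comp FormModel.toForm

/-- The canonical form in coordinates, which is constant. -/
def canonicalModel : (B × (F × FormModel B F r k)) [⋀^Fin (k + 1)]→L[ℝ] ℝ :=
  -ContinuousAlternatingMap.alternatizeUncurryFin ((liouvilleModel B F r k).comp
    ((ContinuousLinearMap.snd ℝ F (FormModel B F r k)).comp
      (ContinuousLinearMap.snd ℝ B (F × FormModel B F r k))))

variable {B F r k}

lemma canonicalModel_apply (X : Fin (k + 1) → B × (F × FormModel B F r k)) :
    canonicalModel B F r k X = -∑ i : Fin (k + 1), (-1 : ℝ) ^ (i : ℕ) *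
      (X i).2.2.toForm fun j => ((X (i.succAbove j)).1, (X (i.succAbove j)).2.1) := by
  change -(ContinuousAlternatingMap.alternatizeUncurryFin _ X) = _
  rw [ContinuousAlternatingMap.alternatizeUncurryFin_apply]
  congr 1
  refine Finset.sum_congr rfl fun i _ => ?_
  rw [zsmul_eq_mul]
  push_cast
  rfl

/-- The coefficients are linear in `q`, so their derivative is the same linear map at every point.
-/
lemma extDeriv_liouvilleModel (q : B × (F × FormModel B F r k)) :
    extDeriv (fun q : B × (F × FormModel B F r k) => liouvilleModel B F r k q.2.2) q =
      -canonicalModel B F r k := by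
  have h : (fun q : B × (F × FormModel B F r k) => liouvilleModel B F r k q.2.2) =
    (liouvilleModel B F r k).comp ((ContinuousLinearMap.snd ℝ F (FormModel B F r k)).comp
      (ContinuousLinearMap.snd ℝ B (F × FormModel B F r k))) := rfl
  rw [extDeriv, h, ContinuousLinearMap.fderiv, canonicalModel, neg_neg]

/-- The Liouville form is `r`-horizontal at every point, and the exterior derivative raises the
horizontality index by one. -/
lemma canonicalModel_mem : canonicalModel B F r k ∈
    horizontalForms (ContinuousLinearMap.fst ℝ B (F × FormModel B F r k)) (r + 1) (k + 1) := by
  rw [← neg_mem_iff, ← extDeriv_liouvilleModel 0]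
  refine extDeriv_mem_horizontalForms _ _ _ (Filter.Eventually.of_forall fun q => ?_)
  exact comp_mem_horizontalForms q.2.2.toForm_mem _ fun v hv => hv

variable (B) in
/-- The horizontal projector `(b, y) ↦ (b, l b)` in coordinates. -/
def projectorModel {Y : Type*} [NormedAddCommGroup Y] [NormedSpace ℝ Y] (l : B →L[ℝ] Y) :
    B × Y →L[ℝ] B × Y :=
  ((ContinuousLinearMap.id ℝ B).prod l).comp (ContinuousLinearMap.fst ℝ B Y)

variable (B F) in
/-- The map `♭_Ω` on the fibre coordinates. -/
def flatModel (l : B →L[ℝ] F × FormModel B F 2 m) :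
    (B × (F × FormModel B F 2 m)) [⋀^Fin (m + 1)]→L[ℝ] ℝ :=
  contractEnd (projectorModel B l) (canonicalModel B F 2 m) -
    ((m : ℝ) - 1) • canonicalModel B F 2 m

variable (B F) in
/-- The linear part of `flatModel`. -/
def flatLin : (B →L[ℝ] F × FormModel B F 2 m) →ₗ[ℝ]
    (B × (F × FormModel B F 2 m)) [⋀^Fin (m + 1)]→L[ℝ] ℝ where
  toFun l := contractEnd ((ContinuousLinearMap.inr ℝ B _).comp
    (l.comp (ContinuousLinearMap.fst ℝ B _))) (canonicalModel B F 2 m)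
  map_add' l l' := by
    rw [← contractEnd_add, ContinuousLinearMap.add_comp, ContinuousLinearMap.comp_add]
  map_smul' c l := by
    rw [RingHom.id_apply, ← contractEnd_smul, ContinuousLinearMap.smul_comp,
      ContinuousLinearMap.comp_smul]

variable {m}

lemma flatLin_apply (l : B →L[ℝ] F × FormModel B F 2 m)
    (X : Fin (m + 1) → B × (F × FormModel B F 2 m)) :
    flatLin B F m l X =
      ∑ i, canonicalModel B F 2 m (Function.update X i (0, l (X i).1)) :=
  contractEnd_apply _ _ _

/-- The projector of `l` is that of `0` plus `(x, y) ↦ (0, l x)`, and contraction is linear in the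
endomorphism; so `♭_Ω` is affine on fibres. -/
lemma flatModel_eq (l : B →L[ℝ] F × FormModel B F 2 m) :
    flatModel B F m l = flatModel B F m 0 + flatLin B F m l := by
  have h : projectorModel B l = projectorModel B 0 + (ContinuousLinearMap.inr ℝ B _).comp
      (l.comp (ContinuousLinearMap.fst ℝ B _)) := by
    ext v <;> simp [projectorModel]
  rw [flatModel, h, contractEnd_add, flatModel, flatLin]
  change _ = _ + contractEnd _ _
  abel

/-- With `m = k + 1` the canonical form has degree `k + 2` and is 3-horizontal, so `m - 1 = k` is
exactly the constant required by `contractEnd_sub_mem`. -/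
lemma flatModel_mem (hm : 1 ≤ m) (l : B →L[ℝ] F × FormModel B F 2 m) :
    flatModel B F m l ∈ horizontalForms (ContinuousLinearMap.fst ℝ B _) 2 (m + 1) := by
  obtain ⟨k, rfl⟩ := Nat.exists_eq_add_of_le' hm
  have hk : ((k + 1 : ℕ) : ℝ) - 1 = k := by push_cast; ring
  rw [flatModel, hk]
  refine contractEnd_sub_mem (fun v => rfl) (fun v hv => ?_) canonicalModel_mem
  have hv' : v.1 = 0 := hv
  simp [projectorModel, hv']

lemma flatLin_mem (hm : 1 ≤ m) (l : B →L[ℝ] F × FormModel B F 2 m) :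
    flatLin B F m l ∈ horizontalForms (ContinuousLinearMap.fst ℝ B _) 2 (m + 1) := by
  have h := Submodule.sub_mem _ (flatModel_mem hm l) (flatModel_mem hm 0)
  rwa [flatModel_eq l, add_sub_cancel_left] at h

/-- The pullback of a form on the base, in coordinates. -/
def volumeModel (vol : B [⋀^Fin m]→L[ℝ] ℝ) : FormModel B F 2 m :=
  FormModel.mk (vol.compContinuousLinearMap (ContinuousLinearMap.fst ℝ B F)) (by
    intro v s hs hv
    obtain ⟨i, hi⟩ := Finset.card_pos.1 (by omega : 0 < s.card)
    exact vol.map_coord_zero i (hv i hi))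

lemma volumeModel_toForm_apply (vol : B [⋀^Fin m]→L[ℝ] ℝ) (v : Fin m → B × F) :
    (volumeModel vol : FormModel B F 2 m).toForm v = vol fun i => (v i).1 := rfl

/-- The first argument is `V_μ` in coordinates. The projector of `0` fixes the `m` horizontal
arguments and kills the vertical one, so contraction multiplies the value of `Ω` by `m`; subtracting
`m - 1` copies leaves one, namely `-vol b`. -/
lemma flatModel_zero_apply (vol : B [⋀^Fin m]→L[ℝ] ℝ) (b : Fin m → B) :
    flatModel B F m 0 (Matrix.vecCons (0, (0, volumeModel vol)) fun i => (b i, 0)) = -vol b := by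
  set X : Fin (m + 1) → B × (F × FormModel B F 2 m) :=
    Matrix.vecCons (0, (0, volumeModel vol)) fun i => (b i, 0) with hX
  have h1 : canonicalModel B F 2 m X = -vol b := by
    rw [canonicalModel_apply, Fin.sum_univ_succ, Finset.sum_eq_zero]
    · simp [hX, volumeModel_toForm_apply]
    · intro i _
      simp [hX]
  have h2 : contractEnd (projectorModel B 0) (canonicalModel B F 2 m) X =
      m * canonicalModel B F 2 m X := by
    rw [contractEnd_apply, Fin.sum_univ_succ]
    have h3 : ∀ i : Fin m, Function.update X i.succ (projectorModel B 0 (X i.succ)) = X := by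
      intro i
      rw [Function.update_eq_self_iff]
      simp [hX, projectorModel]
    have h4 : canonicalModel B F 2 m (Function.update X 0 (projectorModel B 0 (X 0))) = 0 := by
      refine (canonicalModel B F 2 m).map_coord_zero 0 ?_
      simp [hX, projectorModel]
    rw [h4]
    simp [h3]
  change contractEnd _ _ X - ((m : ℝ) - 1) * canonicalModel B F 2 m X = _
  rw [h2, h1]
  ring

end Model

/-! ### The range of the linear part of `♭_Ω`. -/

section Range

variable {B F : Type*} [NormedAddCommGroup B] [NormedSpace ℝ B]
  [NormedAddCommGroup F] [NormedSpace ℝ F] {m : ℕ}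

/-- Contraction with vertical vectors, evaluated on a basis of the base. -/
def verticalEval {Y : Type*} [NormedAddCommGroup Y] [NormedSpace ℝ Y]
    (b : Module.Basis (Fin m) ℝ B) :
    ((B × Y) [⋀^Fin (m + 1)]→L[ℝ] ℝ) →ₗ[ℝ] Module.Dual ℝ Y where
  toFun Φ :=
    { toFun := fun y => Φ (Matrix.vecCons (0, y) fun i => (b i, 0))
      map_add' := fun y y' => by
        have h := Φ.toAlternatingMap.map_vecCons_add (fun i => (b i, (0 : Y))) (0, y) (0, y')
        rw [Prod.mk_add_mk, add_zero] at h
        exact h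
      map_smul' := fun c y => by
        have h := Φ.toAlternatingMap.map_vecCons_smul (fun i => (b i, (0 : Y))) c (0, y)
        rw [Prod.smul_mk, smul_zero] at h
        exact h }
  map_add' _ _ := rfl
  map_smul' _ _ := rfl

lemma verticalEval_apply {Y : Type*} [NormedAddCommGroup Y] [NormedSpace ℝ Y]
    (b : Module.Basis (Fin m) ℝ B) (Φ : (B × Y) [⋀^Fin (m + 1)]→L[ℝ] ℝ) (y : Y) :
    verticalEval b Φ y = Φ (Matrix.vecCons (0, y) fun i => (b i, 0)) := rfl

/-- The jet `(κ, 0)` inserts no form component, so in each term of the canonical form only `θ`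
itself, from slot `0`, can be evaluated. These jets detect the part of `θ` with one vertical
argument. -/
lemma verticalEval_flatLin_inl (b : Module.Basis (Fin m) ℝ B) (κ : B →L[ℝ] F)
    (u : F) (θ : FormModel B F 2 m) :
    verticalEval b (flatLin B F m ((ContinuousLinearMap.inl ℝ F _).comp κ)) (u, θ) =
      -∑ j, θ.toForm (Function.update (fun i => (b i, 0)) j (0, κ (b j))) := by
  rw [verticalEval_apply, flatLin_apply, Fin.sum_univ_succ, ← Finset.sum_neg_distrib]
  have h0 : canonicalModel B F 2 m (Function.update
      (Matrix.vecCons (0, (u, θ)) fun i => (b i, 0)) 0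
      (0, (ContinuousLinearMap.inl ℝ F (FormModel B F 2 m)).comp κ
        (Matrix.vecCons ((0 : B), (u, θ)) (fun i => (b i, 0)) 0).1)) = 0 :=
    (canonicalModel B F 2 m).map_coord_zero 0 (by simp)
  rw [h0, zero_add]
  refine Finset.sum_congr rfl fun j _ => ?_
  rw [canonicalModel_apply, Fin.sum_univ_succ, Finset.sum_eq_zero]
  · simp only [Fin.val_zero, pow_zero, one_mul, add_zero]
    rw [Function.update_of_ne (Fin.succ_ne_zero j).symm]
    congr 2
    funext i
    by_cases hij : i = j
    · subst hij; simp
    · simp [hij]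
  · intro i _
    by_cases hij : i = j
    · subst hij; simp
    · simp [hij]

/-- The jet `b⁰ ⊗ θ'` is nonzero only on `b 0`, so it acts in slot `1` alone and puts `θ'` there.
The two minus signs, from `-dΘ` and from the slot, cancel. These jets detect `u`. -/
lemma verticalEval_flatLin_inr [FiniteDimensional ℝ B] [NeZero m] (b : Module.Basis (Fin m) ℝ B)
    (θ' : FormModel B F 2 m) (u : F) (θ : FormModel B F 2 m) :
    verticalEval b (flatLin B F m ((ContinuousLinearMap.inr ℝ F _).comp
      ((LinearMap.toContinuousLinearMap (b.coord 0)).smulRight θ'))) (u, θ) =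
      θ'.toForm (Function.update (fun i => (b i, 0)) 0 (0, u)) := by
  obtain _ | k := m
  · exact absurd rfl (NeZero.ne 0)
  rw [verticalEval_apply, flatLin_apply, Finset.sum_eq_single (Fin.succ 0)]
  · rw [canonicalModel_apply, Finset.sum_eq_single (Fin.succ 0)]
    · simp only [Function.update_self, Fin.val_succ, Fin.val_zero, zero_add, pow_one]
      have h1 : (fun j : Fin (k + 1) => ((Function.update
          (Matrix.vecCons ((0 : B), (u, θ)) fun i => (b i, 0)) (Fin.succ 0)
          (0, ((ContinuousLinearMap.inr ℝ F _).comp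
            ((LinearMap.toContinuousLinearMap (b.coord 0)).smulRight θ'))
            (Matrix.vecCons ((0 : B), (u, θ)) (fun i => (b i, 0)) (Fin.succ 0)).1)
          ((Fin.succ 0).succAbove j)).1, (Function.update
          (Matrix.vecCons ((0 : B), (u, θ)) fun i => (b i, 0)) (Fin.succ 0)
          (0, ((ContinuousLinearMap.inr ℝ F _).comp
            ((LinearMap.toContinuousLinearMap (b.coord 0)).smulRight θ'))
            (Matrix.vecCons ((0 : B), (u, θ)) (fun i => (b i, 0)) (Fin.succ 0)).1)
          ((Fin.succ 0).succAbove j)).2.1)) =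
          Function.update (fun i => (b i, 0)) 0 (0, u) := by
        funext j
        rw [Function.update_of_ne (Fin.succAbove_ne _ _)]
        refine Fin.cases ?_ (fun i => ?_) j
        · simp
        · simp
      rw [h1]
      simp
    · intro i _ hi
      rw [Function.update_of_ne hi]
      refine Fin.cases ?_ (fun j => ?_) i
      -- When `θ` is evaluated, one of its arguments is the vector inserted in slot `1`, which has
      -- only a form component and hence projects to `0` in `B × F`.
      · have h2 : (θ.toForm fun j : Fin (k + 1) => ((Function.update
          (Matrix.vecCons ((0 : B), (u, θ)) fun i => (b i, 0)) (Fin.succ 0)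
          (0, ((ContinuousLinearMap.inr ℝ F _).comp
            ((LinearMap.toContinuousLinearMap (b.coord 0)).smulRight θ'))
            (Matrix.vecCons ((0 : B), (u, θ)) (fun i => (b i, 0)) (Fin.succ 0)).1)
          ((0 : Fin (k + 2)).succAbove j)).1, (Function.update
          (Matrix.vecCons ((0 : B), (u, θ)) fun i => (b i, 0)) (Fin.succ 0)
          (0, ((ContinuousLinearMap.inr ℝ F _).comp
            ((LinearMap.toContinuousLinearMap (b.coord 0)).smulRight θ'))
            (Matrix.vecCons ((0 : B), (u, θ)) (fun i => (b i, 0)) (Fin.succ 0)).1)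
          ((0 : Fin (k + 2)).succAbove j)).2.1)) = 0 := by
          refine θ.toForm.map_coord_zero 0 ?_
          simp
        simpa using h2
      · simp
    · simp
  · intro i _ hi
    refine (canonicalModel B F 2 (k + 1)).map_coord_zero i ?_
    rw [Function.update_self]
    refine Fin.cases ?_ (fun j hi => ?_) i hi
    · simp
    · have hj : j ≠ 0 := fun h => hi (by rw [h])
      simp [Finsupp.single_eq_of_ne, hj.symm]
  · simp

/-- The constant is forced by the value on the horizontal basis. The pulled-back volume form sees
only base components, so subtracting it does not disturb the sums with one vertical argument. -/
lemma eq_smul_volumeModel (b : Module.Basis (Fin m) ℝ B) [FiniteDimensional ℝ B]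
    (vol : B [⋀^Fin m]→L[ℝ] ℝ)
    (hvol : vol b ≠ 0) (θ : FormModel B F 2 m)
    (h : ∀ κ : B →L[ℝ] F,
      ∑ j, θ.toForm (Function.update (fun i => (b i, 0)) j (0, κ (b j))) = 0) :
    ∃ c : ℝ, θ = c • volumeModel vol := by
  refine ⟨θ.toForm (fun i => (b i, 0)) / vol b, ?_⟩
  rw [← sub_eq_zero]
  apply FormModel.toForm_injective
  rw [map_zero]
  refine eq_zero_of_forall_sum_update b (FormModel.toForm_mem _) ?_ fun κ => ?_
  · simp [volumeModel_toForm_apply, hvol]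
  · simp only [map_sub, map_smul, ContinuousAlternatingMap.sub_apply,
      ContinuousAlternatingMap.smul_apply, Finset.sum_sub_distrib, h κ, zero_sub,
      ← Finset.smul_sum, volumeModel_toForm_apply]
    rw [Finset.sum_eq_zero, smul_zero, neg_zero]
    intro j _
    exact vol.map_coord_zero j (by simp)

lemma exists_formModel_apply_ne_zero [NeZero m]
    (b : Module.Basis (Fin m) ℝ B) (vol : B [⋀^Fin m]→L[ℝ] ℝ) (hvol : vol b ≠ 0) {u : F}
    (hu : u ≠ 0) :
    ∃ θ : FormModel B F 2 m,
      θ.toForm (Function.update (fun i => (b i, 0)) 0 (0, u)) ≠ 0 := by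
  classical
  -- The witness is the pulled-back volume form contracted with `(x, u') ↦ (f u' • b 0, 0)`; its
  -- value at the given arguments is `f u * vol b`.
  obtain ⟨f, hf⟩ := SeparatingDual.exists_ne_zero (R := ℝ) hu
  set h : B × F →L[ℝ] B × F := (ContinuousLinearMap.inl ℝ B F).comp
    ((f.comp (ContinuousLinearMap.snd ℝ B F)).smulRight (b 0)) with hh
  have hmem : contractEnd h (volumeModel vol : FormModel B F 2 m).toForm ∈
      horizontalForms (ContinuousLinearMap.fst ℝ B F) 2 m := by
    intro v s hs hv
    rw [contractEnd_apply]
    refine Finset.sum_eq_zero fun i _ => ?_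
    -- Contraction changes one argument only, so of two vertical ones at least one survives and
    -- kills the volume form.
    obtain ⟨j, hj, hji⟩ := Finset.exists_mem_ne (by omega : 1 < s.card) i
    rw [volumeModel_toForm_apply]
    refine vol.map_coord_zero j ?_
    rw [Function.update_of_ne hji]
    exact hv j hj
  refine ⟨FormModel.mk _ hmem, ?_⟩
  · rw [FormModel.toForm_mk, contractEnd_apply, Finset.sum_eq_single 0]
    · rw [volumeModel_toForm_apply]
      have h1 : (fun i => (Function.update (Function.update (fun i => (b i, (0 : F))) 0 (0, u)) 0
          (h (Function.update (fun i => (b i, (0 : F))) 0 (0, u) 0)) i).1) =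
          Function.update b 0 (f u • b 0) := by
        funext i
        by_cases hi : i = 0
        · subst hi; simp [hh]
        · simp [hi]
      rw [h1, vol.map_update_smul, Function.update_eq_self]
      exact mul_ne_zero hf hvol
    · intro i _ hi
      refine (volumeModel vol : FormModel B F 2 m).toForm.map_coord_zero i ?_
      simp [hi, hh]
    · simp

variable [FiniteDimensional ℝ B] [FiniteDimensional ℝ F]

/-- The range of the linear part of `♭_Ω`: the `2`-horizontal forms which vanish on the generator
of the translations along the volume form. -/
lemma mem_range_flatLin (hm : 1 ≤ m) (b : Module.Basis (Fin m) ℝ B)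
    (vol : B [⋀^Fin m]→L[ℝ] ℝ) (hvol : vol b ≠ 0)
    {Φ : (B × (F × FormModel B F 2 m)) [⋀^Fin (m + 1)]→L[ℝ] ℝ}
    (hΦ : Φ ∈ horizontalForms (ContinuousLinearMap.fst ℝ B _) 2 (m + 1))
    (h : Φ (Matrix.vecCons (0, (0, volumeModel vol)) fun i => (b i, 0)) = 0) :
    Φ ∈ LinearMap.range (flatLin B F m) := by
  have : NeZero m := ⟨by omega⟩
  -- `verticalEval b` is injective on 2-horizontal forms, so it suffices to hit the functional
  -- `verticalEval b Φ`. In finite dimension a subspace of the dual is the annihilator of its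
  -- coannihilator; thus only the vectors killed by the whole range need testing.
  have h1 : verticalEval b Φ ∈ LinearMap.range ((verticalEval b).comp (flatLin B F m)) := by
    rw [← Subspace.dualCoannihilator_dualAnnihilator_eq
      (W := LinearMap.range ((verticalEval b).comp (flatLin B F m))),
      Submodule.mem_dualAnnihilator]
    rintro ⟨u, θ⟩ hy
    rw [Submodule.mem_dualCoannihilator] at hy
    have hy' : ∀ l, verticalEval b (flatLin B F m l) (u, θ) = 0 := fun l => hy _ ⟨l, rfl⟩
    -- The jets `(κ, 0)` force `θ` to be a multiple of the volume form, and the jets `(0, b⁰ ⊗ θ')`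
    -- force `u = 0`. What remains lies on the line of `V_μ`, where `Φ` vanishes by hypothesis.
    obtain ⟨c, rfl⟩ := eq_smul_volumeModel b vol hvol θ fun κ => by
      have := hy' ((ContinuousLinearMap.inl ℝ F _).comp κ)
      rw [verticalEval_flatLin_inl] at this
      exact neg_eq_zero.1 this
    have hu : u = 0 := by
      by_contra hu
      obtain ⟨θ', hθ'⟩ := exists_formModel_apply_ne_zero b vol hvol hu
      exact hθ' (by rw [← verticalEval_flatLin_inr]; exact hy' _)
    subst hu
    have h2 := (verticalEval b Φ).map_smul c (0, volumeModel vol)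
    rw [verticalEval_apply b Φ (0, volumeModel vol), h, smul_zero] at h2
    simpa using h2
  obtain ⟨l, hl⟩ := h1
  refine ⟨l, ?_⟩
  rw [← sub_eq_zero]
  refine eq_zero_of_forall_vecCons b (Submodule.sub_mem _ (flatLin_mem hm l) hΦ) fun y => ?_
  have h3 := DFunLike.congr_fun hl y
  exact sub_eq_zero.2 h3

end Range

/-! ### Induced charts on total spaces. -/

section Coordinates

variable {B F V M E : Type*}
  [NormedAddCommGroup B] [NormedSpace ℝ B] [NormedAddCommGroup F] [NormedSpace ℝ F]
  [NormedAddCommGroup V] [NormedSpace ℝ V]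
  [TopologicalSpace M] [ChartedSpace B M]
  [TopologicalSpace E] [ChartedSpace V E]
  {π : Fibration B F V M E} {Z : E → Type*} {L : Type*}
  [NormedAddCommGroup L] [NormedSpace ℝ L]

namespace FiberCoords

variable (c : FiberCoords π Z L) (a : AdaptedChart π)

lemma homeo_apply (p : Tot c) :
    c.homeo a p = ((a.total p.pt).1, (a.total p.pt).2, c.coord a p.pt p.val) := rfl

lemma homeo_mem_maximalAtlas :
    c.homeo a ∈ IsManifold.maximalAtlas 𝓘(ℝ, B × (F × L)) ∞ (Tot c) :=
  IsManifold.subset_maximalAtlas (c.homeo_mem_atlas a)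

/-- The adapted chart of the total space of a bundle over `E`, as a fibration over `M`, induced by
an adapted chart of `E`. -/
def liftChart : AdaptedChart c.fibration where
  base := a.base
  total := c.homeo a
  base_mem := a.base_mem
  smooth_total := contMDiffOn_of_mem_maximalAtlas (c.homeo_mem_maximalAtlas a)
  smooth_symm := contMDiffOn_symm_of_mem_maximalAtlas (c.homeo_mem_maximalAtlas a)
  mapsTo q hq := a.mapsTo q.pt hq
  fst_total q hq := a.fst_total q.pt hq

variable {a} in
-- In the induced charts the bundle projection is the linear map that forgets the fibre coordinate.
lemma tangentEquiv_mfderiv_pt {p : Tot c} (hp : p.pt ∈ a.total.source)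
    (v : TangentSpace 𝓘(ℝ, B × (F × L)) p) :
    a.tangentEquiv hp (mfderiv 𝓘(ℝ, B × (F × L)) 𝓘(ℝ, V) (Tot.pt : Tot c → E) p v) =
      ((mfderiv 𝓘(ℝ, B × (F × L)) 𝓘(ℝ, B × (F × L)) (c.homeo a) p v).1,
        (mfderiv 𝓘(ℝ, B × (F × L)) 𝓘(ℝ, B × (F × L)) (c.homeo a) p v).2.1) := by
  have h1 : HasMFDerivAt 𝓘(ℝ, B × (F × L)) 𝓘(ℝ, B × F) (a.total ∘ (Tot.pt : Tot c → E)) p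
      ((mfderiv 𝓘(ℝ, V) 𝓘(ℝ, B × F) a.total p.pt).comp
        (mfderiv 𝓘(ℝ, B × (F × L)) 𝓘(ℝ, V) (Tot.pt : Tot c → E) p)) :=
    (a.mdifferentiable.mdifferentiableAt hp).hasMFDerivAt.comp p
      (Tot.mdifferentiableAt_pt c p).hasMFDerivAt
  have h2 : HasMFDerivAt 𝓘(ℝ, B × (F × L)) 𝓘(ℝ, B × (F × L)) (c.homeo a) p
      (mfderiv 𝓘(ℝ, B × (F × L)) 𝓘(ℝ, B × (F × L)) (c.homeo a) p) :=
    ((mdifferentiable_of_mem_maximalAtlas (c.homeo_mem_maximalAtlas a)).mdifferentiableAt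
      hp).hasMFDerivAt
  have h3 : HasMFDerivAt 𝓘(ℝ, B × (F × L)) 𝓘(ℝ, B × F)
      (fun q : B × (F × L) => (q.1, q.2.1)) (c.homeo a p)
      ((ContinuousLinearMap.fst ℝ B (F × L)).prod
        ((ContinuousLinearMap.fst ℝ F L).comp (ContinuousLinearMap.snd ℝ B (F × L)))) :=
    (ContinuousLinearMap.hasFDerivAt ((ContinuousLinearMap.fst ℝ B (F × L)).prod
        ((ContinuousLinearMap.fst ℝ F L).comp
          (ContinuousLinearMap.snd ℝ B (F × L))))).hasMFDerivAt
  exact DFunLike.congr_fun (hasMFDerivAt_unique h1 (h3.comp p h2)) v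

end FiberCoords

end Coordinates

/-! ### Liouville and canonical forms in adapted charts. -/

section CanonicalForm

variable {B F V M E : Type*}
  [NormedAddCommGroup B] [NormedSpace ℝ B] [FiniteDimensional ℝ B]
  [NormedAddCommGroup F] [NormedSpace ℝ F] [FiniteDimensional ℝ F]
  [NormedAddCommGroup V] [NormedSpace ℝ V]
  [TopologicalSpace M] [ChartedSpace B M]
  [TopologicalSpace E] [ChartedSpace V E]
  {π : Fibration B F V M E}

lemma formCoords_coord_toForm {r k : ℕ} {a : AdaptedChart π} {u : E} (hu : u ∈ a.total.source)
    (z : FormFiber π r k u) :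
    ((formCoords π r k).coord a u z).toForm =
      (z : TangentSpace 𝓘(ℝ, V) u [⋀^Fin k]→L[ℝ] ℝ).compContinuousLinearMap
        ((a.tangentEquiv hu).symm : B × F →L[ℝ] TangentSpace 𝓘(ℝ, V) u) := by
  simp only [formCoords, hu, dif_pos]
  rfl

lemma formCoords_coord_toForm_apply {r k : ℕ} {a : AdaptedChart π} {u : E}
    (hu : u ∈ a.total.source) (z : FormFiber π r k u) (v : Fin k → TangentSpace 𝓘(ℝ, V) u) :
    ((formCoords π r k).coord a u z).toForm (fun i => a.tangentEquiv hu (v i)) =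
      (z : TangentSpace 𝓘(ℝ, V) u [⋀^Fin k]→L[ℝ] ℝ) v := by
  rw [formCoords_coord_toForm hu]
  simp [Function.comp_def]

lemma liouville_eq {r k : ℕ} {a : AdaptedChart π} {w : FormBundle π r k}
    (hw : w.pt ∈ a.total.source) :
    liouville π r k w =
      (liouvilleModel B F r k ((formCoords π r k).homeo a w).2.2).compContinuousLinearMap
        (mfderiv 𝓘(ℝ, B × (F × FormModel B F r k)) 𝓘(ℝ, B × (F × FormModel B F r k))
          ((formCoords π r k).homeo a) w) := by
  ext v
  refine (formCoords_coord_toForm_apply hw w.val (fun i => mfderiv _ _ _ w (v i))).symm.trans ?_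
  change _ = FormModel.toForm _ _
  congr 1
  funext i
  exact (formCoords π r k).tangentEquiv_mfderiv_pt hw (v i)

/-- Adapted charts are Darboux charts: near `w` the Liouville form is the linear model, so its
exterior derivative is the constant one. -/
lemma canonicalForm_eq {r k : ℕ} {a : AdaptedChart π} {w : FormBundle π r k}
    (hw : w.pt ∈ a.total.source) :
    canonicalForm π r k w = (canonicalModel B F r k).compContinuousLinearMap
        (mfderiv 𝓘(ℝ, B × (F × FormModel B F r k)) 𝓘(ℝ, B × (F × FormModel B F r k))
          ((formCoords π r k).homeo a) w) := by
  set φ := (formCoords π r k).homeo a with hφ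
  have hmem : φ ∈ IsManifold.maximalAtlas _ ∞ _ := (formCoords π r k).homeo_mem_maximalAtlas a
  have h1 : formInChart φ (liouville π r k) =ᶠ[𝓝 (φ w)]
      fun q => liouvilleModel B F r k q.2.2 := by
    filter_upwards [φ.open_target.mem_nhds (φ.map_source hw)] with q hq
    have h2 := formInChart_eq_iff hmem _ (φ.map_target hq) _ (liouville_eq (φ.map_target hq))
    rwa [← hφ, φ.right_inv hq] at h2
  have hd : DifferentiableAt ℝ
      (fun q : B × (F × FormModel B F r k) => liouvilleModel B F r k q.2.2) (φ w) := by
    fun_prop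
  have h3 := extD_eq_of_chart hmem (liouville π r k) hw (hd.congr_of_eventuallyEq h1)
  rw [h1.extDeriv_eq, extDeriv_liouvilleModel] at h3
  rw [canonicalForm, h3]
  ext v
  exact neg_neg _

end CanonicalForm

/-! ### `♭_Ω` and `Ω̃` in adapted charts. -/

section Flat

/-- The model of `J¹(π ∘ ν)`. -/
abbrev JetModel (B F : Type*) [NormedAddCommGroup B] [NormedSpace ℝ B]
    [NormedAddCommGroup F] [NormedSpace ℝ F] (m : ℕ) : Type _ :=
  B × ((F × FormModel B F 2 m) × (B →L[ℝ] F × FormModel B F 2 m))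

/-- The model of `Λ^{m+1}_2 ℳπ`. -/
abbrev CodomainModel (B F : Type*) [NormedAddCommGroup B] [NormedSpace ℝ B]
    [NormedAddCommGroup F] [NormedSpace ℝ F] (m : ℕ) : Type _ :=
  B × ((F × FormModel B F 2 m) × FormModel B (F × FormModel B F 2 m) 2 (m + 1))

lemma contractEnd_compContinuousLinearMap {T T' : Type*} [AddCommGroup T] [Module ℝ T]
    [TopologicalSpace T] [AddCommGroup T'] [Module ℝ T'] [TopologicalSpace T'] {k : ℕ}
    (h : T →L[ℝ] T) (h' : T' →L[ℝ] T') (D : T →L[ℝ] T') (hD : ∀ v, D (h v) = h' (D v))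
    (Ω : T' [⋀^Fin k]→L[ℝ] ℝ) :
    contractEnd h (Ω.compContinuousLinearMap D) =
      (contractEnd h' Ω).compContinuousLinearMap D := by
  classical
  ext v
  rw [ContinuousAlternatingMap.compContinuousLinearMap_apply, contractEnd_apply,
    contractEnd_apply]
  refine Finset.sum_congr rfl fun i _ => ?_
  change Ω _ = Ω _
  congr 1
  funext j
  by_cases hj : j = i
  · subst hj; simp [hD]
  · simp [hj]

variable {B F V M E : Type*}
  [NormedAddCommGroup B] [NormedSpace ℝ B]
  [NormedAddCommGroup F] [NormedSpace ℝ F]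
  [NormedAddCommGroup V] [NormedSpace ℝ V]
  [TopologicalSpace M] [ChartedSpace B M]
  [TopologicalSpace E] [ChartedSpace V E]
  {π : Fibration B F V M E}

/-- The base component is preserved because a jet is a section of the tangent map; the fibre
component is the definition of the jet coordinate. -/
lemma tangentEquiv_horizontalProjector {a : AdaptedChart π} {z : Jet π}
    (hz : z.pt ∈ a.total.source) (v : TangentSpace 𝓘(ℝ, V) z.pt) :
    a.tangentEquiv hz (horizontalProjector z v) =
      projectorModel B ((jetCoords π).homeo a z).2.2 (a.tangentEquiv hz v) := by
  have h1 := a.fst_tangentEquiv hz (horizontalProjector z v)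
  have h2 := a.fst_tangentEquiv hz v
  have h3 : π.tangent z.pt (horizontalProjector z v) = π.tangent z.pt v :=
    DFunLike.congr_fun z.val.2 _
  refine Prod.ext (h1.trans ?_) ?_
  · rw [h3, ← h2]; rfl
  · have h4 : ((jetCoords π).homeo a z).2.2 = (jetCoords π).coord a z.pt z.val := rfl
    change _ = ((jetCoords π).homeo a z).2.2 (a.tangentEquiv hz v).1
    rw [h4, h2]
    simp only [jetCoords, hz, dif_pos]
    simp [horizontalProjector]

variable [FiniteDimensional ℝ B] [FiniteDimensional ℝ F] {m : ℕ}

variable (B F) in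
/-- `flatLin` with values in the model of the fibres of `Λ^{m+1}_2 ℳπ`. -/
def flatLinModel (hm : 1 ≤ m) :
    (B →L[ℝ] F × FormModel B F 2 m) →L[ℝ] FormModel B (F × FormModel B F 2 m) 2 (m + 1) :=
  LinearMap.toContinuousLinearMap
    { toFun := fun l => FormModel.mk (flatLin B F m l) (flatLin_mem hm l)
      map_add' := fun l l' => FormModel.toForm_injective ((flatLin B F m).map_add l l')
      map_smul' := fun c l => FormModel.toForm_injective ((flatLin B F m).map_smul c l) }

variable (B F) in
/-- The differential of `♭_Ω` in coordinates. -/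
def flatDeriv (hm : 1 ≤ m) :
    JetModel B F m →L[ℝ]
      CodomainModel B F m :=
  (ContinuousLinearMap.id ℝ B).prodMap
    ((ContinuousLinearMap.id ℝ (F × FormModel B F 2 m)).prodMap (flatLinModel B F hm))

/-- Both ingredients, `Ω` and `h_z`, have known coordinate expressions, with the first constant and
the second affine in `l`. So `♭_Ω` is globally affine in the chart, which makes its differential the
fixed map `flatDeriv`. -/
lemma homeo_flatOmega (hm : 1 ≤ m) {a : AdaptedChart π} {z : Jet (momentumFibration π m)}
    (hz : z.pt.pt ∈ a.total.source) :
    (formCoords (momentumFibration π m) 2 (m + 1)).homeo ((formCoords π 2 m).liftChart a)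
        (flatOmega π m z) =
      (0, (0, FormModel.mk (flatModel B F m 0) (flatModel_mem hm 0))) + flatDeriv B F hm
        ((jetCoords (momentumFibration π m)).homeo ((formCoords π 2 m).liftChart a) z) := by
  set A := (formCoords π 2 m).liftChart a with hA
  have hzA : z.pt ∈ A.total.source := hz
  let ζ : FormFiber (momentumFibration π m) 2 (m + 1) z.pt := (flatOmega π m z).val
  have h1 : ((formCoords (momentumFibration π m) 2 (m + 1)).coord A z.pt ζ).toForm =
      flatModel B F m ((jetCoords (momentumFibration π m)).homeo A z).2.2 := by
    have h2 : canonicalForm π 2 m z.pt = (canonicalModel B F 2 m).compContinuousLinearMap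
      (A.tangentEquiv hzA : TangentSpace 𝓘(ℝ, B × (F × FormModel B F 2 m)) z.pt →L[ℝ]
        B × (F × FormModel B F 2 m)) := canonicalForm_eq hz
    have h3 : (ζ : TangentSpace 𝓘(ℝ, B × (F × FormModel B F 2 m)) z.pt
        [⋀^Fin (m + 1)]→L[ℝ] ℝ) = (flatModel B F m
          ((jetCoords (momentumFibration π m)).homeo A z).2.2).compContinuousLinearMap
      (A.tangentEquiv hzA : TangentSpace 𝓘(ℝ, B × (F × FormModel B F 2 m)) z.pt →L[ℝ]
        B × (F × FormModel B F 2 m)) := by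
      change contractEnd (horizontalProjector z) (canonicalForm π 2 m z.pt) -
        ((m : ℝ) - 1) • canonicalForm π 2 m z.pt = _
      rw [h2, contractEnd_compContinuousLinearMap (horizontalProjector z) (projectorModel B
        ((jetCoords (momentumFibration π m)).homeo A z).2.2)
        (A.tangentEquiv hzA : TangentSpace 𝓘(ℝ, B × (F × FormModel B F 2 m)) z.pt →L[ℝ]
          B × (F × FormModel B F 2 m)) (tangentEquiv_horizontalProjector hzA)]
      rfl
    rw [formCoords_coord_toForm hzA, h3]
    ext v
    simp [Function.comp_def]
  refine Prod.ext ?_ (Prod.ext ?_ ?_)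
  · exact (zero_add _).symm
  · exact (zero_add _).symm
  · apply FormModel.toForm_injective
    refine h1.trans ((flatModel_eq _).trans ?_)
    rfl

variable (B F) in
/-- The form `Ω̃` in coordinates, which is constant. -/
def tildeModel (hm : 1 ≤ m) :
    JetModel B F m
      [⋀^Fin (m + 1 + 1)]→L[ℝ] ℝ :=
  (canonicalModel B (F × FormModel B F 2 m) 2 (m + 1)).compContinuousLinearMap (flatDeriv B F hm)

lemma tildeModel_apply (hm : 1 ≤ m)
    (X : Fin (m + 1 + 1) → JetModel B F m) :
    tildeModel B F hm X = -∑ i : Fin (m + 1 + 1), (-1 : ℝ) ^ (i : ℕ) *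
      flatLin B F m (X i).2.2 fun j => ((X (i.succAbove j)).1, (X (i.succAbove j)).2.1) :=
  canonicalModel_apply _

lemma tildeOmega_eq (hm : 1 ≤ m) {a : AdaptedChart π} {z : Jet (momentumFibration π m)}
    (hz : z.pt.pt ∈ a.total.source) :
    tildeOmega π m z = (tildeModel B F hm).compContinuousLinearMap
      (mfderiv 𝓘(ℝ, JetModel B F m)
        𝓘(ℝ, JetModel B F m)
        ((jetCoords (momentumFibration π m)).homeo ((formCoords π 2 m).liftChart a)) z) := by
  set A := (formCoords π 2 m).liftChart a with hA
  set φ := (jetCoords (momentumFibration π m)).homeo A with hφ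
  set ψ := (formCoords (momentumFibration π m) 2 (m + 1)).homeo A with hψ
  have hφm : φ ∈ IsManifold.maximalAtlas 𝓘(ℝ, JetModel B F m) ∞ _ :=
    (jetCoords (momentumFibration π m)).homeo_mem_maximalAtlas A
  have hψm : ψ ∈ IsManifold.maximalAtlas 𝓘(ℝ, CodomainModel B F m) ∞ _ :=
    (formCoords (momentumFibration π m) 2 (m + 1)).homeo_mem_maximalAtlas A
  have hzφ : z ∈ φ.source := hz
  have hzψ : flatOmega π m z ∈ ψ.source := hz
  set G : JetModel B F m →
      CodomainModel B F m :=
    fun q => (0, (0, FormModel.mk (flatModel B F m 0) (flatModel_mem hm 0))) +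
      flatDeriv B F hm q with hG
  have h1 : HasMFDerivAt 𝓘(ℝ, JetModel B F m) 𝓘(ℝ, CodomainModel B F m) G (φ z) (flatDeriv B F hm) :=
    ((flatDeriv B F hm).hasFDerivAt.const_add _).hasMFDerivAt
  have h2 := h1.comp z
    ((mdifferentiable_of_mem_maximalAtlas hφm).mdifferentiableAt hzφ).hasMFDerivAt
  have h3 : ψ ∘ flatOmega π m =ᶠ[𝓝 z] G ∘ φ := by
    filter_upwards [φ.open_source.mem_nhds hzφ] with y hy using homeo_flatOmega hm hy
  have h4 := h2.congr_of_eventuallyEq h3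
  -- Differentiability of `♭_Ω` itself is needed, since `mfderiv` in the pullback would otherwise
  -- take its default value `0`.
  have h5 : MDifferentiableAt 𝓘(ℝ, JetModel B F m) 𝓘(ℝ, CodomainModel B F m) (flatOmega π m) z := by
    have h6 : MDifferentiableAt 𝓘(ℝ, CodomainModel B F m) 𝓘(ℝ, CodomainModel B F m) ψ.symm
        ((ψ ∘ flatOmega π m) z) :=
      (mdifferentiable_of_mem_maximalAtlas hψm).mdifferentiableAt_symm (ψ.map_source hzψ)
    refine (h6.comp z h4.mdifferentiableAt).congr_of_eventuallyEq ?_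
    filter_upwards [φ.open_source.mem_nhds hzφ] with y hy
    have hy' : flatOmega π m y ∈ ψ.source := hy
    exact (ψ.left_inv hy').symm
  have h7 := ((mdifferentiable_of_mem_maximalAtlas hψm).mdifferentiableAt
    hzψ).hasMFDerivAt.comp z h5.hasMFDerivAt
  have h8 := hasMFDerivAt_unique h7 h4
  rw [tildeOmega, pullback, canonicalForm_eq (a := A) (w := flatOmega π m z) hz]
  ext v
  change canonicalModel B _ 2 (m + 1) _ = canonicalModel B _ 2 (m + 1) _
  congr 1
  funext i
  exact DFunLike.congr_fun h8 (v i)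

theorem isPremultisymplectic_tildeOmega (hm : 1 ≤ m) (π : Fibration B F V M E) :
    IsPremultisymplectic (tildeOmega π m) := by
  refine isPremultisymplectic_of_locally_const fun z => ?_
  obtain ⟨a, ha⟩ := π.exists_adaptedChart z.pt.pt
  exact ⟨_, FiberCoords.homeo_mem_maximalAtlas _ ((formCoords π 2 m).liftChart a), ha,
    tildeModel B F hm, fun y hy => tildeOmega_eq hm hy⟩

end Flat

/-! ### Hamiltonian densities and the equation of `S_ℋ`. -/

section Density

variable {B F V M E : Type*}
  [NormedAddCommGroup B] [NormedSpace ℝ B] [NormedAddCommGroup F] [NormedSpace ℝ F]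
  [NormedAddCommGroup V] [NormedSpace ℝ V]
  [TopologicalSpace M] [ChartedSpace B M]
  [TopologicalSpace E] [ChartedSpace V E]
  {π : Fibration B F V M E} {m : ℕ} {η : VolumeForm B M m}

/-- The volume form at `π u` in the coordinates of an adapted chart. -/
def VolumeForm.coord (η : VolumeForm B M m) {a : AdaptedChart π} {u : E}
    (hu : u ∈ a.total.source) : B [⋀^Fin m]→L[ℝ] ℝ :=
  (η.toForm (π u)).compContinuousLinearMap
    ((a.baseTangentEquiv (a.mapsTo u hu)).symm : B →L[ℝ] TangentSpace 𝓘(ℝ, B) (π u))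

lemma VolumeForm.coord_apply_ne_zero (η : VolumeForm B M m) {a : AdaptedChart π} {u : E}
    (hu : u ∈ a.total.source) (b : Module.Basis (Fin m) ℝ B) : η.coord hu b ≠ 0 := by
  intro h
  have h1 := alternatingMap_eq_zero_of_basis b _ h
  apply η.ne_zero (π u)
  ext v
  have h2 := DFunLike.congr_fun h1 fun i => a.baseTangentEquiv (a.mapsTo u hu) (v i)
  simpa [VolumeForm.coord, Function.comp_def] using h2

variable [FiniteDimensional ℝ B] [FiniteDimensional ℝ F]

lemma formCoords_coord_lift (η : VolumeForm B M m) {a : AdaptedChart π} {u : E}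
    (hu : u ∈ a.total.source) :
    (formCoords π 2 m).coord a u (η.lift π u) = volumeModel (η.coord hu) := by
  apply FormModel.toForm_injective
  rw [formCoords_coord_toForm hu]
  ext v
  change η.toForm (π u) _ = η.toForm (π u) _
  congr 1
  funext i
  have h := a.fst_tangentEquiv hu ((a.tangentEquiv hu).symm (v i))
  rw [ContinuousLinearEquiv.apply_symm_apply] at h
  change π.tangent u ((a.tangentEquiv hu).symm (v i)) =
    (a.baseTangentEquiv (a.mapsTo u hu)).symm (v i).1
  rw [h, ContinuousLinearEquiv.symm_apply_apply]

lemma homeo_translate (η : VolumeForm B M m) {a : AdaptedChart π} {w : Momentum π m}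
    (hw : w.pt ∈ a.total.source) (t : ℝ) :
    (formCoords π 2 m).homeo a (translate π η t w) =
      (formCoords π 2 m).homeo a w + t • (0, (0, volumeModel (η.coord hw))) := by
  refine Prod.ext ?_ (Prod.ext ?_ ?_)
  · simp [FiberCoords.homeo_apply, translate]
  · simp [FiberCoords.homeo_apply, translate]
  · rw [← formCoords_coord_lift]
    apply FormModel.toForm_injective
    change ((formCoords π 2 m).coord a w.pt (t • η.lift π w.pt + w.val)).toForm =
      ((formCoords π 2 m).coord a w.pt w.val +
        t • (formCoords π 2 m).coord a w.pt (η.lift π w.pt)).toForm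
    rw [map_add, map_smul, formCoords_coord_toForm hw, formCoords_coord_toForm hw,
      formCoords_coord_toForm hw, add_comm]
    rfl

/-- In the chart the action is translation by `t` times a vector depending only on the base point,
and that vector is the generator. -/
lemma mfderiv_homeo_generator (η : VolumeForm B M m) {a : AdaptedChart π} {w : Momentum π m}
    (hw : w.pt ∈ a.total.source) :
    mfderiv 𝓘(ℝ, B × (F × FormModel B F 2 m)) 𝓘(ℝ, B × (F × FormModel B F 2 m))
      ((formCoords π 2 m).homeo a) w (generator π η w) =
      (0, (0, volumeModel (η.coord hw))) := by
  set φ := (formCoords π 2 m).homeo a with hφ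
  have hmem : φ ∈ IsManifold.maximalAtlas 𝓘(ℝ, B × (F × FormModel B F 2 m)) ∞ _ :=
    (formCoords π 2 m).homeo_mem_maximalAtlas a
  set e : B × (F × FormModel B F 2 m) := (0, (0, volumeModel (η.coord hw))) with he
  have hsrc : ∀ t, translate π η t w ∈ φ.source := fun t => hw
  have h1 : HasMFDerivAt 𝓘(ℝ, ℝ) 𝓘(ℝ, B × (F × FormModel B F 2 m))
      (fun t : ℝ => φ w + t • e) 0 ((ContinuousLinearMap.id ℝ ℝ).smulRight e) :=
    (((hasFDerivAt_id (𝕜 := ℝ) (0 : ℝ)).smul_const e).const_add (φ w)).hasMFDerivAt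
  have h2 : (φ ∘ fun t => translate π η t w) = fun t : ℝ => φ w + t • e :=
    funext fun t => homeo_translate η hw t
  have h3 : MDifferentiableAt 𝓘(ℝ, ℝ) 𝓘(ℝ, B × (F × FormModel B F 2 m))
      (fun t => translate π η t w) 0 := by
    have h4 : MDifferentiableAt 𝓘(ℝ, B × (F × FormModel B F 2 m))
        𝓘(ℝ, B × (F × FormModel B F 2 m)) φ.symm ((φ ∘ fun t => translate π η t w) 0) :=
      (mdifferentiable_of_mem_maximalAtlas hmem).mdifferentiableAt_symm (φ.map_source (hsrc 0))
    have h5 : MDifferentiableAt 𝓘(ℝ, ℝ) 𝓘(ℝ, B × (F × FormModel B F 2 m))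
        (φ ∘ fun t => translate π η t w) 0 := by
      rw [h2]; exact h1.mdifferentiableAt
    refine (h4.comp 0 h5).congr_of_eventuallyEq (Filter.Eventually.of_forall fun t => ?_)
    exact (φ.left_inv (hsrc t)).symm
  have h6 := ((mdifferentiable_of_mem_maximalAtlas hmem).mdifferentiableAt
    (hsrc 0)).hasMFDerivAt.comp 0 h3.hasMFDerivAt
  rw [h2] at h6
  have h7 := DFunLike.congr_fun (hasMFDerivAt_unique h6 h1) (1 : ℝ)
  have h8 : mfderiv 𝓘(ℝ, B × (F × FormModel B F 2 m)) 𝓘(ℝ, B × (F × FormModel B F 2 m)) φ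
      (translate π η 0 w) (mfderiv 𝓘(ℝ, ℝ) 𝓘(ℝ, B × (F × FormModel B F 2 m))
        (fun t => translate π η t w) 0 (1 : ℝ)) = e := h7.trans (one_smul ℝ e)
  -- `generator` transports the velocity along `translate π η 0 w = w`; generalising the point
  -- removes the transport.
  have cast : ∀ (w' : Momentum π m) (h : w' = w)
      (v : TangentSpace 𝓘(ℝ, B × (F × FormModel B F 2 m)) w'),
      mfderiv 𝓘(ℝ, B × (F × FormModel B F 2 m)) 𝓘(ℝ, B × (F × FormModel B F 2 m)) φ w' v = e →
      mfderiv 𝓘(ℝ, B × (F × FormModel B F 2 m)) 𝓘(ℝ, B × (F × FormModel B F 2 m)) φ w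
        (h ▸ v) = e := by
    rintro w' rfl v hv
    exact hv
  exact cast _ _ _ h8

namespace HamiltonianDensity

variable (H : HamiltonianDensity π η) (a : AdaptedChart π)

/-- The exterior derivative of a Hamiltonian density in coordinates. -/
def derivModel (q : B × (F × FormModel B F 2 m)) :
    (B × (F × FormModel B F 2 m)) [⋀^Fin (m + 1)]→L[ℝ] ℝ :=
  extDeriv (formInChart ((formCoords π 2 m).homeo a) (pulledDensity π H.toFun)) q

lemma contDiffAt_formInChart {q : B × (F × FormModel B F 2 m)}
    (hq : (q.1, q.2.1) ∈ a.total.target) :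
    ContDiffAt ℝ ∞ (formInChart ((formCoords π 2 m).homeo a) (pulledDensity π H.toFun)) q :=
  (H.smooth.contDiffOn_formInChart ((formCoords π 2 m).homeo_mem_maximalAtlas a)).contDiffAt
    (((formCoords π 2 m).homeo a).open_target.mem_nhds hq)

lemma contDiffAt_derivModel {q : B × (F × FormModel B F 2 m)}
    (hq : (q.1, q.2.1) ∈ a.total.target) : ContDiffAt ℝ ∞ (H.derivModel a) q := by
  have h := ContDiff.comp_contDiffAt q (ContinuousLinearMap.contDiff
    (ContinuousAlternatingMap.alternatizeUncurryFinCLM ℝ (B × (F × FormModel B F 2 m)) ℝ))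
    ((H.contDiffAt_formInChart a hq).fderiv_right (m := ∞) (by simp))
  refine h.congr_of_eventuallyEq (Filter.Eventually.of_forall fun y => ?_)
  exact (ContinuousAlternatingMap.alternatizeUncurryFinCLM_apply _).symm

/-- This instance of `d ∘ d = 0` is the source of the isotropy of `S_ℋ`. -/
lemma extDeriv_derivModel {q : B × (F × FormModel B F 2 m)}
    (hq : (q.1, q.2.1) ∈ a.total.target) : extDeriv (H.derivModel a) q = 0 :=
  extDeriv_extDeriv_apply (H.contDiffAt_formInChart a hq) (by
    rw [minSmoothness_of_isRCLikeNormedField]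
    exact WithTop.coe_le_coe.2 (le_top : (2 : ℕ∞) ≤ ⊤))

variable {a}

lemma extD_eq {w : Momentum π m} (hw : w.pt ∈ a.total.source) :
    extD (pulledDensity π H.toFun) w =
      (H.derivModel a ((formCoords π 2 m).homeo a w)).compContinuousLinearMap
        (mfderiv 𝓘(ℝ, B × (F × FormModel B F 2 m)) 𝓘(ℝ, B × (F × FormModel B F 2 m))
          ((formCoords π 2 m).homeo a) w) :=
  extD_eq_of_chart ((formCoords π 2 m).homeo_mem_maximalAtlas a) _ hw
    ((H.contDiffAt_formInChart a (((formCoords π 2 m).homeo a).map_source hw)).differentiableAt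
      (by simp))

lemma coord_negD_toForm {w : Momentum π m} (hw : w.pt ∈ a.total.source) :
    ((formCoords (momentumFibration π m) 2 (m + 1)).homeo ((formCoords π 2 m).liftChart a)
      (H.negD w)).2.2.toForm = -H.derivModel a ((formCoords π 2 m).homeo a w) := by
  set A := (formCoords π 2 m).liftChart a
  have hA : w ∈ A.total.source := hw
  let ζ : FormFiber (momentumFibration π m) 2 (m + 1) w := (H.negD w).val
  change ((formCoords (momentumFibration π m) 2 (m + 1)).coord A w ζ).toForm = _
  rw [formCoords_coord_toForm hA]
  have h1 : (ζ : TangentSpace 𝓘(ℝ, B × (F × FormModel B F 2 m)) w [⋀^Fin (m + 1)]→L[ℝ] ℝ) =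
      -(H.derivModel a ((formCoords π 2 m).homeo a w)).compContinuousLinearMap
        (A.tangentEquiv hA : TangentSpace 𝓘(ℝ, B × (F × FormModel B F 2 m)) w →L[ℝ]
          B × (F × FormModel B F 2 m)) := congrArg Neg.neg (H.extD_eq hw)
  rw [h1]
  ext v
  simp [Function.comp_def]

/-- Every `q` in the target represents a point of `ℳπ`, where `-dℋ` is already known to lie in
`Λ^{m+1}_2`. -/
lemma derivModel_mem {q : B × (F × FormModel B F 2 m)} (hq : (q.1, q.2.1) ∈ a.total.target) :
    H.derivModel a q ∈ horizontalForms (ContinuousLinearMap.fst ℝ B _) 2 (m + 1) := by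
  have hq' : q ∈ ((formCoords π 2 m).homeo a).target := hq
  have h := H.coord_negD_toForm (((formCoords π 2 m).homeo a).map_target hq')
  rw [((formCoords π 2 m).homeo a).right_inv hq'] at h
  rw [← neg_mem_iff, ← h]
  exact FormModel.toForm_mem _

/-- The condition `i_{V_μ} dℋ = η` in coordinates, with horizontal vectors in the remaining slots.
-/
lemma derivModel_apply_volumeModel {w : Momentum π m} (hw : w.pt ∈ a.total.source)
    (b : Fin m → B) :
    H.derivModel a ((formCoords π 2 m).homeo a w)
      (Matrix.vecCons (0, (0, volumeModel (η.coord hw))) fun i => (b i, 0)) = η.coord hw b := by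
  set A := (formCoords π 2 m).liftChart a
  have hA : w ∈ A.total.source := hw
  have h1 := H.contract_generator w fun i => (A.tangentEquiv hA).symm (b i, 0)
  rw [H.extD_eq hw] at h1
  have h2 : ∀ i, (momentumFibration π m).tangent w ((A.tangentEquiv hA).symm (b i, 0)) =
      (a.baseTangentEquiv (a.mapsTo w.pt hw)).symm (b i) := by
    intro i
    have h := A.fst_tangentEquiv hA ((A.tangentEquiv hA).symm (b i, 0))
    rw [ContinuousLinearEquiv.apply_symm_apply] at h
    exact (a.baseTangentEquiv (a.mapsTo w.pt hw)).injective (h.symm.trans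
      ((a.baseTangentEquiv (a.mapsTo w.pt hw)).apply_symm_apply (b i)).symm)
  simp only [h2] at h1
  refine Eq.trans ?_ h1
  change H.derivModel a _ _ = H.derivModel a _ _
  congr 1
  funext i
  refine Fin.cases ?_ (fun j => ?_) i
  · exact (mfderiv_homeo_generator η hw).symm
  · exact ((A.tangentEquiv hA).apply_symm_apply (b j, 0)).symm

/-- The equation of `S_ℋ` in coordinates can be solved for the fibre coordinate of the jet. -/
lemma neg_derivModel_sub_mem_range (hm : 1 ≤ m) (b : Module.Basis (Fin m) ℝ B)
    {q : B × (F × FormModel B F 2 m)} (hq : (q.1, q.2.1) ∈ a.total.target) :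
    -H.derivModel a q - flatModel B F m 0 ∈ LinearMap.range (flatLin B F m) := by
  have hq' : q ∈ ((formCoords π 2 m).homeo a).target := hq
  have hw := ((formCoords π 2 m).homeo a).map_target hq'
  have h1 := H.derivModel_apply_volumeModel hw b
  rw [((formCoords π 2 m).homeo a).right_inv hq'] at h1
  refine mem_range_flatLin hm b _ (η.coord_apply_ne_zero hw b)
    (Submodule.sub_mem _ (Submodule.neg_mem _ (H.derivModel_mem hq)) (flatModel_mem hm 0)) ?_
  -- On `V_μ` both `-dℋ` and `flatModel 0` give `-η`, so the normalisation of `ℋ` is precisely the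
  -- solvability condition.
  rw [ContinuousAlternatingMap.sub_apply, ContinuousAlternatingMap.neg_apply, h1,
    flatModel_zero_apply, sub_self]

/-- `♭_Ω` preserves base points, so the only candidate in `ℳπ` is `z.pt`. Membership is then
equality of fibre coordinates, which is affine in the jet coordinate. -/
lemma mem_lagrangianSet_iff (hm : 1 ≤ m) {z : Jet (momentumFibration π m)}
    (hz : z.pt.pt ∈ a.total.source) :
    z ∈ H.lagrangianSet ↔
      flatLin B F m ((jetCoords (momentumFibration π m)).homeo
        ((formCoords π 2 m).liftChart a) z).2.2 =
      -H.derivModel a ((formCoords π 2 m).homeo a z.pt) - flatModel B F m 0 := by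
  set A := (formCoords π 2 m).liftChart a with hA
  set ψ := (formCoords (momentumFibration π m) 2 (m + 1)).homeo A with hψ
  have h1 := H.coord_negD_toForm hz
  have h2 : z ∈ H.lagrangianSet ↔ flatOmega π m z = H.negD z.pt := by
    constructor
    · rintro ⟨w, hw⟩
      have hwz : w = z.pt := congrArg Tot.pt hw
      rw [← hw, ← hwz]
    · intro h
      exact ⟨z.pt, h.symm⟩
  have hzψ : flatOmega π m z ∈ ψ.source := hz
  have hHψ : H.negD z.pt ∈ ψ.source := hz
  have h3 := homeo_flatOmega hm hz
  have h4 : (ψ (flatOmega π m z)).2.2.toForm = flatModel B F m 0 +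
      flatLin B F m ((jetCoords (momentumFibration π m)).homeo A z).2.2 := by
    rw [hψ, h3]; rfl
  rw [h2, ← ψ.injOn.eq_iff hzψ hHψ, eq_sub_iff_add_eq', ← h4, ← h1]
  constructor
  · intro h
    rw [h]
  · intro h
    exact Prod.ext rfl (Prod.ext rfl (FormModel.toForm_injective h))

end HamiltonianDensity

end Density

/-! ### Tangent spaces of linear slices. -/

section Slices

variable {V : Type*} [NormedAddCommGroup V] [NormedSpace ℝ V] [FiniteDimensional ℝ V]
  {N : Type*} [TopologicalSpace N] [ChartedSpace V N]

/-- The tangent space of a set which is a linear slice in some chart. -/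
lemma mem_tangentSubmodule_iff_of_slice {χ : OpenPartialHomeomorph N V}
    (hχ : χ ∈ IsManifold.maximalAtlas 𝓘(ℝ, V) ∞ N) {S : Set N} {L : Submodule ℝ V}
    (hS : ∀ y ∈ χ.source, y ∈ S ↔ χ y ∈ L) {x : N} (hx : x ∈ χ.source) (hxS : x ∈ S)
    (v : TangentSpace 𝓘(ℝ, V) x) :
    v ∈ tangentSubmodule V S x ↔ mfderiv 𝓘(ℝ, V) 𝓘(ℝ, V) χ x v ∈ L := by
  have hχd := mdifferentiable_of_mem_maximalAtlas hχ
  constructor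
  · intro hv
    let T : Submodule ℝ (TangentSpace 𝓘(ℝ, V) x) :=
      L.comap (mfderiv 𝓘(ℝ, V) 𝓘(ℝ, V) χ x).toLinearMap
    suffices h : tangentSubmodule V S x ≤ T from h hv
    refine Submodule.span_le.2 ?_
    rintro _ ⟨γ, rfl, hγ, hγS, rfl⟩
    change mfderiv 𝓘(ℝ, V) 𝓘(ℝ, V) χ (γ 0) (mfderiv 𝓘(ℝ, ℝ) 𝓘(ℝ, V) γ 0 (1 : ℝ)) ∈ L
    have h1 : HasMFDerivAt 𝓘(ℝ, ℝ) 𝓘(ℝ, V) (χ ∘ γ) 0 _ :=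
      (hχd.mdifferentiableAt hx).hasMFDerivAt.comp 0
        (hγ.mdifferentiableAt (by simp)).hasMFDerivAt
    have h2 := h1.hasFDerivAt
    -- `L` is the common kernel of the functionals that vanish on it; each of these is zero along
    -- the curve near `0`, hence so is its derivative.
    refine (Subspace.forall_mem_dualAnnihilator_apply_eq_zero_iff L _).1 fun f hf => ?_
    have h3 := (LinearMap.toContinuousLinearMap f).hasFDerivAt.comp (0 : ℝ) h2
    have h4 : (LinearMap.toContinuousLinearMap f ∘ (χ ∘ γ)) =ᶠ[𝓝 (0 : ℝ)] fun _ => 0 := by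
      filter_upwards [hγS, hγ.continuousAt.preimage_mem_nhds (χ.open_source.mem_nhds hx)]
        with t ht1 ht2
      exact (Submodule.mem_dualAnnihilator f).1 hf _ ((hS _ ht2).1 ht1)
    have h5 := h3.unique ((hasFDerivAt_const (0 : ℝ) (0 : ℝ)).congr_of_eventuallyEq h4)
    exact DFunLike.congr_fun h5 (1 : ℝ)
  · intro hv
    set w : V := mfderiv 𝓘(ℝ, V) 𝓘(ℝ, V) χ x v with hw
    -- A straight line in the slice with the prescribed velocity, to be carried back by the chart.
    let c : ℝ → V := fun t => χ x + t • w
    have hc0 : c 0 = χ x := by simp [c]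
    have hc : ContDiff ℝ ∞ c := by fun_prop
    have hcd : HasFDerivAt c ((ContinuousLinearMap.id ℝ ℝ).smulRight w) 0 :=
      ((hasFDerivAt_id (𝕜 := ℝ) (0 : ℝ)).smul_const w).const_add (χ x)
    have hx0 : χ.symm (c 0) = x := by rw [hc0]; exact χ.left_inv hx
    have hct : c 0 ∈ χ.target := by rw [hc0]; exact χ.map_source hx
    refine Submodule.subset_span ⟨χ.symm ∘ c, hx0, ?_, ?_, ?_⟩
    · exact (contMDiffAt_symm_of_mem_maximalAtlas hχ hct).comp 0 hc.contMDiff.contMDiffAt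
    · filter_upwards [hc.continuous.continuousAt.preimage_mem_nhds
        (χ.open_target.mem_nhds hct)] with t ht
      refine (hS _ (χ.map_target ht)).2 ?_
      rw [χ.right_inv ht]
      exact L.add_mem ((hS x hx).1 hxS) (L.smul_mem _ hv)
    · have h1 := ((hχd.mdifferentiableAt_symm hct).hasMFDerivAt.comp 0
        hcd.hasMFDerivAt).mfderiv
      have h2 : mfderiv 𝓘(ℝ, ℝ) 𝓘(ℝ, V) (χ.symm ∘ c) 0 (1 : ℝ) =
          mfderiv 𝓘(ℝ, V) 𝓘(ℝ, V) χ.symm (c 0) w := by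
        rw [h1]
        exact congrArg (mfderiv 𝓘(ℝ, V) 𝓘(ℝ, V) χ.symm (c 0)) (one_smul ℝ w)
      have h3 : mfderiv 𝓘(ℝ, V) 𝓘(ℝ, V) χ.symm (χ x) w = v :=
        DFunLike.congr_fun (hχd.symm_comp_deriv hx) v
      have key : ∀ (x' : N) (h : x' = x) (v' : TangentSpace 𝓘(ℝ, V) x'),
          (v' : V) = v → v = h ▸ v' := by
        rintro x' rfl v' h
        exact h.symm
      refine key _ hx0 _ ?_
      refine h2.trans ?_
      rw [hc0]
      exact h3

end Slices

/-! ### Straightening an affine family of linear equations. -/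

section Shear

variable {B Y K : Type*} [NormedAddCommGroup B] [NormedSpace ℝ B]
  [NormedAddCommGroup Y] [NormedSpace ℝ Y] [NormedAddCommGroup K] [NormedSpace ℝ K]

/-- The diffeomorphism `(x, y, l) ↦ (x, y, l - ρ (x, y))` over an open set. -/
def shear (ρ : B × Y → K) {U : Set (B × Y)} (hU : IsOpen U) (hρ : ContinuousOn ρ U) :
    OpenPartialHomeomorph (B × (Y × K)) (B × (Y × K)) where
  toFun q := (q.1, (q.2.1, q.2.2 - ρ (q.1, q.2.1)))
  invFun q := (q.1, (q.2.1, q.2.2 + ρ (q.1, q.2.1)))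
  source := {q | (q.1, q.2.1) ∈ U}
  target := {q | (q.1, q.2.1) ∈ U}
  map_source' _ h := h
  map_target' _ h := h
  left_inv' q _ := by simp
  right_inv' q _ := by simp
  open_source := hU.preimage (by fun_prop)
  open_target := hU.preimage (by fun_prop)
  continuousOn_toFun := by
    have h : ContinuousOn (fun q : B × (Y × K) => ρ (q.1, q.2.1)) {q | (q.1, q.2.1) ∈ U} :=
      hρ.comp (by fun_prop) fun q hq => hq
    exact continuousOn_fst.prodMk ((continuous_fst.comp continuous_snd).continuousOn.prodMk
      ((continuous_snd.comp continuous_snd).continuousOn.sub h))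
  continuousOn_invFun := by
    have h : ContinuousOn (fun q : B × (Y × K) => ρ (q.1, q.2.1)) {q | (q.1, q.2.1) ∈ U} :=
      hρ.comp (by fun_prop) fun q hq => hq
    exact continuousOn_fst.prodMk ((continuous_fst.comp continuous_snd).continuousOn.prodMk
      ((continuous_snd.comp continuous_snd).continuousOn.add h))

variable {N : Type*} [TopologicalSpace N] [ChartedSpace (B × (Y × K)) N]
  [IsManifold 𝓘(ℝ, B × (Y × K)) ∞ N]

lemma trans_shear_mem_maximalAtlas {φ : OpenPartialHomeomorph N (B × (Y × K))}
    (hφ : φ ∈ IsManifold.maximalAtlas 𝓘(ℝ, B × (Y × K)) ∞ N) {ρ : B × Y → K} {U : Set (B × Y)}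
    (hU : IsOpen U) (hρ : ContDiffOn ℝ ∞ ρ U) :
    φ.trans (shear ρ hU hρ.continuousOn) ∈ IsManifold.maximalAtlas 𝓘(ℝ, B × (Y × K)) ∞ N := by
  have h : ContDiffOn ℝ ∞ (fun q : B × (Y × K) => ρ (q.1, q.2.1)) {q | (q.1, q.2.1) ∈ U} :=
    hρ.comp (by fun_prop) fun q hq => hq
  have h1 : ContDiffOn ℝ ∞ (shear (K := K) ρ hU hρ.continuousOn) {q | (q.1, q.2.1) ∈ U} := by
    exact contDiffOn_fst.prodMk (contDiff_snd.fst.contDiffOn.prodMk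
      (contDiff_snd.snd.contDiffOn.sub h))
  have h2 : ContDiffOn ℝ ∞ (shear (K := K) ρ hU hρ.continuousOn).symm {q | (q.1, q.2.1) ∈ U} := by
    exact contDiffOn_fst.prodMk (contDiff_snd.fst.contDiffOn.prodMk
      (contDiff_snd.snd.contDiffOn.add h))
  refine OpenPartialHomeomorph.mem_maximalAtlas_of_contMDiffOn _ ?_ ?_
  · exact h1.contMDiffOn.comp ((contMDiffOn_of_mem_maximalAtlas hφ).mono fun x hx => hx.1)
      fun x hx => hx.2
  · exact (contMDiffOn_symm_of_mem_maximalAtlas hφ).comp (h2.contMDiffOn.mono fun x hx => hx.1)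
      fun x hx => hx.2

variable [FiniteDimensional ℝ K]
  {W : Type*} [NormedAddCommGroup W] [NormedSpace ℝ W] [FiniteDimensional ℝ W]

/-- A linear map has a linear inverse on its range. -/
lemma exists_rightInverse_on_range {K W : Type*} [AddCommGroup K] [Module ℝ K]
    [AddCommGroup W] [Module ℝ W] (A : K →ₗ[ℝ] W) :
    ∃ R : W →ₗ[ℝ] K, ∀ w ∈ LinearMap.range A, A (R w) = w := by
  obtain ⟨R₀, hR₀⟩ := A.rangeRestrict.exists_rightInverse_of_surjective A.range_rangeRestrict
  obtain ⟨R, hR⟩ := R₀.exists_extend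
  refine ⟨R, fun w hw => ?_⟩
  have h1 : R w = R₀ ⟨w, hw⟩ := LinearMap.congr_fun hR ⟨w, hw⟩
  rw [h1]
  exact congrArg Subtype.val (LinearMap.congr_fun hR₀ ⟨w, hw⟩)

/-- The solution set of `A l = g (x, y)`, where `g` takes values in the range of the linear map
`A`, is a slice in a suitable chart, and its tangent spaces are given by the linearized
equation. -/
lemma exists_slice_chart (A : K →ₗ[ℝ] W) {φ : OpenPartialHomeomorph N (B × (Y × K))}
    (hφ : φ ∈ IsManifold.maximalAtlas 𝓘(ℝ, B × (Y × K)) ∞ N) {U : Set (B × Y)}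
    (hU : IsOpen U) {g : B × Y → W} (hg : ContDiffOn ℝ ∞ g U)
    (hgA : ∀ q ∈ U, g q ∈ LinearMap.range A) (hφU : ∀ z ∈ φ.source, ((φ z).1, (φ z).2.1) ∈ U)
    {S : Set N} (hS : ∀ z ∈ φ.source, z ∈ S ↔ A (φ z).2.2 = g ((φ z).1, (φ z).2.1)) :
    ∃ χ ∈ IsManifold.maximalAtlas 𝓘(ℝ, B × (Y × K)) ∞ N, χ.source = φ.source ∧
      (∀ z ∈ χ.source, z ∈ S ↔ χ z ∈ LinearMap.ker
        (A.comp ((LinearMap.snd ℝ Y K).comp (LinearMap.snd ℝ B (Y × K))))) ∧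
      ∀ z ∈ φ.source, ∀ v : TangentSpace 𝓘(ℝ, B × (Y × K)) z,
        A (mfderiv 𝓘(ℝ, B × (Y × K)) 𝓘(ℝ, B × (Y × K)) χ z v).2.2 =
          A (mfderiv 𝓘(ℝ, B × (Y × K)) 𝓘(ℝ, B × (Y × K)) φ z v).2.2 -
          fderiv ℝ g ((φ z).1, (φ z).2.1)
            ((mfderiv 𝓘(ℝ, B × (Y × K)) 𝓘(ℝ, B × (Y × K)) φ z v).1,
              (mfderiv 𝓘(ℝ, B × (Y × K)) 𝓘(ℝ, B × (Y × K)) φ z v).2.1) := by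
  obtain ⟨R, hR⟩ := exists_rightInverse_on_range A
  set R' : W →L[ℝ] K := LinearMap.toContinuousLinearMap R
  set A' : K →L[ℝ] W := LinearMap.toContinuousLinearMap A
  -- A particular solution, smooth because a single linear inverse `R` on the range of `A` serves
  -- all parameters. Subtracting it makes the equation homogeneous.
  set ρ : B × Y → K := fun q => R' (g q) with hρdef
  have hρ : ContDiffOn ℝ ∞ ρ U := R'.contDiff.comp_contDiffOn hg
  have hAρ : ∀ q ∈ U, A (ρ q) = g q := fun q hq => hR _ (hgA q hq)
  refine ⟨φ.trans (shear ρ hU hρ.continuousOn), trans_shear_mem_maximalAtlas hφ hU hρ,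
    ?_, ?_, ?_⟩
  · ext z
    exact ⟨fun h => h.1, fun h => ⟨h, hφU z h⟩⟩
  · intro z hz
    have hz' : z ∈ φ.source := hz.1
    rw [hS z hz', LinearMap.mem_ker]
    change _ ↔ A ((φ z).2.2 - ρ ((φ z).1, (φ z).2.1)) = 0
    rw [map_sub, hAρ _ (hφU z hz'), sub_eq_zero]
  · intro z hz v
    have hzU := hφU z hz
    set q : B × (Y × K) := φ z with hq
    have hgd : HasFDerivAt g (fderiv ℝ g (q.1, q.2.1)) (q.1, q.2.1) :=
      ((hg.contDiffAt (hU.mem_nhds hzU)).differentiableAt (by simp)).hasFDerivAt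
    let pr : B × (Y × K) →L[ℝ] B × Y := (ContinuousLinearMap.fst ℝ B (Y × K)).prod
      ((ContinuousLinearMap.fst ℝ Y K).comp (ContinuousLinearMap.snd ℝ B (Y × K)))
    have h1 : HasFDerivAt (fun q : B × (Y × K) => ρ (q.1, q.2.1))
        (R'.comp ((fderiv ℝ g (q.1, q.2.1)).comp pr)) q :=
      R'.hasFDerivAt.comp q (HasFDerivAt.comp (g := g) q hgd (pr.hasFDerivAt (x := q)))
    have h2 : HasFDerivAt (shear (K := K) ρ hU hρ.continuousOn)
        ((ContinuousLinearMap.fst ℝ B (Y × K)).prod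
          (((ContinuousLinearMap.fst ℝ Y K).comp (ContinuousLinearMap.snd ℝ B (Y × K))).prod
            (((ContinuousLinearMap.snd ℝ Y K).comp (ContinuousLinearMap.snd ℝ B (Y × K))) -
              R'.comp ((fderiv ℝ g (q.1, q.2.1)).comp pr)))) q :=
      hasFDerivAt_fst.prodMk ((hasFDerivAt_fst.comp q hasFDerivAt_snd).prodMk
        ((hasFDerivAt_snd.comp q hasFDerivAt_snd).sub h1))
    have h3 := (h2.hasMFDerivAt.comp z ((mdifferentiable_of_mem_maximalAtlas
      hφ).mdifferentiableAt hz).hasMFDerivAt).mfderiv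
    -- `A ∘ R` is the identity only on the range of `A`. Differentiating the local identity `A (R (g
    -- p)) = g p` shows that it also fixes the derivative of `g`.
    have h4 : A'.comp (R'.comp (fderiv ℝ g (q.1, q.2.1))) = fderiv ℝ g (q.1, q.2.1) := by
      have h5 := A'.hasFDerivAt.comp (q.1, q.2.1) (R'.hasFDerivAt.comp (q.1, q.2.1) hgd)
      refine h5.unique (hgd.congr_of_eventuallyEq ?_)
      filter_upwards [hU.mem_nhds hzU] with p hp using hAρ p hp
    set w := mfderiv 𝓘(ℝ, B × (Y × K)) 𝓘(ℝ, B × (Y × K)) φ z v with hw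
    have h6 : mfderiv 𝓘(ℝ, B × (Y × K)) 𝓘(ℝ, B × (Y × K))
        (φ.trans (shear ρ hU hρ.continuousOn)) z v = (w.1, (w.2.1,
          w.2.2 - R' (fderiv ℝ g (q.1, q.2.1) (w.1, w.2.1)))) := DFunLike.congr_fun h3 v
    have h7 : A (R' (fderiv ℝ g (q.1, q.2.1) (w.1, w.2.1))) =
        fderiv ℝ g (q.1, q.2.1) (w.1, w.2.1) := DFunLike.congr_fun h4 _
    exact (congrArg (fun p : B × (Y × K) => A p.2.2) h6).trans ((map_sub A _ _).trans
      (congrArg (A w.2.2 - ·) h7))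

end Shear

/-! ### The Lagrangian property. -/

section Lagrangian

lemma reduce_mkQ_apply {V : Type*} [AddCommGroup V] [Module ℝ V] {k : ℕ}
    (Ω : V [⋀^Fin (k + 1)]→ₗ[ℝ] ℝ) (v : V) (w : Fin k → V) :
    reduce Ω (Matrix.vecCons ((flatKer Ω).mkQ v) fun i => (flatKer Ω).mkQ (w i)) =
      Ω (Matrix.vecCons v w) := by
  have h := DFunLike.congr_fun (reduce_mk Ω) (Matrix.vecCons v w)
  rw [AlternatingMap.compLinearMap_apply] at h
  rw [← h]
  congr 1
  funext i
  refine Fin.cases ?_ (fun j => ?_) i <;> simp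

/-- A subspace which equals its orthogonal complement of top order is Lagrangian. -/
lemma isLagrangian_of_forall_mem_iff {V : Type*} [AddCommGroup V] [Module ℝ V] {k : ℕ}
    (Ω : V [⋀^Fin (k + 1)]→ₗ[ℝ] ℝ) (W : Submodule ℝ V)
    (h : ∀ v, v ∈ W ↔ ∀ w : Fin k → V, (∀ i, w i ∈ W) → Ω (Matrix.vecCons v w) = 0) :
    IsLagrangian Ω k W := by
  ext x
  constructor
  · rintro ⟨v, hv, rfl⟩ w hw
    -- In top order all `k` remaining arguments lie in the image of `W`, so each one lifts to `W`.
    choose u hu hwu using fun i => hw i i.isLt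
    obtain rfl : (fun i => (flatKer Ω).mkQ (u i)) = w := funext hwu
    rw [reduce_mkQ_apply]
    exact (h v).1 hv u hu
  · intro hx
    obtain ⟨v, rfl⟩ := Submodule.mkQ_surjective _ x
    refine ⟨v, (h v).2 fun w hw => ?_, rfl⟩
    rw [← reduce_mkQ_apply]
    exact hx _ fun i _ => ⟨w i, hw i, rfl⟩

variable {B F : Type*} [NormedAddCommGroup B] [NormedSpace ℝ B] [FiniteDimensional ℝ B]
  [NormedAddCommGroup F] [NormedSpace ℝ F] [FiniteDimensional ℝ F] {m : ℕ}

/-- Substituting the linearised equation in each summand of `tildeModel_apply` turns the alternating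
sum into the alternation of `Γ`. -/
lemma tildeModel_eq_zero (hm : 1 ≤ m)
    {Γ : B × (F × FormModel B F 2 m) →L[ℝ]
      (B × (F × FormModel B F 2 m)) [⋀^Fin (m + 1)]→L[ℝ] ℝ}
    (hΓ : ContinuousAlternatingMap.alternatizeUncurryFin Γ = 0)
    {X : Fin (m + 1 + 1) → JetModel B F m}
    (hX : ∀ i, flatLin B F m (X i).2.2 = -Γ ((X i).1, (X i).2.1)) :
    tildeModel B F hm X = 0 := by
  have h1 := DFunLike.congr_fun hΓ fun i => ((X i).1, (X i).2.1)
  rw [ContinuousAlternatingMap.alternatizeUncurryFin_apply] at h1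
  rw [tildeModel_apply, neg_eq_zero, ← neg_eq_zero, ← Finset.sum_neg_distrib]
  refine Eq.trans (Finset.sum_congr rfl fun i _ => ?_) h1
  rw [hX, ContinuousAlternatingMap.neg_apply, zsmul_eq_mul]
  push_cast
  rw [mul_neg, neg_neg]
  rfl

/-- A vertical vector projects to `0` in the model of `ℳπ`, so the only surviving summand is the one
where its own jet component is evaluated. -/
lemma tildeModel_vecCons_vertical (hm : 1 ≤ m) (l : B →L[ℝ] F × FormModel B F 2 m)
    (X : Fin (m + 1) → JetModel B F m) :
    tildeModel B F hm (Matrix.vecCons (0, (0, l)) X) =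
      -flatLin B F m l fun j => ((X j).1, (X j).2.1) := by
  rw [tildeModel_apply, Fin.sum_univ_succ, Finset.sum_eq_zero]
  · simp
  · intro i _
    have h : flatLin B F m (X i).2.2 (fun j => ((Matrix.vecCons (0, (0, l)) X
        (i.succ.succAbove j)).1, (Matrix.vecCons (0, (0, l)) X (i.succ.succAbove j)).2.1)) = 0 := by
      refine (flatLin B F m (X i).2.2).map_coord_zero 0 ?_
      simp
    simpa using h

/-- The solutions of the linearized equation of `S_ℋ` form their own orthogonal complement. -/
lemma flatLin_eq_iff_forall_tildeModel (hm : 1 ≤ m)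
    {Γ : B × (F × FormModel B F 2 m) →L[ℝ]
      (B × (F × FormModel B F 2 m)) [⋀^Fin (m + 1)]→L[ℝ] ℝ}
    (hΓ : ContinuousAlternatingMap.alternatizeUncurryFin Γ = 0)
    (hΓr : ∀ x, Γ x ∈ LinearMap.range (flatLin B F m)) (X : JetModel B F m) :
    flatLin B F m X.2.2 = -Γ (X.1, X.2.1) ↔ ∀ w : Fin (m + 1) → JetModel B F m,
      (∀ i, flatLin B F m (w i).2.2 = -Γ ((w i).1, (w i).2.1)) →
        tildeModel B F hm (Matrix.vecCons X w) = 0 := by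
  constructor
  · intro hX w hw
    refine tildeModel_eq_zero hm hΓ fun i => ?_
    refine Fin.cases ?_ (fun j => ?_) i
    · exact hX
    · exact hw j
  · intro h
    -- Solvability: every tangent vector of `ℳπ` lifts to a solution of the linearised equation.
    have hlift : ∀ x : B × (F × FormModel B F 2 m), ∃ l, flatLin B F m l = -Γ x := fun x =>
      Submodule.neg_mem _ (hΓr x)
    choose lift hl using hlift
    -- A solution with the same projection as `X`, so that `X - X₀` is vertical. Pairing with lifts
    -- of arbitrary `x` then forces `flatLin` of the difference to vanish.
    set X₀ : JetModel B F m := (X.1, (X.2.1, lift (X.1, X.2.1))) with hX₀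
    have h1 : flatLin B F m (X.2.2 - X₀.2.2) = 0 := by
      ext x
      set w : Fin (m + 1) → JetModel B F m := fun i => ((x i).1, ((x i).2, lift (x i))) with hw
      have h2 : ∀ i, flatLin B F m (w i).2.2 = -Γ ((w i).1, (w i).2.1) := fun i => hl (x i)
      have h3 : tildeModel B F hm (Matrix.vecCons X₀ w) = 0 := by
        refine tildeModel_eq_zero hm hΓ fun i => ?_
        refine Fin.cases ?_ (fun j => ?_) i
        · exact hl _
        · exact h2 j
      have h4 : X = (0, (0, X.2.2 - X₀.2.2)) + X₀ :=
        Prod.ext (zero_add _).symm (Prod.ext (zero_add _).symm (sub_add_cancel _ _).symm)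
      have h5 := (tildeModel B F hm).toAlternatingMap.map_vecCons_add w
        (0, (0, X.2.2 - X₀.2.2)) X₀
      rw [← h4] at h5
      have h6 : tildeModel B F hm (Matrix.vecCons X w) = tildeModel B F hm
        (Matrix.vecCons (0, (0, X.2.2 - X₀.2.2)) w) + tildeModel B F hm (Matrix.vecCons X₀ w) := h5
      rw [h w h2, h3, add_zero, tildeModel_vecCons_vertical] at h6
      exact neg_eq_zero.1 h6.symm
    rw [map_sub, sub_eq_zero] at h1
    rw [h1]
    exact hl _

variable (B F m) in
/-- The linear subspace of the model in which `S_ℋ` is a slice. -/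
def sliceModel : Submodule ℝ (JetModel B F m) :=
  LinearMap.ker ((flatLin B F m).comp ((LinearMap.snd ℝ (F × FormModel B F 2 m)
    (B →L[ℝ] F × FormModel B F 2 m)).comp (LinearMap.snd ℝ B
      ((F × FormModel B F 2 m) × (B →L[ℝ] F × FormModel B F 2 m)))))

variable {V M E : Type*} [NormedAddCommGroup V] [NormedSpace ℝ V]
  [TopologicalSpace M] [ChartedSpace B M] [TopologicalSpace E] [ChartedSpace V E]
  {π : Fibration B F V M E} {η : VolumeForm B M m}

namespace HamiltonianDensity

variable (H : HamiltonianDensity π η)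

/-- The right-hand side of the equation of `S_ℋ` stays in the range of `flatLin`, a linear subspace;
so do its derivatives, and the constant `flatModel 0` drops out. In the proof, `T` fixes this range
and the identity `T ∘ g = g` is differentiated. -/
lemma range_fderiv_derivModel (hm : 1 ≤ m) (b : Module.Basis (Fin m) ℝ B) {a : AdaptedChart π}
    {q : B × (F × FormModel B F 2 m)} (hq : (q.1, q.2.1) ∈ a.total.target)
    (x : B × (F × FormModel B F 2 m)) :
    fderiv ℝ (H.derivModel a) q x ∈ LinearMap.range (flatLin B F m) := by
  obtain ⟨R, hR⟩ := exists_rightInverse_on_range (flatLin B F m)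
  set T := LinearMap.toContinuousLinearMap ((flatLin B F m).comp R)
  have hd : HasFDerivAt (H.derivModel a) (fderiv ℝ (H.derivModel a) q) q :=
    ((H.contDiffAt_derivModel a hq).differentiableAt (by simp)).hasFDerivAt
  have h1 := hd.neg.sub_const (flatModel B F m 0)
  have h2 := T.hasFDerivAt.comp q h1
  have h3 := h2.unique (h1.congr_of_eventuallyEq (by
    filter_upwards [((formCoords π 2 m).homeo a).open_target.mem_nhds hq] with p hp
    exact hR _ (H.neg_derivModel_sub_mem_range hm b hp)))
  have h4 : flatLin B F m (R (-(fderiv ℝ (H.derivModel a) q x))) =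
      -(fderiv ℝ (H.derivModel a) q x) := DFunLike.congr_fun h3 x
  rw [← neg_mem_iff, ← h4]
  exact ⟨_, rfl⟩

/-- A single chart provides both the slice and the linearised equation, expressed in the adapted
chart where `Ω̃` is constant. -/
lemma exists_slice_chart_lagrangianSet (hm : 1 ≤ m) (b : Module.Basis (Fin m) ℝ B)
    (a : AdaptedChart π) :
    ∃ χ ∈ IsManifold.maximalAtlas 𝓘(ℝ, JetModel B F m) ∞ (Jet (momentumFibration π m)),
      χ.source = {z | z.pt.pt ∈ a.total.source} ∧
      (∀ z ∈ χ.source, z ∈ H.lagrangianSet ↔ χ z ∈ sliceModel B F m) ∧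
      ∀ z : Jet (momentumFibration π m), z.pt.pt ∈ a.total.source →
        ∀ v : TangentSpace 𝓘(ℝ, JetModel B F m) z,
        flatLin B F m (mfderiv 𝓘(ℝ, JetModel B F m) 𝓘(ℝ, JetModel B F m) χ z v).2.2 =
          flatLin B F m (mfderiv 𝓘(ℝ, JetModel B F m) 𝓘(ℝ, JetModel B F m)
            ((jetCoords (momentumFibration π m)).homeo ((formCoords π 2 m).liftChart a)) z v).2.2 +
          fderiv ℝ (H.derivModel a) ((formCoords π 2 m).homeo a z.pt)
            ((mfderiv 𝓘(ℝ, JetModel B F m) 𝓘(ℝ, JetModel B F m)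
              ((jetCoords (momentumFibration π m)).homeo ((formCoords π 2 m).liftChart a)) z v).1,
            (mfderiv 𝓘(ℝ, JetModel B F m) 𝓘(ℝ, JetModel B F m)
              ((jetCoords (momentumFibration π m)).homeo
                ((formCoords π 2 m).liftChart a)) z v).2.1) := by
  set φ := (jetCoords (momentumFibration π m)).homeo ((formCoords π 2 m).liftChart a) with hφ
  have hg : ContDiffOn ℝ ∞ (fun q => -H.derivModel a q - flatModel B F m 0)
      ((formCoords π 2 m).homeo a).target := fun q hq =>
    ((H.contDiffAt_derivModel a hq).neg.sub contDiffAt_const).contDiffWithinAt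
  obtain ⟨χ, hχ, hsrc, hslice, hder⟩ := exists_slice_chart (N := Jet (momentumFibration π m))
    (flatLin B F m) (φ := φ)
    ((jetCoords (momentumFibration π m)).homeo_mem_maximalAtlas _)
    ((formCoords π 2 m).homeo a).open_target hg
    (fun q hq => H.neg_derivModel_sub_mem_range hm b hq)
    (fun z hz => ((formCoords π 2 m).homeo a).map_source (x := z.pt) hz)
    (S := H.lagrangianSet) (fun z hz => H.mem_lagrangianSet_iff hm hz)
  refine ⟨χ, hχ, hsrc, hslice, fun z hz v => (hder z hz v).trans ?_⟩
  have h1 : fderiv ℝ (fun q => -H.derivModel a q - flatModel B F m 0)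
      ((formCoords π 2 m).homeo a z.pt) =
      -fderiv ℝ (H.derivModel a) ((formCoords π 2 m).homeo a z.pt) := by
    rw [fderiv_sub_const, fderiv_fun_neg]
  rw [sub_eq_add_neg]
  congr 1
  exact (congrArg Neg.neg (DFunLike.congr_fun h1 _)).trans (neg_neg _)

theorem isLagrangianSubmanifold_lagrangianSet (hm : 1 ≤ m) (b : Module.Basis (Fin m) ℝ B) :
    IsLagrangianSubmanifold (tildeOmega π m) (m + 1) H.lagrangianSet := by
  constructor
  -- The model slice does not depend on the chart, so one dimension works at all points.
  · refine ⟨Module.finrank ℝ (sliceModel B F m), fun z _ => ?_⟩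
    obtain ⟨a, ha⟩ := π.exists_adaptedChart z.pt.pt
    obtain ⟨χ, hχ, hsrc, hslice, -⟩ := H.exists_slice_chart_lagrangianSet hm b a
    exact ⟨χ, hχ, by rw [hsrc]; exact ha, _, rfl, hslice⟩
  · intro z hzS
    obtain ⟨a, ha⟩ := π.exists_adaptedChart z.pt.pt
    obtain ⟨χ, hχ, hsrc, hslice, hder⟩ := H.exists_slice_chart_lagrangianSet hm b a
    have hzχ : z ∈ χ.source := by rw [hsrc]; exact ha
    set φ := (jetCoords (momentumFibration π m)).homeo ((formCoords π 2 m).liftChart a) with hφ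
    have hφm : φ ∈ IsManifold.maximalAtlas 𝓘(ℝ, JetModel B F m) ∞ _ :=
      (jetCoords (momentumFibration π m)).homeo_mem_maximalAtlas _
    let D : TangentSpace 𝓘(ℝ, JetModel B F m) z ≃L[ℝ] JetModel B F m :=
      (mdifferentiable_of_mem_maximalAtlas hφm).mfderiv (x := z) ha
    set q := (formCoords π 2 m).homeo a z.pt with hq
    have hqt : (q.1, q.2.1) ∈ a.total.target :=
      ((formCoords π 2 m).homeo a).map_source (x := z.pt) ha
    set Γ := fderiv ℝ (H.derivModel a) q with hΓ
    have hT : ∀ v : TangentSpace 𝓘(ℝ, JetModel B F m) z,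
        v ∈ tangentSubmodule (JetModel B F m) H.lagrangianSet z ↔
          flatLin B F m (D v).2.2 =
            -Γ ((D v).1, (D v).2.1) := by
      intro v
      rw [mem_tangentSubmodule_iff_of_slice hχ hslice hzχ hzS, eq_neg_iff_add_eq_zero]
      exact Eq.congr (hder z ha v) rfl
    -- `Ω̃` has degree `m + 2`, so `m + 1` is the top order and the orthogonality condition leaves
    -- no free argument.
    refine isLagrangian_of_forall_mem_iff _ _ fun v => ?_
    have key := flatLin_eq_iff_forall_tildeModel hm (H.extDeriv_derivModel a hqt)
      (H.range_fderiv_derivModel hm b hqt) (D v)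
    have hΩ : ∀ w : Fin (m + 1) → TangentSpace 𝓘(ℝ, JetModel B F m) z,
        tildeOmega π m z (Matrix.vecCons v w) =
          tildeModel B F hm (Matrix.vecCons (D v) fun i => D (w i)) := by
      intro w
      rw [tildeOmega_eq hm ha]
      change tildeModel B F hm _ = tildeModel B F hm _
      congr 1
      funext i
      refine Fin.cases ?_ (fun j => ?_) i <;> rfl
    rw [hT v, key]
    constructor
    · intro h w hw
      exact (hΩ w).trans (h _ fun i => (hT (w i)).1 (hw i))
    · intro h w hw
      have h1 := h (fun i => D.symm (w i)) fun i => (hT _).2 (by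
        rw [D.apply_symm_apply]; exact hw i)
      have h2 := (hΩ _).symm.trans h1
      simpa only [D.apply_symm_apply] using h2

end HamiltonianDensity

end Lagrangian

end TulczyjewTriple

end

theorem mainTheorem4 {m n : ℕ} (hm : 1 ≤ m) {M E : Type*}
    [TopologicalSpace M] [ChartedSpace (EuclideanSpace ℝ (Fin m)) M]
    [IsManifold 𝓘(ℝ, EuclideanSpace ℝ (Fin m)) ∞ M]
    [TopologicalSpace E] [ChartedSpace (EuclideanSpace ℝ (Fin (m + n))) E]
    [IsManifold 𝓘(ℝ, EuclideanSpace ℝ (Fin (m + n))) ∞ E]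
    (π : Fibration (EuclideanSpace ℝ (Fin m)) (EuclideanSpace ℝ (Fin n))
      (EuclideanSpace ℝ (Fin (m + n))) M E)
    (η : VolumeForm (EuclideanSpace ℝ (Fin m)) M m)
    (H : HamiltonianDensity π η) :
    IsPremultisymplectic (tildeOmega π m) ∧
      IsLagrangianSubmanifold (tildeOmega π m) (m + 1) H.lagrangianSet := by
  exact ⟨isPremultisymplectic_tildeOmega hm π,
    H.isLagrangianSubmanifold_lagrangianSet hm (EuclideanSpace.basisFun (Fin m) ℝ).toBasis⟩
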